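/- **Setting.** Let $P=(p_{jk})$ be a $b_0\times b_1$ probability matrix ($p_{jk}\ge 0$, $\sum_{jk}p_{jk}=1$) with marginals $p_{j*}=\sum_k p_{jk}$ and $p_{*k}=\sum_j p_{jk}$; a star always denotes summation over the index it replaces. For $d\ge 1$ put $p_{x_0x_1}=\prod_{i=1}^d p_{x_{0,i}x_{1,i}}$, $p_{x_0*}=\prod_i p_{x_{0,i}*}$ and $p_{*x_1}=\prod_i p_{*x_{1,i}}$ for $x_0\in\{0,\dots,b_0-1\}^d$, $x_1\in\{0,\dots,b_1-1\}^d$, and let the probability of a set be the sum over its elements. A $d$-dimensional *bucketing code* is a finite family of pairs $(B_{0,t},B_{1,t})_{0\le t<T}$ with $B_{0,t}\subset\{0,\dots,b_0-1\}^d$, $B_{1,t}\subset\{0,\dots,b_1-1\}^d$. Its success probability is $S=p_{\bigcup_t B_{0,t}\times B_{1,t}}$, and for real $n_0,n_1>0$ its work is $$W=\sum_{t}\max\bigl(n_0p_{B_{0,t}*},\;n_1p_{*B_{1,t}},\;n_0p_{B_{0,t}*}\,n_1p_{*B_{1,t}}\bigr).$$ $(P,d,n_0,n_1,\tilde S,\tilde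 W)$ is *attainable* if some $d$-dimensional bucketing code has success probability $S\ge\tilde S\ge 0$ and work $W\le\tilde W$ for $n_0,n_1$. Let $$D(P)=\Bigl\{\tfrac1d(\ln n_0,\ln n_1,-\ln S,\ln W)\;:\;d\ge1,\ S>0,\ (P,d,n_0,n_1,S,W)\text{ attainable}\Bigr\}\subset\mathbb R^4,\qquad D_0(P)=\bigcup_{\alpha\ge0}\alpha D(P),$$ and let $D^c(P)$, $D_0^c(P)$ be their closures in $\mathbb R^4$. For nonnegative $R$ vanishing wherever $P$ does, let $K(R\|P)=\sum_{jk}r_{jk}\ln\frac{r_{jk}}{r_{**}p_{jk}}$ (with $0\ln 0=0$), and similarly for vectors. For $N\ge 1$ let $\mathcal R_N$ be the set of families $R=\{r_{i,jk}\ge0\}_{0\le i<N}$ with $r_{*,**}=1$ and $r_{i,jk}=0$ whenever $p_{jk}=0$. For $\mu\ge0$ the *bucketing information* is $$I(P,\lambda_0,\lambda_1,\mu)=\max_{R\in\mathcal R_{b_0b_1}}\Bigl[\lambda_0\sum_iK(R_{i,\cdot*}\|P_{\cdot*})+\lambda_1\sum_iK(R_{i,*\cdot}\|P_{*\cdot})+(1-\mu)K(R_{*,\cdot\cdot}\|P_{\cdot\cdot})-\sum_iK(R_{i,\cdot\cdot}\|P_{\cdot\cdot})\Bigr].$$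 $\mathrm{ConvCone}(A)$ is the set of finite nonnegative linear combinations of elements of $A$, $\mathrm{Cone}(A)=\bigcup_{\alpha\ge0}\alpha A$, and $$D(0)=\mathrm{ConvCone}\{(1,0,0,1),(0,1,0,1),(0,0,1,0),(0,0,0,1),(-1,-1,0,-1)\},\qquad D_0(0)=D(0)+\mathrm{Cone}\{(0,0,-1,1)\}.$$ **Theorem.** For every probability matrix $P$: 1. $D^c(P)$ is the set of all $(m_0,m_1,s,w)\in\mathbb R^4$ with $s\ge0$ such that $w\ge\lambda_0m_0+\lambda_1m_1-\mu s-I(P,\lambda_0,\lambda_1,\mu)$ for all real $\lambda_0,\lambda_1\le1\le\lambda_0+\lambda_1$ and $\mu\ge0$. 2. Equivalently, for every $N\ge b_0b_1$, $$D^c(P)=D(0)+\mathrm{Conv}\Bigl\{\Bigl(\sum_iK(R_{i,\cdot*}\|P_{\cdot*}),\ \sum_iK(R_{i,*\cdot}\|P_{*\cdot}),\ K(R_{*,\cdot\cdot}\|P_{\cdot\cdot}),\ -K(R_{*,\cdot\cdot}\|P_{\cdot\cdot})+\sum_iK(R_{i,\cdot\cdot}\|P_{\cdot\cdot})\Bigr):R\in\mathcal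 R_N\Bigr\}.$$ 3. (Unlimited data.) $$D_0^c(P)=\{(m_0,m_1,s,w):s\ge0\}\cap\Bigl[D_0(0)+\overline{\mathrm{ConvCone}\bigl\{\bigl(K(Q_{\cdot*}\|P_{\cdot*}),\,K(Q_{*\cdot}\|P_{*\cdot}),\,K(Q_{\cdot\cdot}\|P_{\cdot\cdot}),\,0\bigr)\bigr\}_Q}\,\Bigr],$$ where $Q$ runs over all $b_0\times b_1$ probability matrices with $q_{jk}=0$ whenever $p_{jk}=0$, and the bar denotes closure. -/

import Mathlib

open scoped Pointwise

/-- `P` is a `b₀ × b₁` probability matrix. -/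
def IsProbMatrix {b₀ b₁ : ℕ} (P : Matrix (Fin b₀) (Fin b₁) ℝ) : Prop :=
  (∀ j k, 0 ≤ P j k) ∧ ∑ j, ∑ k, P j k = 1

/-- The row marginal `p_{j*}`. -/
def rowMarg {b₀ b₁ : ℕ} (P : Matrix (Fin b₀) (Fin b₁) ℝ) (j : Fin b₀) : ℝ := ∑ k, P j k

/-- The column marginal `p_{*k}`. -/
def colMarg {b₀ b₁ : ℕ} (P : Matrix (Fin b₀) (Fin b₁) ℝ) (k : Fin b₁) : ℝ := ∑ j, P j k

/-! ### Bucketing codes -/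

/-- A `d`-dimensional bucketing code over alphabets of sizes `b₀`, `b₁`: finitely many pairs of
(data independent) buckets. -/
structure BucketingCode (b₀ b₁ d : ℕ) where
  /-- number of bucket pairs -/
  T : ℕ
  /-- buckets for the first bag -/
  B₀ : Fin T → Finset (Fin d → Fin b₀)
  /-- buckets for the second bag -/
  B₁ : Fin T → Finset (Fin d → Fin b₁)

namespace BucketingCode

variable {b₀ b₁ d : ℕ}

/-- The probability `p_{B₀*}` that a random point of the first bag lies in `B`. -/
def prob₀ (P : Matrix (Fin b₀) (Fin b₁) ℝ) (B : Finset (Fin d → Fin b₀)) : ℝ :=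
  ∑ x ∈ B, ∏ i, rowMarg P (x i)

/-- The probability `p_{*B₁}` that a random point of the second bag lies in `B`. -/
def prob₁ (P : Matrix (Fin b₀) (Fin b₁) ℝ) (B : Finset (Fin d → Fin b₁)) : ℝ :=
  ∑ x ∈ B, ∏ i, colMarg P (x i)

/-- The success probability: the probability that the special pair lies in
`⋃ₜ B₀,ₜ × B₁,ₜ`. -/
def success (P : Matrix (Fin b₀) (Fin b₁) ℝ) (C : BucketingCode b₀ b₁ d) : ℝ :=
  ∑ x ∈ Finset.univ.biUnion (fun t => C.B₀ t ×ˢ C.B₁ t), ∏ i, P (x.1 i) (x.2 i)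

/-- The work of a bucketing code for (expected) set sizes `n₀`, `n₁`. -/
noncomputable def work (P : Matrix (Fin b₀) (Fin b₁) ℝ) (C : BucketingCode b₀ b₁ d)
    (n₀ n₁ : ℝ) : ℝ :=
  ∑ t, max (max (n₀ * prob₀ P (C.B₀ t)) (n₁ * prob₁ P (C.B₁ t)))
    (n₀ * prob₀ P (C.B₀ t) * (n₁ * prob₁ P (C.B₁ t)))

end BucketingCode

/-- `(P, d, n₀, n₁, S, W)` is attainable: some `d`-dimensional bucketing code has success
probability at least `S` and work at most `W`. -/
def Attainable {b₀ b₁ : ℕ} (P : Matrix (Fin b₀) (Fin b₁) ℝ) (d : ℕ) (n₀ n₁ S W : ℝ) : Prop :=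
  0 < n₀ ∧ 0 < n₁ ∧ 0 ≤ S ∧
    ∃ C : BucketingCode b₀ b₁ d, S ≤ C.success P ∧ C.work P n₀ n₁ ≤ W

/-- The log-attainable set `D(P)`. The condition `0 < S` makes `-ln S` a real number; it forces
the work to be positive, so `ln W` is a real number as well. -/
def logAttainable {b₀ b₁ : ℕ} (P : Matrix (Fin b₀) (Fin b₁) ℝ) : Set (ℝ × ℝ × ℝ × ℝ) :=
  {x | ∃ (d : ℕ) (n₀ n₁ S W : ℝ), 0 < d ∧ 0 < S ∧ Attainable P d n₀ n₁ S W ∧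
    x = (d : ℝ)⁻¹ • (Real.log n₀, Real.log n₁, -Real.log S, Real.log W)}

/-- `Cone(A) = ⋃_{α ≥ 0} α A`. -/
def rayCone (A : Set (ℝ × ℝ × ℝ × ℝ)) : Set (ℝ × ℝ × ℝ × ℝ) :=
  ⋃ α ∈ Set.Ici (0 : ℝ), α • A

/-- The log-attainable cone `D₀(P)`. -/
def logAttainableCone {b₀ b₁ : ℕ} (P : Matrix (Fin b₀) (Fin b₁) ℝ) : Set (ℝ × ℝ × ℝ × ℝ) :=
  rayCone (logAttainable P)

/-! ### Divergence and bucketing information -/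

/-- The extended Kullback-Leibler divergence `K(r‖p) = ∑ⱼ rⱼ ln (rⱼ / (r_* pⱼ))` of a nonnegative
vector `r`, with `0 ln 0 = 0`. It is used only when `r` vanishes wherever `p` does (otherwise the
divergence is `+∞`). -/
noncomputable def kl {ι : Type*} [Fintype ι] (r p : ι → ℝ) : ℝ :=
  ∑ j, r j * Real.log (r j / ((∑ j', r j') * p j))

/-- `K(R_{··}‖P_{··})`. -/
noncomputable def klJoint {b₀ b₁ : ℕ} (R P : Matrix (Fin b₀) (Fin b₁) ℝ) : ℝ :=
  kl (fun jk : Fin b₀ × Fin b₁ => R jk.1 jk.2) (fun jk => P jk.1 jk.2)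

/-- `K(R_{·*}‖P_{·*})`. -/
noncomputable def klRow {b₀ b₁ : ℕ} (R P : Matrix (Fin b₀) (Fin b₁) ℝ) : ℝ :=
  kl (rowMarg R) (rowMarg P)

/-- `K(R_{*·}‖P_{*·})`. -/
noncomputable def klCol {b₀ b₁ : ℕ} (R P : Matrix (Fin b₀) (Fin b₁) ℝ) : ℝ :=
  kl (colMarg R) (colMarg P)

/-- The families `{r_{i,jk} ≥ 0}` with `N` values of `i` and `r_{*,**} = 1`, for which all the
divergences from `P` are finite, i.e. `r_{i,jk} = 0` whenever `p_{jk} = 0`. -/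
def finiteFamilies {b₀ b₁ : ℕ} (P : Matrix (Fin b₀) (Fin b₁) ℝ) (N : ℕ) :
    Set (Fin N → Matrix (Fin b₀) (Fin b₁) ℝ) :=
  {R | (∀ i j k, 0 ≤ R i j k) ∧ ∑ i, ∑ j, ∑ k, R i j k = 1 ∧
    ∀ i j k, P j k = 0 → R i j k = 0}

/-- The function maximized in the definition of the bucketing information. -/
noncomputable def infoObjective {b₀ b₁ : ℕ} (P : Matrix (Fin b₀) (Fin b₁) ℝ) (l₀ l₁ μ : ℝ)
    {N : ℕ} (R : Fin N → Matrix (Fin b₀) (Fin b₁) ℝ) : ℝ :=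
  l₀ * ∑ i, klRow (R i) P + l₁ * ∑ i, klCol (R i) P
    + (1 - μ) * klJoint (∑ i, R i) P - ∑ i, klJoint (R i) P

/-- The bucketing information `I(P, λ₀, λ₁, μ)`. The supremum is a maximum, see
`isGreatest_bucketingInfo`. -/
noncomputable def bucketingInfo {b₀ b₁ : ℕ} (P : Matrix (Fin b₀) (Fin b₁) ℝ) (l₀ l₁ μ : ℝ) : ℝ :=
  sSup (infoObjective P l₀ l₁ μ '' finiteFamilies P (b₀ * b₁))

/-! ### The core cones and the divergence vectors -/

/-- `ConvCone(A)`: all finite nonnegative linear combinations of elements of `A`. -/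
def convCone (A : Set (ℝ × ℝ × ℝ × ℝ)) : Set (ℝ × ℝ × ℝ × ℝ) :=
  (PointedCone.hull ℝ A : Set (ℝ × ℝ × ℝ × ℝ))

/-- The common core `D(0)`. -/
def commonCore : Set (ℝ × ℝ × ℝ × ℝ) :=
  convCone {(1, 0, 0, 1), (0, 1, 0, 1), (0, 0, 1, 0), (0, 0, 0, 1), (-1, -1, 0, -1)}

/-- The extended common core `D₀(0)`. -/
def extendedCore : Set (ℝ × ℝ × ℝ × ℝ) :=
  commonCore + rayCone {(0, 0, -1, 1)}

/-- The divergence vectors of all families `{r_{i,jk}}` with `N` values of `i`. -/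
def divergenceVectors {b₀ b₁ : ℕ} (P : Matrix (Fin b₀) (Fin b₁) ℝ) (N : ℕ) :
    Set (ℝ × ℝ × ℝ × ℝ) :=
  (fun R : Fin N → Matrix (Fin b₀) (Fin b₁) ℝ =>
    (∑ i, klRow (R i) P, ∑ i, klCol (R i) P, klJoint (∑ i, R i) P,
      -klJoint (∑ i, R i) P + ∑ i, klJoint (R i) P)) '' finiteFamilies P N

/-- The vectors `(K(Q_{·*}‖P_{·*}), K(Q_{*·}‖P_{*·}), K(Q_{··}‖P_{··}), 0)`, where `Q` runs over the
probability matrices with finite divergence from `P`. -/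
def singleDivergenceVectors {b₀ b₁ : ℕ} (P : Matrix (Fin b₀) (Fin b₁) ℝ) :
    Set (ℝ × ℝ × ℝ × ℝ) :=
  (fun Q : Matrix (Fin b₀) (Fin b₁) ℝ => (klRow Q P, klCol Q P, klJoint Q P, 0)) ''
    {Q | IsProbMatrix Q ∧ ∀ j k, P j k = 0 → Q j k = 0}

/-! ### The maximum in the bucketing information is attained -/

theorem kl_eq {ι : Type*} [Fintype ι] {r p : ι → ℝ} (hr : ∀ j, 0 ≤ r j)
    (h : ∀ j, p j = 0 → r j = 0) :
    kl r p = Real.negMulLog (∑ j, r j) - ∑ j, Real.negMulLog (r j)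
      - ∑ j, r j * Real.log (p j) := by
  unfold kl
  have key : ∀ j, r j * Real.log (r j / ((∑ j', r j') * p j)) =
      -(r j * Real.log (∑ j', r j')) - Real.negMulLog (r j) - r j * Real.log (p j) := by
    intro j
    by_cases h0 : r j = 0
    · simp [h0]
    · have hs : ∑ j', r j' ≠ 0 := fun hs =>
        h0 ((Finset.sum_eq_zero_iff_of_nonneg (fun i _ => hr i)).1 hs j (Finset.mem_univ j))
      have hp : p j ≠ 0 := fun hp => h0 (h j hp)
      rw [Real.log_div h0 (mul_ne_zero hs hp), Real.log_mul hs hp, Real.negMulLog]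
      ring
  rw [Finset.sum_congr rfl (fun j _ => key j), Finset.sum_sub_distrib, Finset.sum_sub_distrib,
    Finset.sum_neg_distrib, ← Finset.sum_mul, Real.negMulLog]
  ring

theorem continuousOn_kl {ι X : Type*} [Fintype ι] [TopologicalSpace X] {s : Set X}
    {f : X → ι → ℝ} {p : ι → ℝ} (hf : Continuous f) (hr : ∀ x ∈ s, ∀ j, 0 ≤ f x j)
    (h : ∀ x ∈ s, ∀ j, p j = 0 → f x j = 0) : ContinuousOn (fun x => kl (f x) p) s := by
  have hc : Continuous fun x => Real.negMulLog (∑ j, f x j) - ∑ j, Real.negMulLog (f x j)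
      - ∑ j, f x j * Real.log (p j) := by
    have hfj : ∀ j, Continuous fun x => f x j := fun j => (continuous_apply j).comp hf
    have := Real.continuous_negMulLog
    fun_prop
  exact hc.continuousOn.congr fun x hx => kl_eq (hr x hx) (h x hx)

theorem isCompact_finiteFamilies {b₀ b₁ : ℕ} (P : Matrix (Fin b₀) (Fin b₁) ℝ) (N : ℕ) :
    IsCompact (finiteFamilies P N) := by
  have hK : IsCompact (Set.univ.pi fun _ : Fin N => Set.univ.pi fun _ : Fin b₀ =>
      Set.univ.pi fun _ : Fin b₁ => Set.Icc (0 : ℝ) 1) :=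
    isCompact_univ_pi fun _ => isCompact_univ_pi fun _ => isCompact_univ_pi fun _ => isCompact_Icc
  have hc : ∀ i j k, Continuous fun R : Fin N → Matrix (Fin b₀) (Fin b₁) ℝ => R i j k :=
    fun i j k => (continuous_apply_apply j k).comp (continuous_apply i)
  refine IsCompact.of_isClosed_subset hK ?_ ?_
  · have e : finiteFamilies P N = (⋂ i, ⋂ j, ⋂ k, {R | 0 ≤ R i j k}) ∩
        ({R | ∑ i, ∑ j, ∑ k, R i j k = 1} ∩
          ⋂ i, ⋂ j, ⋂ k, ⋂ (_ : P j k = 0), {R | R i j k = 0}) := by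
      ext R
      simp [finiteFamilies]
    rw [e]
    refine IsClosed.inter ?_ (IsClosed.inter ?_ ?_)
    · exact isClosed_iInter fun i => isClosed_iInter fun j => isClosed_iInter fun k =>
        isClosed_le continuous_const (hc i j k)
    · exact isClosed_eq (by fun_prop) continuous_const
    · exact isClosed_iInter fun i => isClosed_iInter fun j => isClosed_iInter fun k =>
        isClosed_iInter fun _ => isClosed_eq (hc i j k) continuous_const
  · rintro R ⟨h0, h1, -⟩ i - j - k -
    refine ⟨h0 i j k, ?_⟩
    calc R i j k ≤ ∑ k, R i j k :=
          Finset.single_le_sum (fun k _ => h0 i j k) (Finset.mem_univ k)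
      _ ≤ ∑ j, ∑ k, R i j k :=
          Finset.single_le_sum (f := fun j => ∑ k, R i j k)
            (fun j _ => Finset.sum_nonneg fun k _ => h0 i j k) (Finset.mem_univ j)
      _ ≤ ∑ i, ∑ j, ∑ k, R i j k :=
          Finset.single_le_sum (f := fun i => ∑ j, ∑ k, R i j k)
            (fun i _ => Finset.sum_nonneg fun j _ => Finset.sum_nonneg fun k _ => h0 i j k)
            (Finset.mem_univ i)
      _ = 1 := h1

theorem finiteFamilies_nonempty {b₀ b₁ : ℕ} {P : Matrix (Fin b₀) (Fin b₁) ℝ}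
    (hP : IsProbMatrix P) : (finiteFamilies P (b₀ * b₁)).Nonempty := by
  have h0 : 0 < b₀ := by
    rcases Nat.eq_zero_or_pos b₀ with rfl | h
    · simpa using hP.2
    · exact h
  have h1 : 0 < b₁ := by
    rcases Nat.eq_zero_or_pos b₁ with rfl | h
    · simpa using hP.2
    · exact h
  let i₀ : Fin (b₀ * b₁) := ⟨0, Nat.mul_pos h0 h1⟩
  refine ⟨fun i => if i = i₀ then P else 0, ?_, ?_, ?_⟩
  · intro i j k
    by_cases h : i = i₀ <;> simp [h, hP.1 j k]
  · rw [Finset.sum_eq_single i₀]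
    · simpa using hP.2
    · intro i _ h
      simp [h]
    · simp
  · intro i j k h
    by_cases h' : i = i₀ <;> simp [h', h]

theorem isGreatest_bucketingInfo {b₀ b₁ : ℕ} {P : Matrix (Fin b₀) (Fin b₁) ℝ}
    (hP : IsProbMatrix P) (l₀ l₁ μ : ℝ) :
    IsGreatest (infoObjective P l₀ l₁ μ '' finiteFamilies P (b₀ * b₁))
      (bucketingInfo P l₀ l₁ μ) := by
  refine ((isCompact_finiteFamilies P _).image_of_continuousOn ?_).isGreatest_sSup
    ((finiteFamilies_nonempty hP).image _)
  have hc : ∀ i j k, Continuous fun R : Fin (b₀ * b₁) → Matrix (Fin b₀) (Fin b₁) ℝ => R i j k :=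
    fun i j k => (continuous_apply_apply j k).comp (continuous_apply i)
  have hrow : ∀ i, ContinuousOn (fun R : Fin (b₀ * b₁) → Matrix (Fin b₀) (Fin b₁) ℝ =>
      klRow (R i) P) (finiteFamilies P (b₀ * b₁)) := by
    intro i
    refine continuousOn_kl (continuous_pi fun j => ?_) ?_ ?_
    · unfold rowMarg
      fun_prop
    · exact fun R hR j => Finset.sum_nonneg fun k _ => hR.1 i j k
    · intro R hR j hj
      exact Finset.sum_eq_zero fun k hk => hR.2.2 i j k
        ((Finset.sum_eq_zero_iff_of_nonneg fun k _ => hP.1 j k).1 hj k hk)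
  have hcol : ∀ i, ContinuousOn (fun R : Fin (b₀ * b₁) → Matrix (Fin b₀) (Fin b₁) ℝ =>
      klCol (R i) P) (finiteFamilies P (b₀ * b₁)) := by
    intro i
    refine continuousOn_kl (continuous_pi fun k => ?_) ?_ ?_
    · unfold colMarg
      fun_prop
    · exact fun R hR k => Finset.sum_nonneg fun j _ => hR.1 i j k
    · intro R hR k hk
      exact Finset.sum_eq_zero fun j hj => hR.2.2 i j k
        ((Finset.sum_eq_zero_iff_of_nonneg fun j _ => hP.1 j k).1 hk j hj)
  have hjoint : ∀ i, ContinuousOn (fun R : Fin (b₀ * b₁) → Matrix (Fin b₀) (Fin b₁) ℝ =>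
      klJoint (R i) P) (finiteFamilies P (b₀ * b₁)) := by
    intro i
    exact continuousOn_kl (continuous_pi fun jk => hc i jk.1 jk.2)
      (fun R hR jk => hR.1 i jk.1 jk.2) (fun R hR jk h => hR.2.2 i jk.1 jk.2 h)
  have htot : ContinuousOn (fun R : Fin (b₀ * b₁) → Matrix (Fin b₀) (Fin b₁) ℝ =>
      klJoint (∑ i, R i) P) (finiteFamilies P (b₀ * b₁)) := by
    refine continuousOn_kl (continuous_pi fun jk => ?_) ?_ ?_
    · simp only [Matrix.sum_apply]
      fun_prop
    · intro R hR jk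
      simp only [Matrix.sum_apply]
      exact Finset.sum_nonneg fun i _ => hR.1 i jk.1 jk.2
    · intro R hR jk h
      simp only [Matrix.sum_apply]
      exact Finset.sum_eq_zero fun i _ => hR.2.2 i jk.1 jk.2 h
  unfold infoObjective
  fun_prop

/-! The first two statements rest on a converse, a construction and a separation argument between
them.

Converse. For λ₀, λ₁ ≤ 1 ≤ λ₀ + λ₁ the work of a bucket pair of probabilities p, q is at least
(n₀p)^λ₀ (n₁q)^λ₁ (`rpow_mul_rpow_le_max`). It remains to bound ∑ₜ p^λ₀ q^λ₁ below by S^μ exp(-dI).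
With the indicators of the buckets replaced by positive functions this becomes an inequality that
tensorizes: `one_letter_log_bound` is the case of one coordinate, obtained by testing I on an
exponentially tilted family, and `tensorized_bound` is the induction. A code may have any number T
of buckets, while I allows only b₀b₁ matrices. This is harmless: for a fixed total matrix the
objective is a sum of functions homogeneous of degree one, so a Carathéodory reduction
(`exists_conic_reduction`, `infoObjective_le_bucketingInfo`) removes the surplus.

Construction. A family R is read as a joint law of a label i and a letter pair (j, k). Buckets are
indexed by label words, and a bucket consists of the words having the prescribed joint type with its
label word. A greedy choice of labels covers half of a joint type class with about exp(d · mutual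
information of label and letter pair) buckets (`attainableOn_typeCode`). Stirling's formula turns
the sizes of type classes into entropies, so every divergence vector is a limit of attainable points
(`divergenceVectors_subset_closure`).

Separation. The closure of the attainable set is convex, by concatenation of codes, and absorbs the
common core. By Hahn–Banach, a closed convex set with these properties that contains the divergence
vectors contains all points obeying the information bounds (`infoPolar_subset`). Applied to the
closure and to core plus hull, this gives both descriptions.

Unlimited data. Subadditivity of divergence puts the cone inside the right-hand side, which is
closed by `isClosed_extendedCore_add`. Conversely, the two-member family {εQ, P - εQ} sums to P and
its second member costs only O(ε²). Dividing by ε trades the success exponent K(Q‖P) for an equal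
amount of work (`single_split_mem_closure_cone`), which realizes the extra ray (0, 0, -1, 1) as long
as s stays nonnegative. -/

/-! ### Divergence of vectors: log-sum inequality, homogeneity, subadditivity. -/

section Divergence

theorem sub_le_mul_log_div {a b : ℝ} (ha : 0 ≤ a) (hb : 0 ≤ b) (h : b = 0 → a = 0) :
    a - b ≤ a * Real.log (a / b) := by
  rcases ha.eq_or_lt with rfl | ha'
  · simpa using hb
  have hb' : 0 < b := lt_of_le_of_ne hb fun h0 => ha'.ne' (h h0.symm)
  have := Real.one_sub_inv_le_log_of_pos (div_pos ha' hb')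
  have h2 := mul_le_mul_of_nonneg_left this ha
  rw [inv_div] at h2
  have : a * (1 - b / a) = a - b := by field_simp
  linarith

/-- The log-sum inequality. -/
theorem log_sum_inequality {ι : Type*} (s : Finset ι) {a b : ι → ℝ} (ha : ∀ i ∈ s, 0 ≤ a i)
    (hb : ∀ i ∈ s, 0 ≤ b i) (h : ∀ i ∈ s, b i = 0 → a i = 0) :
    (∑ i ∈ s, a i) * Real.log ((∑ i ∈ s, a i) / ∑ i ∈ s, b i) ≤
      ∑ i ∈ s, a i * Real.log (a i / b i) := by
  set A := ∑ i ∈ s, a i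
  set B := ∑ i ∈ s, b i
  have hA : 0 ≤ A := Finset.sum_nonneg ha
  have hB : 0 ≤ B := Finset.sum_nonneg hb
  rcases hA.eq_or_lt with hA0 | hA0
  · have h0 : ∀ i ∈ s, a i = 0 := (Finset.sum_eq_zero_iff_of_nonneg ha).1 hA0.symm
    rw [← hA0, zero_mul, Finset.sum_eq_zero fun i hi => by rw [h0 i hi, zero_mul]]
  have hB0 : 0 < B := by
    refine lt_of_le_of_ne hB fun h0 => hA0.ne' ?_
    exact Finset.sum_eq_zero fun i hi =>
      h i hi ((Finset.sum_eq_zero_iff_of_nonneg hb).1 h0.symm i hi)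
  -- Rescaling `b` to have the total of `a` makes the linear terms cancel after summation.
  have key : ∀ i ∈ s, a i - b i * (A / B) ≤ a i * Real.log (a i / b i) - a i * Real.log (A / B) := by
    intro i hi
    have h1 := sub_le_mul_log_div (ha i hi) (mul_nonneg (hb i hi) (div_pos hA0 hB0).le)
      (fun h0 => h i hi ((mul_eq_zero.1 h0).resolve_right (div_pos hA0 hB0).ne'))
    refine h1.trans (le_of_eq ?_)
    by_cases hai : a i = 0
    · simp [hai]
    have hbi : b i ≠ 0 := fun h0 => hai (h i hi h0)
    rw [← div_div, Real.log_div (div_ne_zero hai hbi) (div_pos hA0 hB0).ne', mul_sub]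
  have := Finset.sum_le_sum key
  rw [Finset.sum_sub_distrib, Finset.sum_sub_distrib, ← Finset.sum_mul, ← Finset.sum_mul] at this
  have h3 : B * (A / B) = A := by field_simp
  change A - B * (A / B) ≤ _ - A * Real.log (A / B) at this
  linarith

variable {ι : Type*} [Fintype ι]

/-- One half of the Gibbs variational principle, in homogeneous form: the log-sum inequality against
the tilted weights p f scaled by the mass of `r`. The choice f = 1 gives nonnegativity of the
divergence. -/
theorem sum_mul_log_sub_kl_le {r p f : ι → ℝ} (hr : ∀ j, 0 ≤ r j) (hp : ∀ j, 0 ≤ p j)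
    (h : ∀ j, p j = 0 → r j = 0) (hf : ∀ j, 0 < f j) :
    ∑ j, r j * Real.log (f j) - kl r p ≤ (∑ j, r j) * Real.log (∑ j, p j * f j) := by
  set ρ := ∑ j, r j
  have hρ : 0 ≤ ρ := Finset.sum_nonneg fun j _ => hr j
  have h0 : ∀ j, ρ = 0 → r j = 0 := fun j h' =>
    (Finset.sum_eq_zero_iff_of_nonneg fun i _ => hr i).1 h' j (Finset.mem_univ j)
  have h1 := log_sum_inequality Finset.univ (a := r) (b := fun j => ρ * (p j * f j))
    (fun j _ => hr j) (fun j _ => mul_nonneg hρ (mul_nonneg (hp j) (hf j).le)) (by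
      intro j _ hj
      rcases mul_eq_zero.1 hj with h' | h'
      · exact h0 j h'
      · exact h j ((mul_eq_zero.1 h').resolve_right (hf j).ne'))
  rw [← Finset.mul_sum] at h1
  have h2 : ∑ j, r j * Real.log (r j / (ρ * (p j * f j))) =
      kl r p - ∑ j, r j * Real.log (f j) := by
    rw [kl, ← Finset.sum_sub_distrib]
    refine Finset.sum_congr rfl fun j _ => ?_
    by_cases hj : r j = 0
    · simp [hj]
    have hp' : p j ≠ 0 := fun h' => hj (h j h')
    have hρ' : ρ ≠ 0 := fun h' => hj (h0 j h')
    rw [← mul_assoc, ← div_div, Real.log_div (div_ne_zero hj (mul_ne_zero hρ' hp')) (hf j).ne',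
      mul_sub]
  have h3 : ρ * Real.log (ρ / (ρ * ∑ j, p j * f j)) = -(ρ * Real.log (∑ j, p j * f j)) := by
    by_cases hρ' : ρ = 0
    · simp [hρ']
    rw [← div_div, div_self hρ', one_div, Real.log_inv, mul_neg]
  change ρ * Real.log (ρ / (ρ * ∑ j, p j * f j)) ≤ _ at h1
  rw [h2, h3] at h1
  linarith

theorem kl_nonneg {r p : ι → ℝ} (hr : ∀ j, 0 ≤ r j) (hp : ∀ j, 0 ≤ p j) (hp1 : ∑ j, p j = 1)
    (h : ∀ j, p j = 0 → r j = 0) : 0 ≤ kl r p := by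
  have := sum_mul_log_sub_kl_le hr hp h (f := fun _ => 1) (fun _ => one_pos)
  simpa [hp1] using this

theorem kl_smul (c : ℝ) (r p : ι → ℝ) : kl (fun j => c * r j) p = c * kl r p := by
  rcases eq_or_ne c 0 with rfl | hc
  · simp [kl]
  unfold kl
  rw [Finset.mul_sum]
  refine Finset.sum_congr rfl fun j _ => ?_
  rw [← Finset.mul_sum, mul_assoc c _ (p j), mul_div_mul_left _ _ hc, mul_assoc]

/-- The log-sum inequality over the members, applied to each letter separately. Together with
homogeneity it expresses joint convexity in the unnormalized form needed for families. -/
theorem kl_sum_le {κ : Type*} (s : Finset κ) {r : κ → ι → ℝ} {p : ι → ℝ}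
    (hr : ∀ i ∈ s, ∀ j, 0 ≤ r i j) (hp : ∀ j, 0 ≤ p j) (h : ∀ i ∈ s, ∀ j, p j = 0 → r i j = 0) :
    kl (fun j => ∑ i ∈ s, r i j) p ≤ ∑ i ∈ s, kl (r i) p := by
  unfold kl
  rw [Finset.sum_comm (s := s)]
  refine Finset.sum_le_sum fun j _ => ?_
  have h1 := log_sum_inequality s (a := fun i => r i j) (b := fun i => (∑ j', r i j') * p j)
    (fun i hi => hr i hi j)
    (fun i hi => mul_nonneg (Finset.sum_nonneg fun j _ => hr i hi j) (hp j)) (by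
      intro i hi h0
      rcases mul_eq_zero.1 h0 with h' | h'
      · exact (Finset.sum_eq_zero_iff_of_nonneg (f := r i) fun j _ => hr i hi j).1 h' j
          (Finset.mem_univ j)
      · exact h i hi j h')
  rw [← Finset.sum_mul] at h1
  rwa [Finset.sum_comm (s := Finset.univ)]

end Divergence

/-! ### Divergences of matrices and of their marginals. -/

section MatrixDivergence

variable {b₀ b₁ : ℕ} {P R : Matrix (Fin b₀) (Fin b₁) ℝ}

/-- `R` is a nonnegative matrix of finite divergence from `P`. -/
structure FiniteDiv (P R : Matrix (Fin b₀) (Fin b₁) ℝ) : Prop where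
  nonneg : ∀ j k, 0 ≤ R j k
  eq_zero : ∀ j k, P j k = 0 → R j k = 0

theorem FiniteDiv.row_nonneg (hR : FiniteDiv P R) (j : Fin b₀) : 0 ≤ rowMarg R j :=
  Finset.sum_nonneg fun k _ => hR.nonneg j k

theorem FiniteDiv.col_nonneg (hR : FiniteDiv P R) (k : Fin b₁) : 0 ≤ colMarg R k :=
  Finset.sum_nonneg fun j _ => hR.nonneg j k

theorem FiniteDiv.row_eq_zero (hP : IsProbMatrix P) (hR : FiniteDiv P R) (j : Fin b₀)
    (h : rowMarg P j = 0) : rowMarg R j = 0 :=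
  Finset.sum_eq_zero fun k hk => hR.eq_zero j k
    ((Finset.sum_eq_zero_iff_of_nonneg fun k _ => hP.1 j k).1 h k hk)

theorem FiniteDiv.col_eq_zero (hP : IsProbMatrix P) (hR : FiniteDiv P R) (k : Fin b₁)
    (h : colMarg P k = 0) : colMarg R k = 0 :=
  Finset.sum_eq_zero fun j hj => hR.eq_zero j k
    ((Finset.sum_eq_zero_iff_of_nonneg fun j _ => hP.1 j k).1 h j hj)

theorem IsProbMatrix.finiteDiv (hP : IsProbMatrix P) : FiniteDiv P P := ⟨hP.1, fun _ _ h => h⟩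

theorem IsProbMatrix.row_sum (hP : IsProbMatrix P) : ∑ j, rowMarg P j = 1 := hP.2

theorem IsProbMatrix.row_nonneg (hP : IsProbMatrix P) (j : Fin b₀) : 0 ≤ rowMarg P j :=
  hP.finiteDiv.row_nonneg j

theorem IsProbMatrix.col_nonneg (hP : IsProbMatrix P) (k : Fin b₁) : 0 ≤ colMarg P k :=
  hP.finiteDiv.col_nonneg k

theorem sum_colMarg (R : Matrix (Fin b₀) (Fin b₁) ℝ) : ∑ k, colMarg R k = ∑ j, ∑ k, R j k :=
  Finset.sum_comm

theorem IsProbMatrix.col_sum (hP : IsProbMatrix P) : ∑ k, colMarg P k = 1 := by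
  rw [sum_colMarg, hP.2]

theorem klJoint_eq_sum (R P : Matrix (Fin b₀) (Fin b₁) ℝ) :
    klJoint R P =
      ∑ j, ∑ k, R j k * Real.log (R j k / ((∑ j', ∑ k', R j' k') * P j k)) := by
  unfold klJoint kl
  rw [Fintype.sum_prod_type, Fintype.sum_prod_type]

theorem klJoint_nonneg (hP : IsProbMatrix P) (hR : FiniteDiv P R) : 0 ≤ klJoint R P :=
  kl_nonneg (fun _ => hR.nonneg _ _) (fun _ => hP.1 _ _)
    (by rw [Fintype.sum_prod_type]; exact hP.2) fun _ => hR.eq_zero _ _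

theorem klRow_nonneg (hP : IsProbMatrix P) (hR : FiniteDiv P R) : 0 ≤ klRow R P :=
  kl_nonneg hR.row_nonneg hP.row_nonneg hP.row_sum (hR.row_eq_zero hP)

theorem klCol_nonneg (hP : IsProbMatrix P) (hR : FiniteDiv P R) : 0 ≤ klCol R P :=
  kl_nonneg hR.col_nonneg hP.col_nonneg hP.col_sum (hR.col_eq_zero hP)

theorem FiniteDiv.zero_of_sum_eq_zero (hR : FiniteDiv P R) (h : ∑ j, ∑ k, R j k = 0) (j k) :
    R j k = 0 := by
  have h1 := (Finset.sum_eq_zero_iff_of_nonneg fun j _ => hR.row_nonneg j).1 h j (Finset.mem_univ j)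
  exact (Finset.sum_eq_zero_iff_of_nonneg fun k _ => hR.nonneg j k).1 h1 k (Finset.mem_univ k)

/-- Data processing: merging the entries of each row can only lose divergence, by the log-sum
inequality along that row. -/
theorem klRow_le_klJoint (hP : IsProbMatrix P) (hR : FiniteDiv P R) : klRow R P ≤ klJoint R P := by
  rw [klJoint_eq_sum, klRow, kl]
  refine Finset.sum_le_sum fun j _ => ?_
  have h1 := log_sum_inequality Finset.univ (a := fun k => R j k)
    (b := fun k => (∑ j', ∑ k', R j' k') * P j k) (fun k _ => hR.nonneg j k)
    (fun k _ => mul_nonneg (Finset.sum_nonneg fun j _ => hR.row_nonneg j) (hP.1 j k)) (by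
      intro k _ h0
      rcases mul_eq_zero.1 h0 with h' | h'
      · exact hR.zero_of_sum_eq_zero h' j k
      · exact hR.eq_zero j k h')
  rw [← Finset.mul_sum] at h1
  exact h1

theorem klCol_le_klJoint (hP : IsProbMatrix P) (hR : FiniteDiv P R) : klCol R P ≤ klJoint R P := by
  rw [klJoint_eq_sum, Finset.sum_comm, klCol, kl]
  refine Finset.sum_le_sum fun k _ => ?_
  have h1 := log_sum_inequality Finset.univ (a := fun j => R j k)
    (b := fun j => (∑ j', ∑ k', R j' k') * P j k) (fun j _ => hR.nonneg j k)
    (fun j _ => mul_nonneg (Finset.sum_nonneg fun j _ => hR.row_nonneg j) (hP.1 j k)) (by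
      intro j _ h0
      rcases mul_eq_zero.1 h0 with h' | h'
      · exact hR.zero_of_sum_eq_zero h' j k
      · exact hR.eq_zero j k h')
  rw [← Finset.mul_sum, ← sum_colMarg] at h1
  rw [← sum_colMarg]
  exact h1

theorem klJoint_smul (c : ℝ) (R P : Matrix (Fin b₀) (Fin b₁) ℝ) :
    klJoint (c • R) P = c * klJoint R P :=
  kl_smul c (fun jk : Fin b₀ × Fin b₁ => R jk.1 jk.2) _

theorem klRow_smul (c : ℝ) (R P : Matrix (Fin b₀) (Fin b₁) ℝ) :
    klRow (c • R) P = c * klRow R P := by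
  rw [klRow, klRow, ← kl_smul]
  congr 1
  ext j
  simp [rowMarg, Finset.mul_sum]

theorem klCol_smul (c : ℝ) (R P : Matrix (Fin b₀) (Fin b₁) ℝ) :
    klCol (c • R) P = c * klCol R P := by
  rw [klCol, klCol, ← kl_smul]
  congr 1
  ext j
  simp [colMarg, Finset.mul_sum]

theorem klJoint_sum_le {κ : Type*} (s : Finset κ) {R : κ → Matrix (Fin b₀) (Fin b₁) ℝ}
    (hP : IsProbMatrix P) (hR : ∀ i ∈ s, FiniteDiv P (R i)) :
    klJoint (∑ i ∈ s, R i) P ≤ ∑ i ∈ s, klJoint (R i) P := by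
  have := kl_sum_le s (r := fun i (jk : Fin b₀ × Fin b₁) => R i jk.1 jk.2)
    (p := fun jk => P jk.1 jk.2) (fun i hi jk => (hR i hi).nonneg _ _) (fun _ => hP.1 _ _)
    (fun i hi jk => (hR i hi).eq_zero _ _)
  simpa [klJoint, Matrix.sum_apply] using this

theorem klJoint_self (hP : IsProbMatrix P) : klJoint P P = 0 := by
  rw [klJoint_eq_sum, hP.2]
  refine Finset.sum_eq_zero fun j _ => Finset.sum_eq_zero fun k _ => ?_
  by_cases h : P j k = 0 <;> simp [h]

end MatrixDivergence

/-! ### Carathéodory reduction with a linear objective. -/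

section ConicReduction

/-- A conic combination can be supported on at most `finrank` many vectors of a strict cone,
without decreasing a given linear function of the coefficients. -/
theorem exists_conic_reduction {κ V : Type*} [AddCommGroup V] [Module ℝ V] [FiniteDimensional ℝ V]
    (v : κ → V) (F : κ → ℝ) (φ : V →ₗ[ℝ] ℝ) (n : ℕ) :
    ∀ (s : Finset κ) (c : κ → ℝ), s.card = n → (∀ i ∈ s, 0 < φ (v i)) → (∀ i ∈ s, 0 < c i) →
      ∃ (s' : Finset κ) (c' : κ → ℝ), s' ⊆ s ∧ s'.card ≤ Module.finrank ℝ V ∧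
        (∀ i ∈ s', 0 < c' i) ∧ ∑ i ∈ s', c' i • v i = ∑ i ∈ s, c i • v i ∧
        ∑ i ∈ s, c i * F i ≤ ∑ i ∈ s', c' i * F i := by
  classical
  induction n using Nat.strong_induction_on with
  | _ n ih =>
  intro s c hn hφ hc
  by_cases hs : s.card ≤ Module.finrank ℝ V
  · exact ⟨s, c, subset_rfl, hs, hc, rfl, le_rfl⟩
  have hdep : ∃ g : κ → ℝ, ∑ i ∈ s, g i • v i = 0 ∧ ∃ i ∈ s, g i ≠ 0 := by
    have hnot : ¬ LinearIndependent ℝ fun i : s => v i := fun hli => by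
      have := hli.fintype_card_le_finrank
      rw [Fintype.card_coe] at this
      exact hs this
    obtain ⟨g, hg, i, hi⟩ := Fintype.not_linearIndependent_iff.1 hnot
    refine ⟨fun i => if h : i ∈ s then g ⟨i, h⟩ else 0, ?_, i, i.2, by simpa using hi⟩
    rw [← Finset.sum_coe_sort, ← hg]
    exact Finset.sum_congr rfl fun i _ => by simp
  -- The sign of the linear relation is free; it is chosen so that moving along it does not decrease
  -- the objective.
  obtain ⟨g, hg0, hgne, hgF⟩ : ∃ g : κ → ℝ, ∑ i ∈ s, g i • v i = 0 ∧ (∃ i ∈ s, g i ≠ 0) ∧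
      0 ≤ ∑ i ∈ s, g i * F i := by
    obtain ⟨g, hg0, i, hi, hgi⟩ := hdep
    rcases le_total 0 (∑ i ∈ s, g i * F i) with h | h
    · exact ⟨g, hg0, ⟨i, hi, hgi⟩, h⟩
    · refine ⟨fun i => -g i, ?_, ⟨i, hi, neg_ne_zero.2 hgi⟩, ?_⟩
      · simp [hg0]
      · simpa using h
  -- Strict positivity of `φ` on the vectors excludes a nontrivial relation with nonnegative
  -- coefficients.
  have hneg : (s.filter fun i => g i < 0).Nonempty := by
    by_contra hcon
    have hpos : ∀ i ∈ s, 0 ≤ g i := fun i hi => by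
      by_contra h
      exact hcon ⟨i, Finset.mem_filter.2 ⟨hi, not_le.1 h⟩⟩
    obtain ⟨i, hi, hgi⟩ := hgne
    have h1 : ∑ i ∈ s, g i * φ (v i) = 0 := by
      simpa using congrArg φ hg0
    have h2 := (Finset.sum_eq_zero_iff_of_nonneg
      fun i hi => mul_nonneg (hpos i hi) (hφ i hi).le).1 h1 i hi
    exact hgi ((mul_eq_zero.1 h2).resolve_right (hφ i hi).ne')
  -- The step length `τ` is the first moment at which some coefficient reaches zero; that index then
  -- leaves the support.
  obtain ⟨i₀, hi₀, hmin⟩ := Finset.exists_min_image _ (fun i => c i / -g i) hneg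
  obtain ⟨hi₀s, hi₀g⟩ := Finset.mem_filter.1 hi₀
  set τ := c i₀ / -g i₀ with hτ
  have hτ0 : 0 ≤ τ := div_nonneg (hc _ hi₀s).le (by linarith)
  have hc' : ∀ i ∈ s, 0 ≤ c i + τ * g i := by
    intro i hi
    rcases le_or_gt 0 (g i) with h | h
    · exact add_nonneg (hc i hi).le (mul_nonneg hτ0 h)
    · have := hmin i (Finset.mem_filter.2 ⟨hi, h⟩)
      rw [le_div_iff₀ (by linarith)] at this
      linarith
  have hz : c i₀ + τ * g i₀ = 0 := by
    rw [hτ, div_neg, neg_mul, div_mul_cancel₀ _ hi₀g.ne, add_neg_cancel]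
  set s₁ := s.filter fun i => 0 < c i + τ * g i
  have hsub : s₁ ⊆ s := Finset.filter_subset _ _
  have hlt : s₁.card < n := by
    rw [← hn]
    refine Finset.card_lt_card ⟨hsub, fun h => ?_⟩
    have := (Finset.mem_filter.1 (h hi₀s)).2
    exact this.ne' hz
  have hout : ∀ i ∈ s, i ∉ s₁ → c i + τ * g i = 0 := fun i hi h =>
    le_antisymm (not_lt.1 fun h' => h (Finset.mem_filter.2 ⟨hi, h'⟩)) (hc' i hi)
  obtain ⟨s', c', h1, h2, h3, h4, h5⟩ := ih _ hlt s₁ (fun i => c i + τ * g i) rfl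
    (fun i hi => hφ i (hsub hi)) (fun i hi => (Finset.mem_filter.1 hi).2)
  refine ⟨s', c', h1.trans hsub, h2, h3, ?_, ?_⟩
  · rw [h4, Finset.sum_subset hsub fun i hi h => by rw [hout i hi h, zero_smul]]
    simp only [add_smul, mul_smul]
    rw [Finset.sum_add_distrib, ← Finset.smul_sum, hg0, smul_zero, add_zero]
  · refine le_trans ?_ h5
    rw [Finset.sum_subset hsub fun i hi h => by rw [hout i hi h, zero_mul]]
    simp only [add_mul, mul_assoc]
    rw [Finset.sum_add_distrib, ← Finset.mul_sum]
    linarith [mul_nonneg hτ0 hgF]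

end ConicReduction

/-! ### Families of matrices, and independence of the information from the size of the family. -/

section Families

variable {b₀ b₁ N : ℕ} {P : Matrix (Fin b₀) (Fin b₁) ℝ} {R : Fin N → Matrix (Fin b₀) (Fin b₁) ℝ}

theorem finiteFamilies.finiteDiv (hR : R ∈ finiteFamilies P N) (i : Fin N) : FiniteDiv P (R i) :=
  ⟨hR.1 i, hR.2.2 i⟩

theorem FiniteDiv.sum {κ : Type*} {s : Finset κ} {R : κ → Matrix (Fin b₀) (Fin b₁) ℝ}
    (h : ∀ i ∈ s, FiniteDiv P (R i)) : FiniteDiv P (∑ i ∈ s, R i) where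
  nonneg j k := by
    rw [Matrix.sum_apply]
    exact Finset.sum_nonneg fun i hi => (h i hi).nonneg j k
  eq_zero j k h0 := by
    rw [Matrix.sum_apply]
    exact Finset.sum_eq_zero fun i hi => (h i hi).eq_zero j k h0

theorem FiniteDiv.smul {c : ℝ} (hc : 0 ≤ c) {R : Matrix (Fin b₀) (Fin b₁) ℝ} (h : FiniteDiv P R) :
    FiniteDiv P (c • R) where
  nonneg j k := mul_nonneg hc (h.nonneg j k)
  eq_zero j k h0 := by simp [h.eq_zero j k h0]

/-- The sum of all the entries of a matrix, as a linear map. -/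
def totalMass (b₀ b₁ : ℕ) : Matrix (Fin b₀) (Fin b₁) ℝ →ₗ[ℝ] ℝ where
  toFun R := ∑ j, ∑ k, R j k
  map_add' R S := by simp [Finset.sum_add_distrib]
  map_smul' c R := by simp [Finset.mul_sum]

theorem totalMass_apply (R : Matrix (Fin b₀) (Fin b₁) ℝ) :
    totalMass b₀ b₁ R = ∑ j, ∑ k, R j k := rfl

theorem FiniteDiv.totalMass_nonneg {R : Matrix (Fin b₀) (Fin b₁) ℝ} (h : FiniteDiv P R) :
    0 ≤ totalMass b₀ b₁ R := by
  rw [totalMass_apply]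
  exact Finset.sum_nonneg fun j _ => h.row_nonneg j

theorem FiniteDiv.eq_zero_of_totalMass {R : Matrix (Fin b₀) (Fin b₁) ℝ} (h : FiniteDiv P R)
    (h0 : totalMass b₀ b₁ R = 0) : R = 0 := by
  ext j k
  exact h.zero_of_sum_eq_zero h0 j k

theorem mem_finiteFamilies_iff :
    R ∈ finiteFamilies P N ↔ (∀ i, FiniteDiv P (R i)) ∧ totalMass b₀ b₁ (∑ i, R i) = 1 := by
  rw [map_sum]
  exact ⟨fun h => ⟨fun i => finiteFamilies.finiteDiv h i, h.2.1⟩,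
    fun h => ⟨fun i => (h.1 i).nonneg, h.2, fun i => (h.1 i).eq_zero⟩⟩

theorem klJoint_zero (P : Matrix (Fin b₀) (Fin b₁) ℝ) : klJoint 0 P = 0 := by
  simpa using klJoint_smul 0 0 P

theorem klRow_zero (P : Matrix (Fin b₀) (Fin b₁) ℝ) : klRow 0 P = 0 := by
  simpa using klRow_smul 0 0 P

theorem klCol_zero (P : Matrix (Fin b₀) (Fin b₁) ℝ) : klCol 0 P = 0 := by
  simpa using klCol_smul 0 0 P

/-- Families are padded with zero matrices; functionals vanishing at zero do not notice this. -/
theorem sum_extend_zero {κ A M : Type*} [Fintype κ] [Fintype A] [Zero M] {W : Type*}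
    [AddCommMonoid W] (ψ : κ ↪ A) (f : κ → M) (G : M → W) (hG : G 0 = 0) :
    ∑ a, G (Function.extend ψ f 0 a) = ∑ i, G (f i) := by
  symm
  refine Fintype.sum_of_injective ψ ψ.injective _ _ (fun a ha => ?_) fun i => ?_
  · rw [Function.extend_apply' _ _ _ fun ⟨i, hi⟩ => ha ⟨i, hi⟩, Pi.zero_apply, hG]
  · rw [ψ.injective.extend_apply]

theorem extend_mem_finiteFamilies {κ : Type*} [Fintype κ] (ψ : κ ↪ Fin N)
    {f : κ → Matrix (Fin b₀) (Fin b₁) ℝ} (hf : ∀ i, FiniteDiv P (f i))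
    (h1 : totalMass b₀ b₁ (∑ i, f i) = 1) :
    (Function.extend ψ f 0 : Fin N → Matrix (Fin b₀) (Fin b₁) ℝ) ∈ finiteFamilies P N := by
  rw [mem_finiteFamilies_iff, sum_extend_zero ψ f (fun R => R) rfl]
  refine ⟨fun a => ?_, h1⟩
  by_cases h : ∃ i, ψ i = a
  · obtain ⟨i, rfl⟩ := h
    rw [ψ.injective.extend_apply]
    exact hf i
  · rw [Function.extend_apply' _ _ _ h]
    exact ⟨fun _ _ => le_rfl, fun _ _ _ => rfl⟩

theorem divergenceVectors_mono {N N' : ℕ} (h : N ≤ N') :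
    divergenceVectors P N ⊆ divergenceVectors P N' := by
  rintro _ ⟨R, hR, rfl⟩
  obtain ⟨h1, h2⟩ := mem_finiteFamilies_iff.1 hR
  refine ⟨_, extend_mem_finiteFamilies (Fin.castLEEmb h) h1 h2, ?_⟩
  simp only
  rw [sum_extend_zero _ R (fun R => R) rfl, sum_extend_zero _ R (fun R => klRow R P) (klRow_zero P),
    sum_extend_zero _ R (fun R => klCol R P) (klCol_zero P),
    sum_extend_zero _ R (fun R => klJoint R P) (klJoint_zero P)]

/-- With the total matrix held fixed, the objective is a constant plus a sum of functions
homogeneous of degree one. The conic reduction in the space of matrices, of dimension b₀b₁,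
therefore keeps the total and does not lower the objective. This is what lets codes with arbitrarily
many buckets be bounded by `bucketingInfo`. -/
theorem infoObjective_le_bucketingInfo (hP : IsProbMatrix P) (l₀ l₁ μ : ℝ)
    (hR : R ∈ finiteFamilies P N) : infoObjective P l₀ l₁ μ R ≤ bucketingInfo P l₀ l₁ μ := by
  classical
  obtain ⟨hdiv, hmass⟩ := mem_finiteFamilies_iff.1 hR
  set F : Matrix (Fin b₀) (Fin b₁) ℝ → ℝ :=
    fun R => l₀ * klRow R P + l₁ * klCol R P - klJoint R P with hF
  have hF0 : F 0 = 0 := by simp [hF, klRow_zero, klCol_zero, klJoint_zero]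
  have hobj : ∀ {n : ℕ} (R : Fin n → Matrix (Fin b₀) (Fin b₁) ℝ),
      infoObjective P l₀ l₁ μ R = (1 - μ) * klJoint (∑ i, R i) P + ∑ i, F (R i) := by
    intro n R
    simp only [infoObjective, hF, Finset.sum_add_distrib, Finset.sum_sub_distrib, Finset.mul_sum]
    ring
  -- Zero members are discarded because the reduction needs strictly positive mass.
  set s : Finset (Fin N) := Finset.univ.filter fun i => R i ≠ 0
  obtain ⟨s', c', -, hcard, hc', hsum, hle⟩ := exists_conic_reduction R (fun i => F (R i))
    (totalMass b₀ b₁) s.card s (fun _ => 1) rfl (fun i hi => lt_of_le_of_ne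
      (hdiv i).totalMass_nonneg fun h => (Finset.mem_filter.1 hi).2
        ((hdiv i).eq_zero_of_totalMass h.symm)) fun _ _ => one_pos
  have hs : ∀ {W : Type} [AddCommMonoid W] (G : Matrix (Fin b₀) (Fin b₁) ℝ → W), G 0 = 0 →
      ∑ i ∈ s, G (R i) = ∑ i, G (R i) := by
    intro W _ G hG
    refine Finset.sum_subset (Finset.subset_univ _) fun i _ hi => ?_
    have : R i = 0 := by simpa [s] using hi
    rw [this, hG]
  have hcard' : Fintype.card s' ≤ Fintype.card (Fin (b₀ * b₁)) := by
    rw [Fintype.card_coe, Fintype.card_fin]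
    simpa [Module.finrank_matrix] using hcard
  obtain ⟨ψ⟩ := Function.Embedding.nonempty_of_card_le hcard'
  set f : s' → Matrix (Fin b₀) (Fin b₁) ℝ := fun i => c' i • R i with hf
  have hfs : ∑ i, f i = ∑ i, R i := by
    rw [← hs (fun R => R) rfl]
    simp only [one_smul] at hsum
    rw [← hsum]
    exact Finset.sum_coe_sort s' fun i => c' i • R i
  have hmem := extend_mem_finiteFamilies ψ (f := f)
    (fun i => (hdiv i).smul (hc' i i.2).le) (by rw [hfs, hmass])
  refine le_trans ?_ ((isGreatest_bucketingInfo hP l₀ l₁ μ).2 ⟨_, hmem, rfl⟩)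
  rw [hobj, hobj, sum_extend_zero ψ f (fun R => R) rfl, sum_extend_zero ψ f F hF0, hfs]
  simp only [one_mul] at hle
  rw [hs F hF0] at hle
  have : ∑ i, F (f i) = ∑ i ∈ s', c' i * F (R i) := by
    rw [← Finset.sum_coe_sort s' fun i => c' i * F (R i)]
    refine Finset.sum_congr rfl fun i _ => ?_
    simp only [hF, hf, klRow_smul, klCol_smul, klJoint_smul]
    ring
  linarith

end Families

/-! ### The functional inequality for a single coordinate. -/

section OneLetter

variable {b₀ b₁ : ℕ} {P : Matrix (Fin b₀) (Fin b₁) ℝ}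

theorem sum_mul_pos_of_sum_eq_one {ι : Type*} [Fintype ι] {p f : ι → ℝ} (hp : ∀ j, 0 ≤ p j)
    (hp1 : ∑ j, p j = 1) (hf : ∀ j, 0 < f j) : 0 < ∑ j, p j * f j := by
  have h0 : ∀ j ∈ Finset.univ, 0 ≤ p j * f j := fun j _ => mul_nonneg (hp j) (hf j).le
  refine lt_of_le_of_ne (Finset.sum_nonneg h0) fun h => ?_
  have h1 := (Finset.sum_eq_zero_iff_of_nonneg h0).1 h.symm
  have : ∑ j, p j = 0 := Finset.sum_eq_zero fun j hj =>
    (mul_eq_zero.1 (h1 j hj)).resolve_right (hf j).ne'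
  linarith

theorem sum_sum_mul_pos (hP : IsProbMatrix P) {f : Fin b₀ → Fin b₁ → ℝ} (hf : ∀ j k, 0 < f j k) :
    0 < ∑ j, ∑ k, P j k * f j k := by
  have := sum_mul_pos_of_sum_eq_one (p := fun jk : Fin b₀ × Fin b₁ => P jk.1 jk.2)
    (f := fun jk => f jk.1 jk.2) (fun _ => hP.1 _ _) (by rw [Fintype.sum_prod_type]; exact hP.2)
    fun _ => hf _ _
  rwa [Fintype.sum_prod_type] at this

/-- The bound `I` is tested on the family suggested by the variational principle: the total `Q` is
`P` tilted by Φ^(1/μ), and it is split over the buckets in proportion to `φ t`. For this family the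
joint divergences are explicit and produce μ log Z; only the marginal divergences and the bucket
weights are estimated, by log-sum inequalities. -/
theorem one_letter_log_bound (hP : IsProbMatrix P) {T : ℕ} (hT : 0 < T) {l₀ l₁ μ I : ℝ}
    (hl₀ : 0 ≤ l₀) (hl₁ : 0 ≤ l₁) (hμ : 0 < μ)
    (hI : ∀ R ∈ finiteFamilies P T, infoObjective P l₀ l₁ μ R ≤ I)
    {f : Fin T → Fin b₀ → ℝ} {g : Fin T → Fin b₁ → ℝ} (hf : ∀ t j, 0 < f t j)
    (hg : ∀ t k, 0 < g t k) :
    μ * Real.log (∑ j, ∑ k, P j k * (∑ t, f t j ^ l₀ * g t k ^ l₁) ^ (1 / μ)) - I ≤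
      Real.log (∑ t, (∑ j, rowMarg P j * f t j) ^ l₀ * (∑ k, colMarg P k * g t k) ^ l₁) := by
  have : Nonempty (Fin T) := ⟨⟨0, hT⟩⟩
  set φ : Fin T → Fin b₀ → Fin b₁ → ℝ := fun t j k => f t j ^ l₀ * g t k ^ l₁ with hφ
  have hφ0 : ∀ t j k, 0 < φ t j k := fun t j k =>
    mul_pos (Real.rpow_pos_of_pos (hf t j) _) (Real.rpow_pos_of_pos (hg t k) _)
  set Φ : Fin b₀ → Fin b₁ → ℝ := fun j k => ∑ t, φ t j k with hΦ
  have hΦ0 : ∀ j k, 0 < Φ j k := fun j k =>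
    Finset.sum_pos (fun t _ => hφ0 t j k) Finset.univ_nonempty
  set Z : ℝ := ∑ j, ∑ k, P j k * Φ j k ^ (1 / μ) with hZ
  have hZ0 : 0 < Z := sum_sum_mul_pos hP fun j k => Real.rpow_pos_of_pos (hΦ0 j k) _
  set Q : Matrix (Fin b₀) (Fin b₁) ℝ := fun j k => P j k * Φ j k ^ (1 / μ) / Z with hQ
  set R : Fin T → Matrix (Fin b₀) (Fin b₁) ℝ := fun t j k => Q j k * (φ t j k / Φ j k) with hR
  have hQdiv : FiniteDiv P Q :=
    ⟨fun j k => div_nonneg (mul_nonneg (hP.1 j k) (Real.rpow_nonneg (hΦ0 j k).le _)) hZ0.le,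
      fun j k h => by simp [hQ, h]⟩
  have hRdiv : ∀ t, FiniteDiv P (R t) := fun t =>
    ⟨fun j k => mul_nonneg (hQdiv.nonneg j k) (div_pos (hφ0 t j k) (hΦ0 j k)).le,
      fun j k h => by simp [hR, hQdiv.eq_zero j k h]⟩
  have hRsum : ∑ t, R t = Q := by
    ext j k
    rw [Matrix.sum_apply]
    simp only [hR]
    rw [← Finset.mul_sum, ← Finset.sum_div]
    change Q j k * (Φ j k / Φ j k) = _
    rw [div_self (hΦ0 j k).ne', mul_one]
  have hQ1 : ∑ j, ∑ k, Q j k = 1 := by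
    simp only [hQ, ← Finset.sum_div]
    exact div_self hZ0.ne'
  have hmem : R ∈ finiteFamilies P T :=
    mem_finiteFamilies_iff.2 ⟨hRdiv, by rw [hRsum]; exact hQ1⟩
  have hobj := hI R hmem
  set q : Fin T → ℝ := fun t => ∑ j, ∑ k, R t j k with hq
  have hq0 : ∀ t, 0 ≤ q t := fun t => (hRdiv t).totalMass_nonneg
  have hq1 : ∑ t, q t = 1 := by
    have := (mem_finiteFamilies_iff.1 hmem).2
    rw [map_sum] at this
    exact this
  set a : Fin T → ℝ := fun t => ∑ j, rowMarg P j * f t j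
  set c : Fin T → ℝ := fun t => ∑ k, colMarg P k * g t k
  have ha : ∀ t, 0 < a t := fun t => sum_mul_pos_of_sum_eq_one hP.row_nonneg hP.row_sum (hf t)
  have hc : ∀ t, 0 < c t := fun t => sum_mul_pos_of_sum_eq_one hP.col_nonneg hP.col_sum (hg t)
  have hA : ∀ t, 0 < a t ^ l₀ * c t ^ l₁ := fun t =>
    mul_pos (Real.rpow_pos_of_pos (ha t) _) (Real.rpow_pos_of_pos (hc t) _)
  -- the log-sum inequality over the bucket index
  have h1 := log_sum_inequality Finset.univ (a := q) (b := fun t => a t ^ l₀ * c t ^ l₁)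
    (fun t _ => hq0 t) (fun t _ => (hA t).le) (fun t _ h => absurd h (hA t).ne')
  rw [hq1, one_mul, one_div, Real.log_inv] at h1
  have h2 : ∀ t, q t * Real.log (q t / (a t ^ l₀ * c t ^ l₁)) =
      q t * Real.log (q t) - l₀ * (q t * Real.log (a t)) - l₁ * (q t * Real.log (c t)) := by
    intro t
    by_cases h0 : q t = 0
    · simp [h0]
    rw [Real.log_div h0 (hA t).ne', Real.log_mul (Real.rpow_pos_of_pos (ha t) _).ne'
      (Real.rpow_pos_of_pos (hc t) _).ne', Real.log_rpow (ha t), Real.log_rpow (hc t)]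
    ring
  simp only [h2] at h1
  -- the log-sum inequality for each marginal
  have h3 : ∀ t, ∑ j, ∑ k, R t j k * Real.log (f t j) - klRow (R t) P ≤
      q t * Real.log (a t) := by
    intro t
    have := sum_mul_log_sub_kl_le (hRdiv t).row_nonneg hP.row_nonneg ((hRdiv t).row_eq_zero hP)
      (hf t)
    simp only [← Finset.sum_mul]
    exact this
  have h4 : ∀ t, ∑ j, ∑ k, R t j k * Real.log (g t k) - klCol (R t) P ≤
      q t * Real.log (c t) := by
    intro t
    have := sum_mul_log_sub_kl_le (hRdiv t).col_nonneg hP.col_nonneg ((hRdiv t).col_eq_zero hP)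
      (hg t)
    rw [sum_colMarg] at this
    rw [Finset.sum_comm]
    simp only [← Finset.sum_mul]
    exact this
  -- the divergences of the tilted matrices
  have h5 : ∀ t, klJoint (R t) P = (1 / μ - 1) * ∑ j, ∑ k, R t j k * Real.log (Φ j k)
      - q t * Real.log Z + l₀ * ∑ j, ∑ k, R t j k * Real.log (f t j)
      + l₁ * ∑ j, ∑ k, R t j k * Real.log (g t k) - q t * Real.log (q t) := by
    intro t
    have hqm : ∀ x, q t * x = ∑ j, ∑ k, R t j k * x := fun x => by simp only [hq, Finset.sum_mul]
    have hk : klJoint (R t) P = ∑ j, ∑ k, R t j k * Real.log (R t j k / (q t * P j k)) :=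
      klJoint_eq_sum _ _
    rw [hk, hqm (Real.log Z), hqm (Real.log (q t))]
    simp only [Finset.mul_sum, ← Finset.sum_add_distrib, ← Finset.sum_sub_distrib]
    refine Finset.sum_congr rfl fun j _ => Finset.sum_congr rfl fun k _ => ?_
    by_cases h0 : R t j k = 0
    · simp [h0]
    have hP0 : P j k ≠ 0 := fun h => h0 ((hRdiv t).eq_zero j k h)
    have hq0' : q t ≠ 0 := fun h => h0 ((hRdiv t).zero_of_sum_eq_zero h j k)
    have hratio : R t j k / (q t * P j k) =
        Φ j k ^ (1 / μ) * f t j ^ l₀ * g t k ^ l₁ / (Z * Φ j k * q t) := by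
      simp only [hR, hQ, hφ]
      field_simp
    have hfp := Real.rpow_pos_of_pos (hf t j) l₀
    have hgp := Real.rpow_pos_of_pos (hg t k) l₁
    have hΦp := Real.rpow_pos_of_pos (hΦ0 j k) (1 / μ)
    rw [hratio, Real.log_div (by positivity) (mul_ne_zero (mul_pos hZ0 (hΦ0 j k)).ne' hq0'),
      Real.log_mul (by positivity) (by positivity), Real.log_mul (by positivity) (by positivity),
      Real.log_mul (mul_pos hZ0 (hΦ0 j k)).ne' hq0', Real.log_mul hZ0.ne' (hΦ0 j k).ne',
      Real.log_rpow (hΦ0 j k), Real.log_rpow (hf t j), Real.log_rpow (hg t k)]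
    ring
  have h6 : klJoint Q P = 1 / μ * ∑ j, ∑ k, Q j k * Real.log (Φ j k) - Real.log Z := by
    have e : Real.log Z = ∑ j, ∑ k, Q j k * Real.log Z := by
      simp only [← Finset.sum_mul, hQ1, one_mul]
    rw [klJoint_eq_sum, hQ1, e]
    simp only [Finset.mul_sum, ← Finset.sum_sub_distrib]
    refine Finset.sum_congr rfl fun j _ => Finset.sum_congr rfl fun k _ => ?_
    by_cases h0 : Q j k = 0
    · simp [h0]
    have hP0 : P j k ≠ 0 := fun h => h0 (hQdiv.eq_zero j k h)
    have hratio : Q j k / (1 * P j k) = Φ j k ^ (1 / μ) / Z := by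
      simp only [hQ]
      field_simp
    rw [hratio, Real.log_div (Real.rpow_pos_of_pos (hΦ0 j k) _).ne' hZ0.ne',
      Real.log_rpow (hΦ0 j k)]
    ring
  have h7 : ∑ t, ∑ j, ∑ k, R t j k * Real.log (Φ j k) = ∑ j, ∑ k, Q j k * Real.log (Φ j k) := by
    rw [Finset.sum_comm]
    refine Finset.sum_congr rfl fun j _ => ?_
    rw [Finset.sum_comm]
    refine Finset.sum_congr rfl fun k _ => ?_
    rw [← Finset.sum_mul, ← hRsum, Matrix.sum_apply]
  have h8 := Finset.sum_le_sum fun t (_ : t ∈ Finset.univ) => mul_le_mul_of_nonneg_left (h3 t) hl₀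
  have h9 := Finset.sum_le_sum fun t (_ : t ∈ Finset.univ) => mul_le_mul_of_nonneg_left (h4 t) hl₁
  have h10 := Finset.sum_congr rfl fun t (_ : t ∈ Finset.univ) => h5 t
  simp only [Finset.sum_sub_distrib, Finset.sum_add_distrib, ← Finset.mul_sum, h7] at h1 h8 h9 h10
  rw [← Finset.sum_mul, hq1, one_mul] at h10
  rw [infoObjective, hRsum, h10, h6] at hobj
  set E := ∑ j, ∑ k, Q j k * Real.log (Φ j k)
  have e1 : (1 - μ) * (1 / μ * E - Real.log Z) =
      (1 / μ - 1) * E - Real.log Z + μ * Real.log Z := by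
    field_simp
    ring
  rw [e1] at hobj
  change μ * Real.log Z - I ≤ Real.log (∑ t, a t ^ l₀ * c t ^ l₁)
  linarith

theorem one_letter_bound (hP : IsProbMatrix P) {T : ℕ} (hT : 0 < T) {l₀ l₁ μ I : ℝ}
    (hl₀ : 0 ≤ l₀) (hl₁ : 0 ≤ l₁) (hμ : 0 < μ)
    (hI : ∀ R ∈ finiteFamilies P T, infoObjective P l₀ l₁ μ R ≤ I)
    {f : Fin T → Fin b₀ → ℝ} {g : Fin T → Fin b₁ → ℝ} (hf : ∀ t j, 0 < f t j)
    (hg : ∀ t k, 0 < g t k) :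
    (∑ j, ∑ k, P j k * (∑ t, f t j ^ l₀ * g t k ^ l₁) ^ (1 / μ)) ^ μ * Real.exp (-I) ≤
      ∑ t, (∑ j, rowMarg P j * f t j) ^ l₀ * (∑ k, colMarg P k * g t k) ^ l₁ := by
  have : Nonempty (Fin T) := ⟨⟨0, hT⟩⟩
  have h := one_letter_log_bound hP hT hl₀ hl₁ hμ hI hf hg
  have hZ : 0 < ∑ j, ∑ k, P j k * (∑ t, f t j ^ l₀ * g t k ^ l₁) ^ (1 / μ) :=
    sum_sum_mul_pos hP fun j k => Real.rpow_pos_of_pos (Finset.sum_pos (fun t _ =>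
      mul_pos (Real.rpow_pos_of_pos (hf t j) _) (Real.rpow_pos_of_pos (hg t k) _))
      Finset.univ_nonempty) _
  have hA : 0 < ∑ t, (∑ j, rowMarg P j * f t j) ^ l₀ * (∑ k, colMarg P k * g t k) ^ l₁ :=
    Finset.sum_pos (fun t _ => mul_pos
      (Real.rpow_pos_of_pos (sum_mul_pos_of_sum_eq_one hP.row_nonneg hP.row_sum (hf t)) _)
      (Real.rpow_pos_of_pos (sum_mul_pos_of_sum_eq_one hP.col_nonneg hP.col_sum (hg t)) _))
      Finset.univ_nonempty
  rw [← Real.log_le_log_iff (mul_pos (Real.rpow_pos_of_pos hZ _) (Real.exp_pos _)) hA,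
    Real.log_mul (Real.rpow_pos_of_pos hZ _).ne' (Real.exp_pos _).ne', Real.log_rpow hZ,
    Real.log_exp]
  linarith

end OneLetter

/-! ### Induction on the number of coordinates. -/

section Tensorization

variable {b₀ b₁ : ℕ} {P : Matrix (Fin b₀) (Fin b₁) ℝ}

theorem sum_fin_succ_arrow {α M : Type*} [Fintype α] [AddCommMonoid M] {d : ℕ}
    (h : (Fin (d + 1) → α) → M) : ∑ x, h x = ∑ a, ∑ x : Fin d → α, h (Fin.cons a x) := by
  rw [← Fintype.sum_prod_type']
  exact (Fintype.sum_equiv (Fin.consEquiv fun _ => α) _ _ fun _ => rfl).symm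

theorem sum_prod_eq_one {α : Type*} [Fintype α] {p : α → ℝ} (hp : ∑ a, p a = 1)
    {κ : Type*} [Fintype κ] [DecidableEq κ] :
    ∑ x : κ → α, ∏ i, p (x i) = 1 := by
  rw [← Fintype.prod_sum (fun (_ : κ) a => p a)]
  simp [hp]

/-- The one-letter inequality reproduces itself: it is applied in the first coordinate to the
averages of `f` and `g` over the remaining ones, and the induction hypothesis bounds the inner
expression for each value of the first letters. The constants exp(-I) multiply. -/
theorem tensorized_bound (hP : IsProbMatrix P) {T : ℕ} (hT : 0 < T) {l₀ l₁ μ I : ℝ}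
    (hl₀ : 0 ≤ l₀) (hl₁ : 0 ≤ l₁) (hμ : 0 < μ)
    (hI : ∀ R ∈ finiteFamilies P T, infoObjective P l₀ l₁ μ R ≤ I) (d : ℕ) :
    ∀ {f : Fin T → (Fin d → Fin b₀) → ℝ} {g : Fin T → (Fin d → Fin b₁) → ℝ}
      (_ : ∀ t x, 0 < f t x) (_ : ∀ t y, 0 < g t y),
      (∑ x, ∑ y, (∏ i, P (x i) (y i)) * (∑ t, f t x ^ l₀ * g t y ^ l₁) ^ (1 / μ)) ^ μ *
          Real.exp (-(d * I)) ≤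
        ∑ t, (∑ x, (∏ i, rowMarg P (x i)) * f t x) ^ l₀ *
          (∑ y, (∏ i, colMarg P (y i)) * g t y) ^ l₁ := by
  have : Nonempty (Fin T) := ⟨⟨0, hT⟩⟩
  induction d with
  | zero =>
    intro f g hf hg
    have h0 : 0 ≤ ∑ t, f t default ^ l₀ * g t default ^ l₁ := Finset.sum_nonneg fun t _ =>
      mul_nonneg (Real.rpow_nonneg (hf t _).le _) (Real.rpow_nonneg (hg t _).le _)
    simp only [Finset.univ_unique, Finset.sum_singleton, Finset.univ_eq_empty, Finset.prod_empty,
      one_mul, Nat.cast_zero, zero_mul, neg_zero, Real.exp_zero, mul_one]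
    rw [← Real.rpow_mul h0, one_div_mul_cancel hμ.ne', Real.rpow_one]
  | succ d ih =>
    intro f g hf hg
    set F : Fin T → Fin b₀ → ℝ := fun t a =>
      ∑ x : Fin d → Fin b₀, (∏ i, rowMarg P (x i)) * f t (Fin.cons a x) with hF
    set G : Fin T → Fin b₁ → ℝ := fun t b =>
      ∑ y : Fin d → Fin b₁, (∏ i, colMarg P (y i)) * g t (Fin.cons b y) with hG
    have hF0 : ∀ t a, 0 < F t a := fun t a => sum_mul_pos_of_sum_eq_one
      (fun x => Finset.prod_nonneg fun i _ => hP.row_nonneg _) (sum_prod_eq_one hP.row_sum)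
      fun x => hf t _
    have hG0 : ∀ t b, 0 < G t b := fun t b => sum_mul_pos_of_sum_eq_one
      (fun y => Finset.prod_nonneg fun i _ => hP.col_nonneg _) (sum_prod_eq_one hP.col_sum)
      fun y => hg t _
    set z : Fin b₀ → Fin b₁ → ℝ := fun a b => ∑ x : Fin d → Fin b₀, ∑ y : Fin d → Fin b₁,
      (∏ i, P (x i) (y i)) *
        (∑ t, f t (Fin.cons a x) ^ l₀ * g t (Fin.cons b y) ^ l₁) ^ (1 / μ) with hz
    have hz0 : ∀ a b, 0 ≤ z a b := fun a b => Finset.sum_nonneg fun x _ =>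
      Finset.sum_nonneg fun y _ => mul_nonneg (Finset.prod_nonneg fun i _ => hP.1 _ _)
        (Real.rpow_nonneg (Finset.sum_nonneg fun t _ =>
          mul_nonneg (Real.rpow_nonneg (hf t _).le _) (Real.rpow_nonneg (hg t _).le _)) _)
    have h1 := one_letter_bound hP hT hl₀ hl₁ hμ hI hF0 hG0
    -- The induction hypothesis at fixed first letters, raised to the power 1/μ so that it fits
    -- under the outer sum.
    have h2 : ∀ a b, z a b * Real.exp (-(d * I)) ^ (1 / μ) ≤
        (∑ t, F t a ^ l₀ * G t b ^ l₁) ^ (1 / μ) := by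
      intro a b
      have h := Real.rpow_le_rpow (mul_nonneg (Real.rpow_nonneg (hz0 a b) _) (Real.exp_pos _).le)
        (ih (f := fun t x => f t (Fin.cons a x)) (g := fun t y => g t (Fin.cons b y))
        (fun t x => hf t _) (fun t y => hg t _)) (one_div_pos.2 hμ).le
      rw [Real.mul_rpow (Real.rpow_nonneg (hz0 a b) _) (Real.exp_pos _).le,
        ← Real.rpow_mul (hz0 a b), mul_one_div_cancel hμ.ne', Real.rpow_one] at h
      exact h
    have h3 : ∑ x, ∑ y, (∏ i, P (x i) (y i)) * (∑ t, f t x ^ l₀ * g t y ^ l₁) ^ (1 / μ) =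
        ∑ a, ∑ b, P a b * z a b := by
      rw [sum_fin_succ_arrow]
      refine Finset.sum_congr rfl fun a _ => ?_
      rw [Finset.sum_congr rfl fun x _ => sum_fin_succ_arrow _, Finset.sum_comm]
      refine Finset.sum_congr rfl fun b _ => ?_
      simp only [hz, Finset.mul_sum, Fin.prod_univ_succ, Fin.cons_zero, Fin.cons_succ, mul_assoc]
    have h4 : ∀ t, ∑ x, (∏ i, rowMarg P (x i)) * f t x = ∑ a, rowMarg P a * F t a := by
      intro t
      rw [sum_fin_succ_arrow]
      simp only [hF, Finset.mul_sum, Fin.prod_univ_succ, Fin.cons_zero, Fin.cons_succ, mul_assoc]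
    have h5 : ∀ t, ∑ y, (∏ i, colMarg P (y i)) * g t y = ∑ b, colMarg P b * G t b := by
      intro t
      rw [sum_fin_succ_arrow]
      simp only [hG, Finset.mul_sum, Fin.prod_univ_succ, Fin.cons_zero, Fin.cons_succ, mul_assoc]
    rw [h3]
    simp only [h4, h5]
    refine le_trans ?_ h1
    have h6 : (∑ a, ∑ b, P a b * z a b) * Real.exp (-(d * I)) ^ (1 / μ) ≤
        ∑ a, ∑ b, P a b * (∑ t, F t a ^ l₀ * G t b ^ l₁) ^ (1 / μ) := by
      simp only [Finset.sum_mul]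
      refine Finset.sum_le_sum fun a _ => Finset.sum_le_sum fun b _ => ?_
      rw [mul_assoc]
      exact mul_le_mul_of_nonneg_left (h2 a b) (hP.1 a b)
    have hS0 : 0 ≤ ∑ a, ∑ b, P a b * z a b := Finset.sum_nonneg fun a _ =>
      Finset.sum_nonneg fun b _ => mul_nonneg (hP.1 a b) (hz0 a b)
    have hE0 := (Real.exp_pos (-(d * I))).le
    have h7 := Real.rpow_le_rpow (mul_nonneg hS0 (Real.rpow_nonneg hE0 _)) h6 hμ.le
    rw [Real.mul_rpow hS0 (Real.rpow_nonneg hE0 _), ← Real.rpow_mul hE0,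
      one_div_mul_cancel hμ.ne', Real.rpow_one] at h7
    have h8 : Real.exp (-((d + 1 : ℕ) * I)) = Real.exp (-(d * I)) * Real.exp (-I) := by
      rw [← Real.exp_add]
      congr 1
      push_cast
      ring
    rw [h8, ← mul_assoc]
    exact mul_le_mul_of_nonneg_right h7 (Real.exp_pos _).le

end Tensorization

/-! ### The converse: every code obeys the information bounds. -/

section Converse

open Filter Topology

variable {b₀ b₁ : ℕ} {P : Matrix (Fin b₀) (Fin b₁) ℝ}

/-- The left side is a weighted geometric mean of a, b and ab with weights 1 - λ₁, 1 - λ₀ and λ₀ +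
λ₁ - 1. These are nonnegative and sum to one exactly under the constraints on λ. -/
theorem rpow_mul_rpow_le_max {a b l₀ l₁ : ℝ} (ha : 0 ≤ a) (hb : 0 ≤ b) (hl₀ : l₀ ≤ 1)
    (hl₁ : l₁ ≤ 1) (hl : 1 ≤ l₀ + l₁) : a ^ l₀ * b ^ l₁ ≤ max (max a b) (a * b) := by
  set M := max (max a b) (a * b)
  have haM : a ≤ M := (le_max_left _ _).trans (le_max_left _ _)
  have hbM : b ≤ M := (le_max_right _ _).trans (le_max_left _ _)
  have habM : a * b ≤ M := le_max_right _ _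
  have hM : 0 ≤ M := ha.trans haM
  have e0 : a ^ l₀ = a ^ (1 - l₁) * a ^ (l₀ + l₁ - 1) := by
    rw [← Real.rpow_add_of_nonneg ha (by linarith) (by linarith)]
    ring_nf
  have e1 : b ^ l₁ = b ^ (1 - l₀) * b ^ (l₀ + l₁ - 1) := by
    rw [← Real.rpow_add_of_nonneg hb (by linarith) (by linarith)]
    ring_nf
  have eM : M = M ^ (1 - l₁) * M ^ (1 - l₀) * M ^ (l₀ + l₁ - 1) := by
    rw [← Real.rpow_add_of_nonneg hM (by linarith) (by linarith),
      ← Real.rpow_add_of_nonneg hM (by linarith) (by linarith)]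
    ring_nf
    rw [Real.rpow_one]
  calc a ^ l₀ * b ^ l₁ = a ^ (1 - l₁) * b ^ (1 - l₀) * (a * b) ^ (l₀ + l₁ - 1) := by
        rw [e0, e1, Real.mul_rpow ha hb]
        ring
    _ ≤ M ^ (1 - l₁) * M ^ (1 - l₀) * M ^ (l₀ + l₁ - 1) := by
        have h1 := Real.rpow_le_rpow ha haM (z := 1 - l₁) (by linarith)
        have h2 := Real.rpow_le_rpow hb hbM (z := 1 - l₀) (by linarith)
        have h3 := Real.rpow_le_rpow (mul_nonneg ha hb) habM (z := l₀ + l₁ - 1) (by linarith)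
        gcongr
    _ = M := eM.symm

variable {d : ℕ} (C : BucketingCode b₀ b₁ d)

theorem BucketingCode.success_nonneg (hP : IsProbMatrix P) : 0 ≤ C.success P :=
  Finset.sum_nonneg fun _ _ => Finset.prod_nonneg fun _ _ => hP.1 _ _

theorem BucketingCode.prob₀_nonneg (hP : IsProbMatrix P) (B : Finset (Fin d → Fin b₀)) :
    0 ≤ BucketingCode.prob₀ P B :=
  Finset.sum_nonneg fun _ _ => Finset.prod_nonneg fun _ _ => hP.row_nonneg _

theorem BucketingCode.prob₁_nonneg (hP : IsProbMatrix P) (B : Finset (Fin d → Fin b₁)) :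
    0 ≤ BucketingCode.prob₁ P B :=
  Finset.sum_nonneg fun _ _ => Finset.prod_nonneg fun _ _ => hP.col_nonneg _

theorem sum_prod_matrix_eq_one (hP : IsProbMatrix P) {κ : Type*} [Fintype κ] [DecidableEq κ] :
    ∑ x : (κ → Fin b₀) × (κ → Fin b₁), ∏ i, P (x.1 i) (x.2 i) = 1 := by
  rw [← sum_prod_eq_one (p := fun jk : Fin b₀ × Fin b₁ => P jk.1 jk.2) (κ := κ)
    (by rw [Fintype.sum_prod_type]; exact hP.2)]
  exact (Fintype.sum_equiv (Equiv.arrowProdEquivProdArrow _ _ _) _ _ fun _ => rfl).symm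

theorem BucketingCode.success_le_one (hP : IsProbMatrix P) : C.success P ≤ 1 := by
  rw [← sum_prod_matrix_eq_one hP (κ := Fin d)]
  exact Finset.sum_le_sum_of_subset_of_nonneg (Finset.subset_univ _)
    fun _ _ _ => Finset.prod_nonneg fun _ _ => hP.1 _ _

/-- The tensorized inequality for bucket indicators: on a successful pair some bucket makes the
inner sum at least one, so the left side dominates the success probability. -/
theorem success_rpow_le (hP : IsProbMatrix P) (hT : 0 < C.T) {l₀ l₁ μ I : ℝ} (hl₀ : 0 ≤ l₀)
    (hl₁ : 0 ≤ l₁) (hμ : 0 < μ)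
    (hI : ∀ R ∈ finiteFamilies P C.T, infoObjective P l₀ l₁ μ R ≤ I) :
    C.success P ^ μ * Real.exp (-(d * I)) ≤
      ∑ t, BucketingCode.prob₀ P (C.B₀ t) ^ l₀ * BucketingCode.prob₁ P (C.B₁ t) ^ l₁ := by
  classical
  -- The functional inequality needs positive functions, so the indicators are shifted by `δ`, which
  -- tends to zero at the end.
  have key : ∀ δ : ℝ, 0 < δ → C.success P ^ μ * Real.exp (-(d * I)) ≤
      ∑ t, (BucketingCode.prob₀ P (C.B₀ t) + δ) ^ l₀ *
        (BucketingCode.prob₁ P (C.B₁ t) + δ) ^ l₁ := by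
    intro δ hδ
    have hind : ∀ {α : Type} [DecidableEq α] (B : Finset α) (x : α),
        0 < (if x ∈ B then (1 : ℝ) else 0) + δ := by
      intro α _ B x
      split_ifs <;> linarith
    have hsum : ∀ {α : Type} [Fintype α] [DecidableEq α] (p : α → ℝ) (_ : ∑ x, p x = 1)
        (B : Finset α), ∑ x, p x * ((if x ∈ B then (1 : ℝ) else 0) + δ) = ∑ x ∈ B, p x + δ := by
      intro α _ _ p hp B
      simp only [mul_add, Finset.sum_add_distrib, ← Finset.sum_mul, hp, one_mul, mul_ite, mul_one,
        mul_zero, Finset.sum_ite_mem, Finset.univ_inter]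
    have h := tensorized_bound hP hT hl₀ hl₁ hμ hI d
      (f := fun t x => (if x ∈ C.B₀ t then (1 : ℝ) else 0) + δ)
      (g := fun t y => (if y ∈ C.B₁ t then (1 : ℝ) else 0) + δ)
      (fun t x => hind _ _) (fun t y => hind _ _)
    simp only [hsum _ (sum_prod_eq_one hP.row_sum), hsum _ (sum_prod_eq_one hP.col_sum)] at h
    refine le_trans (mul_le_mul_of_nonneg_right (Real.rpow_le_rpow (C.success_nonneg hP) ?_ hμ.le)
      (Real.exp_pos _).le) h
    rw [← Fintype.sum_prod_type']
    have hΦ : ∀ x y, 0 ≤ ∑ t, ((if x ∈ C.B₀ t then (1 : ℝ) else 0) + δ) ^ l₀ *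
        ((if y ∈ C.B₁ t then (1 : ℝ) else 0) + δ) ^ l₁ := fun x y =>
      Finset.sum_nonneg fun t _ =>
        mul_nonneg (Real.rpow_nonneg (hind _ _).le _) (Real.rpow_nonneg (hind _ _).le _)
    refine le_trans ?_ (Finset.sum_le_sum_of_subset_of_nonneg (Finset.subset_univ
      (Finset.univ.biUnion fun t => C.B₀ t ×ˢ C.B₁ t)) fun x _ _ => mul_nonneg
        (Finset.prod_nonneg fun _ _ => hP.1 _ _) (Real.rpow_nonneg (hΦ _ _) _))
    refine Finset.sum_le_sum fun x hx => ?_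
    obtain ⟨t, -, ht⟩ := Finset.mem_biUnion.1 hx
    obtain ⟨h0, h1⟩ := Finset.mem_product.1 ht
    refine le_mul_of_one_le_right (Finset.prod_nonneg fun _ _ => hP.1 _ _) ?_
    refine Real.one_le_rpow ?_ (one_div_pos.2 hμ).le
    refine le_trans ?_ (Finset.single_le_sum (f := fun t =>
      ((if x.1 ∈ C.B₀ t then (1 : ℝ) else 0) + δ) ^ l₀ *
        ((if x.2 ∈ C.B₁ t then (1 : ℝ) else 0) + δ) ^ l₁) (fun t _ =>
        mul_nonneg (Real.rpow_nonneg (hind _ _).le _) (Real.rpow_nonneg (hind _ _).le _))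
        (Finset.mem_univ t))
    simp only [h0, h1, if_true]
    exact one_le_mul_of_one_le_of_one_le (Real.one_le_rpow (by linarith) hl₀)
      (Real.one_le_rpow (by linarith) hl₁)
  have hcont : Continuous fun δ : ℝ => ∑ t, (BucketingCode.prob₀ P (C.B₀ t) + δ) ^ l₀ *
      (BucketingCode.prob₁ P (C.B₁ t) + δ) ^ l₁ := by
    refine continuous_finsetSum _ fun t _ => ?_
    exact ((Real.continuous_rpow_const hl₀).comp (continuous_const.add continuous_id)).mul
      ((Real.continuous_rpow_const hl₁).comp (continuous_const.add continuous_id))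
  have hlim := (hcont.tendsto 0).mono_left (nhdsWithin_le_nhds (s := Set.Ioi 0))
  simp only [add_zero] at hlim
  exact ge_of_tendsto hlim (eventually_mem_nhdsWithin.mono key)

theorem log_work_bound (hP : IsProbMatrix P) {n₀ n₁ S W l₀ l₁ μ : ℝ} (hS : 0 < S)
    (h : Attainable P d n₀ n₁ S W) (hl₀ : l₀ ≤ 1) (hl₁ : l₁ ≤ 1) (hl : 1 ≤ l₀ + l₁)
    (hμ : 0 < μ) :
    l₀ * Real.log n₀ + l₁ * Real.log n₁ + μ * Real.log S - d * bucketingInfo P l₀ l₁ μ ≤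
      Real.log W := by
  obtain ⟨hn₀, hn₁, -, C, hCS, hCW⟩ := h
  have hT : 0 < C.T := by
    rcases Nat.eq_zero_or_pos C.T with h0 | h0
    · have : IsEmpty (Fin C.T) := by rw [h0]; infer_instance
      have : C.success P = 0 := by simp [BucketingCode.success]
      linarith
    · exact h0
  have h1 := success_rpow_le C hP hT (by linarith) (by linarith) hμ
    fun R hR => infoObjective_le_bucketingInfo hP l₀ l₁ μ hR
  have h2 : n₀ ^ l₀ * n₁ ^ l₁ *
      ∑ t, BucketingCode.prob₀ P (C.B₀ t) ^ l₀ * BucketingCode.prob₁ P (C.B₁ t) ^ l₁ ≤ W := by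
    refine le_trans ?_ hCW
    rw [Finset.mul_sum, BucketingCode.work]
    refine Finset.sum_le_sum fun t _ => ?_
    have ha := BucketingCode.prob₀_nonneg hP (C.B₀ t)
    have hb := BucketingCode.prob₁_nonneg hP (C.B₁ t)
    refine le_trans (le_of_eq ?_) (rpow_mul_rpow_le_max (mul_nonneg hn₀.le ha)
      (mul_nonneg hn₁.le hb) hl₀ hl₁ hl)
    rw [Real.mul_rpow hn₀.le ha, Real.mul_rpow hn₁.le hb]
    ring
  have hp0 := Real.rpow_pos_of_pos hn₀ l₀
  have hp1 := Real.rpow_pos_of_pos hn₁ l₁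
  have hpS := Real.rpow_pos_of_pos hS μ
  have h3 : n₀ ^ l₀ * n₁ ^ l₁ * (S ^ μ * Real.exp (-(d * bucketingInfo P l₀ l₁ μ))) ≤ W := by
    refine le_trans (mul_le_mul_of_nonneg_left (le_trans (mul_le_mul_of_nonneg_right
      (Real.rpow_le_rpow hS.le hCS hμ.le) (Real.exp_pos _).le) h1) (mul_pos hp0 hp1).le) h2
  have h4 := Real.log_le_log (by positivity) h3
  rw [Real.log_mul (by positivity) (by positivity), Real.log_mul (by positivity) (by positivity),
    Real.log_mul (by positivity) (by positivity), Real.log_exp, Real.log_rpow hn₀,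
    Real.log_rpow hn₁, Real.log_rpow hS] at h4
  linarith

theorem bucketingInfo_anti (hP : IsProbMatrix P) (l₀ l₁ : ℝ) {μ ν : ℝ} (h : μ ≤ ν) :
    bucketingInfo P l₀ l₁ ν ≤ bucketingInfo P l₀ l₁ μ := by
  obtain ⟨R, hR, e⟩ := (isGreatest_bucketingInfo hP l₀ l₁ ν).1
  rw [← e]
  refine le_trans ?_ (infoObjective_le_bucketingInfo hP l₀ l₁ μ hR)
  have hK : 0 ≤ klJoint (∑ i, R i) P :=
    klJoint_nonneg hP (FiniteDiv.sum fun i _ => finiteFamilies.finiteDiv hR i)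
  unfold infoObjective
  nlinarith

/-- The half-spaces that bound the log-attainable set. -/
def infoPolar (P : Matrix (Fin b₀) (Fin b₁) ℝ) : Set (ℝ × ℝ × ℝ × ℝ) :=
  {x | 0 ≤ x.2.2.1 ∧ ∀ l₀ l₁ μ : ℝ, l₀ ≤ 1 → l₁ ≤ 1 → 1 ≤ l₀ + l₁ → 0 ≤ μ →
    x.2.2.2 ≥ l₀ * x.1 + l₁ * x.2.1 - μ * x.2.2.1 - bucketingInfo P l₀ l₁ μ}

theorem isClosed_infoPolar (P : Matrix (Fin b₀) (Fin b₁) ℝ) : IsClosed (infoPolar P) := by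
  have e : infoPolar P = {x | 0 ≤ x.2.2.1} ∩ ⋂ (l₀ : ℝ) (l₁ : ℝ) (μ : ℝ) (_ : l₀ ≤ 1) (_ : l₁ ≤ 1)
      (_ : 1 ≤ l₀ + l₁) (_ : 0 ≤ μ), {x : ℝ × ℝ × ℝ × ℝ |
        l₀ * x.1 + l₁ * x.2.1 - μ * x.2.2.1 - bucketingInfo P l₀ l₁ μ ≤ x.2.2.2} := by
    ext x
    simp [infoPolar]
  rw [e]
  refine (isClosed_le (by fun_prop) (by fun_prop)).inter ?_
  refine isClosed_iInter fun l₀ => isClosed_iInter fun l₁ => isClosed_iInter fun μ =>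
    isClosed_iInter fun _ => isClosed_iInter fun _ => isClosed_iInter fun _ =>
    isClosed_iInter fun _ => isClosed_le (by fun_prop) (by fun_prop)

theorem logAttainable_subset_infoPolar (hP : IsProbMatrix P) : logAttainable P ⊆ infoPolar P := by
  rintro _ ⟨d, n₀, n₁, S, W, hd, hS, h, rfl⟩
  have hd' : (0 : ℝ) < d := Nat.cast_pos.2 hd
  have hS1 : S ≤ 1 := by
    obtain ⟨-, -, -, C, hCS, -⟩ := h
    exact hCS.trans (C.success_le_one hP)
  have hlogS : 0 ≤ -Real.log S := neg_nonneg.2 (Real.log_nonpos hS.le hS1)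
  have hs : 0 ≤ (d : ℝ)⁻¹ * -Real.log S := mul_nonneg (inv_nonneg.2 hd'.le) hlogS
  have hpos : ∀ l₀ l₁ μ : ℝ, l₀ ≤ 1 → l₁ ≤ 1 → 1 ≤ l₀ + l₁ → 0 < μ →
      l₀ * ((d : ℝ)⁻¹ * Real.log n₀) + l₁ * ((d : ℝ)⁻¹ * Real.log n₁) -
        μ * ((d : ℝ)⁻¹ * -Real.log S) - bucketingInfo P l₀ l₁ μ ≤ (d : ℝ)⁻¹ * Real.log W := by
    intro l₀ l₁ μ h0 h1 h2 h3
    have := mul_le_mul_of_nonneg_left (log_work_bound hP hS h h0 h1 h2 h3) (inv_nonneg.2 hd'.le)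
    refine le_trans (le_of_eq ?_) this
    field_simp
    ring
  refine ⟨hs, fun l₀ l₁ μ h0 h1 h2 h3 => ?_⟩
  change l₀ * ((d : ℝ)⁻¹ * Real.log n₀) + l₁ * ((d : ℝ)⁻¹ * Real.log n₁) -
        μ * ((d : ℝ)⁻¹ * -Real.log S) - bucketingInfo P l₀ l₁ μ ≤ (d : ℝ)⁻¹ * Real.log W
  rcases h3.eq_or_lt with rfl | h3
  -- The exponent 1/μ excludes μ = 0; that case is the limit ν → 0 from the right, with the
  -- information at ν bounded by the information at 0 through monotonicity.
  · have hlim : Tendsto (fun ν : ℝ => l₀ * ((d : ℝ)⁻¹ * Real.log n₀) +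
        l₁ * ((d : ℝ)⁻¹ * Real.log n₁) - ν * ((d : ℝ)⁻¹ * -Real.log S) -
          bucketingInfo P l₀ l₁ 0) (𝓝[>] 0) (𝓝 (l₀ * ((d : ℝ)⁻¹ * Real.log n₀) +
        l₁ * ((d : ℝ)⁻¹ * Real.log n₁) - 0 * ((d : ℝ)⁻¹ * -Real.log S) -
          bucketingInfo P l₀ l₁ 0)) :=
      (Continuous.tendsto (by fun_prop) 0).mono_left nhdsWithin_le_nhds
    refine le_of_tendsto hlim (eventually_mem_nhdsWithin.mono fun ν hν => ?_)
    have := hpos l₀ l₁ ν h0 h1 h2 hν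
    have := bucketingInfo_anti hP l₀ l₁ (le_of_lt (Set.mem_Ioi.1 hν))
    linarith
  · exact hpos l₀ l₁ μ h0 h1 h2 h3

end Converse

/-! ### The two core cones as systems of inequalities. -/

section Cores

variable {A : Set (ℝ × ℝ × ℝ × ℝ)} {x y : ℝ × ℝ × ℝ × ℝ}

theorem subset_convCone (A : Set (ℝ × ℝ × ℝ × ℝ)) : A ⊆ convCone A := PointedCone.subset_hull

theorem convCone_zero_mem (A : Set (ℝ × ℝ × ℝ × ℝ)) : 0 ∈ convCone A :=
  (PointedCone.hull ℝ A).zero_mem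

theorem convCone_add_mem (hx : x ∈ convCone A) (hy : y ∈ convCone A) : x + y ∈ convCone A :=
  (PointedCone.hull ℝ A).add_mem hx hy

theorem convCone_smul_mem {c : ℝ} (hc : 0 ≤ c) (hx : x ∈ convCone A) : c • x ∈ convCone A :=
  (PointedCone.hull ℝ A).smul_mem hc hx

theorem convCone_subset {B : Set (ℝ × ℝ × ℝ × ℝ)} (hAB : A ⊆ B) (h0 : 0 ∈ B)
    (hadd : ∀ x ∈ B, ∀ y ∈ B, x + y ∈ B) (hsmul : ∀ c : ℝ, 0 ≤ c → ∀ x ∈ B, c • x ∈ B) :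
    convCone A ⊆ B := by
  intro x hx
  refine Submodule.span_induction (R := {c : ℝ // 0 ≤ c}) (p := fun x _ => x ∈ B) (fun x hx => hAB hx) h0
    (fun x y _ _ hx hy => hadd x hx y hy) (fun c x _ hx => hsmul c c.2 x hx) hx

theorem mem_commonCore_iff {m₀ m₁ s w : ℝ} :
    (m₀, m₁, s, w) ∈ commonCore ↔ 0 ≤ s ∧ m₀ ≤ w ∧ m₁ ≤ w ∧ m₀ + m₁ ≤ w := by
  constructor
  · intro h
    have : commonCore ⊆ {x | 0 ≤ x.2.2.1 ∧ x.1 ≤ x.2.2.2 ∧ x.2.1 ≤ x.2.2.2 ∧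
        x.1 + x.2.1 ≤ x.2.2.2} := by
      refine convCone_subset ?_ (by simp) ?_ ?_
      · rintro x (rfl | rfl | rfl | rfl | rfl) <;> norm_num
      · rintro x ⟨h1, h2, h3, h4⟩ y ⟨h5, h6, h7, h8⟩
        simp only [Set.mem_ofPred_eq, Prod.fst_add, Prod.snd_add]
        refine ⟨?_, ?_, ?_, ?_⟩ <;> linarith
      · rintro c hc x ⟨h1, h2, h3, h4⟩
        simp only [Set.mem_ofPred_eq, Prod.smul_fst, Prod.smul_snd, smul_eq_mul, ← mul_add]
        exact ⟨mul_nonneg hc h1, mul_le_mul_of_nonneg_left h2 hc, mul_le_mul_of_nonneg_left h3 hc,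
          mul_le_mul_of_nonneg_left h4 hc⟩
    exact this h
  · rintro ⟨h1, h2, h3, h4⟩
    -- The least multiple of (-1, -1, 0, -1) that leaves nonnegative coefficients for the first two
    -- generators; the three upper bounds on `m₀`, `m₁`, `m₀ + m₁` say that enough `w` remains.
    set t := max 0 (max (-m₀) (-m₁)) with ht
    have hgen : ∀ a b c e g : ℝ, 0 ≤ a → 0 ≤ b → 0 ≤ c → 0 ≤ e → 0 ≤ g →
        a • ((1, 0, 0, 1) : ℝ × ℝ × ℝ × ℝ) + (b • (0, 1, 0, 1) + (c • (0, 0, 1, 0) +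
          (e • (0, 0, 0, 1) + g • (-1, -1, 0, -1)))) ∈ commonCore := by
      intro a b c e g ha hb hc he hg
      refine convCone_add_mem (convCone_smul_mem ha (subset_convCone _ (by simp)))
        (convCone_add_mem (convCone_smul_mem hb (subset_convCone _ (by simp)))
        (convCone_add_mem (convCone_smul_mem hc (subset_convCone _ (by simp)))
        (convCone_add_mem (convCone_smul_mem he (subset_convCone _ (by simp)))
        (convCone_smul_mem hg (subset_convCone _ (by simp))))))
    have ht0 : 0 ≤ t := le_max_left _ _
    have hm0 : 0 ≤ m₀ + t := by
      have : -m₀ ≤ t := (le_max_left _ _).trans (le_max_right _ _)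
      linarith
    have hm1 : 0 ≤ m₁ + t := by
      have : -m₁ ≤ t := (le_max_right _ _).trans (le_max_right _ _)
      linarith
    have he : 0 ≤ w - m₀ - m₁ - t := by
      have : t ≤ w - m₀ - m₁ := max_le (by linarith) (max_le (by linarith) (by linarith))
      linarith
    have := hgen _ _ _ _ _ hm0 hm1 h1 he ht0
    convert this using 1
    simp only [Prod.smul_mk, smul_eq_mul, Prod.mk_add_mk, Prod.mk.injEq]
    refine ⟨?_, ?_, ?_, ?_⟩ <;> ring

theorem isClosed_commonCore : IsClosed commonCore := by
  have e : commonCore = {x | 0 ≤ x.2.2.1} ∩ ({x | x.1 ≤ x.2.2.2} ∩ ({x | x.2.1 ≤ x.2.2.2} ∩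
      {x | x.1 + x.2.1 ≤ x.2.2.2})) := by
    ext ⟨m₀, m₁, s, w⟩
    rw [mem_commonCore_iff]
    rfl
  rw [e]
  refine IsClosed.inter ?_ (IsClosed.inter ?_ (IsClosed.inter ?_ ?_)) <;>
    exact isClosed_le (by fun_prop) (by fun_prop)

theorem mem_extendedCore_iff {m₀ m₁ s w : ℝ} :
    (m₀, m₁, s, w) ∈ extendedCore ↔ (m₀ ≤ w ∧ m₁ ≤ w ∧ m₀ + m₁ ≤ w) ∧
      m₀ ≤ w + s ∧ m₁ ≤ w + s ∧ m₀ + m₁ ≤ w + s := by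
  constructor
  · rintro ⟨⟨a, b, c, e⟩, h, v, hv, hx⟩
    obtain ⟨α, hα, v', hv', rfl⟩ : ∃ α : ℝ, 0 ≤ α ∧ ∃ v' ∈ ({(0, 0, -1, 1)} : Set (ℝ × ℝ × ℝ × ℝ)),
        α • v' = v := by
      obtain ⟨α, hα, hv⟩ := Set.mem_iUnion₂.1 hv
      exact ⟨α, hα, Set.mem_smul_set.1 hv⟩
    rw [Set.mem_singleton_iff.1 hv'] at hx
    obtain ⟨h1, h2, h3, h4⟩ := mem_commonCore_iff.1 h
    simp only [Prod.smul_mk, smul_eq_mul, Prod.mk_add_mk, Prod.mk.injEq] at hx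
    obtain ⟨rfl, rfl, rfl, rfl⟩ := hx
    refine ⟨⟨?_, ?_, ?_⟩, ?_, ?_, ?_⟩ <;> linarith
  · rintro ⟨⟨h1, h2, h3⟩, h4, h5, h6⟩
    -- The negative part of `s` is exactly what the extra ray has to supply.
    refine ⟨(m₀, m₁, s + max 0 (-s), w - max 0 (-s)), mem_commonCore_iff.2 ?_,
      max 0 (-s) • (0, 0, -1, 1), ?_, ?_⟩
    · rcases le_total 0 s with h | h
      · rw [max_eq_left (by linarith)]
        refine ⟨?_, ?_, ?_, ?_⟩ <;> linarith
      · rw [max_eq_right (by linarith)]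
        refine ⟨?_, ?_, ?_, ?_⟩ <;> linarith
    · exact Set.mem_biUnion (Set.mem_Ici.2 (le_max_left _ _))
        (Set.smul_mem_smul_set (Set.mem_singleton _))
    · simp

end Cores

/-! ### Products and powers of codes. -/

section Attainability

variable {b₀ b₁ : ℕ} {P : Matrix (Fin b₀) (Fin b₁) ℝ}

/-- Attainability with coordinates indexed by an arbitrary finite type. -/
def AttainableOn (P : Matrix (Fin b₀) (Fin b₁) ℝ) (κ : Type) [Fintype κ] (n₀ n₁ S W : ℝ) : Prop :=
  ∃ (τ : Type) (_ : Fintype τ) (B₀ : τ → Finset (κ → Fin b₀)) (B₁ : τ → Finset (κ → Fin b₁))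
    (U : Finset ((κ → Fin b₀) × (κ → Fin b₁))),
    (∀ x ∈ U, ∃ t, x.1 ∈ B₀ t ∧ x.2 ∈ B₁ t) ∧ S ≤ ∑ x ∈ U, ∏ i, P (x.1 i) (x.2 i) ∧
    ∑ t, max (max (n₀ * ∑ x ∈ B₀ t, ∏ i, rowMarg P (x i)) (n₁ * ∑ y ∈ B₁ t, ∏ i, colMarg P (y i)))
      ((n₀ * ∑ x ∈ B₀ t, ∏ i, rowMarg P (x i)) * (n₁ * ∑ y ∈ B₁ t, ∏ i, colMarg P (y i))) ≤ W

theorem Attainable.on {d : ℕ} {n₀ n₁ S W : ℝ} (h : Attainable P d n₀ n₁ S W) :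
    AttainableOn P (Fin d) n₀ n₁ S W := by
  obtain ⟨-, -, -, C, hS, hW⟩ := h
  refine ⟨Fin C.T, inferInstance, C.B₀, C.B₁, Finset.univ.biUnion fun t => C.B₀ t ×ˢ C.B₁ t,
    ?_, hS, hW⟩
  intro x hx
  obtain ⟨t, -, ht⟩ := Finset.mem_biUnion.1 hx
  exact ⟨t, Finset.mem_product.1 ht⟩

theorem AttainableOn.attainable (hP : IsProbMatrix P) {κ : Type} [Fintype κ] {n₀ n₁ S W : ℝ}
    (h : AttainableOn P κ n₀ n₁ S W) (hn₀ : 0 < n₀) (hn₁ : 0 < n₁) (hS0 : 0 ≤ S) :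
    Attainable P (Fintype.card κ) n₀ n₁ S W := by
  classical
  obtain ⟨τ, _, B₀, B₁, U, hU, hS, hW⟩ := h
  have e := Fintype.equivFin κ
  have f := Fintype.equivFin τ
  let E : ∀ α : Type, (κ → α) ≃ (Fin (Fintype.card κ) → α) := fun α =>
    Equiv.arrowCongr e (Equiv.refl α)
  have hsum : ∀ {α : Type} (p : α → ℝ) (B : Finset (κ → α)),
      ∑ x ∈ B.map (E α).toEmbedding, ∏ i, p (x i) = ∑ x ∈ B, ∏ i, p (x i) := by
    intro α p B
    rw [Finset.sum_map]
    refine Finset.sum_congr rfl fun x _ => ?_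
    exact Equiv.prod_comp e.symm fun i => p (x i)
  refine ⟨hn₀, hn₁, hS0, ⟨Fintype.card τ, fun t => (B₀ (f.symm t)).map (E _).toEmbedding,
    fun t => (B₁ (f.symm t)).map (E _).toEmbedding⟩, ?_, ?_⟩
  · refine hS.trans ?_
    have e1 : ∑ x ∈ U, ∏ i, P (x.1 i) (x.2 i) =
        ∑ x ∈ U.map ((E (Fin b₀)).prodCongr (E (Fin b₁))).toEmbedding,
          ∏ i, P (x.1 i) (x.2 i) := by
      rw [Finset.sum_map]
      refine Finset.sum_congr rfl fun x _ => ?_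
      exact (Equiv.prod_comp e.symm fun i => P (x.1 i) (x.2 i)).symm
    rw [e1]
    refine Finset.sum_le_sum_of_subset_of_nonneg ?_ fun _ _ _ =>
      Finset.prod_nonneg fun _ _ => hP.1 _ _
    intro y hy
    obtain ⟨x, hx, rfl⟩ := Finset.mem_map.1 hy
    obtain ⟨t, h0, h1⟩ := hU x hx
    refine Finset.mem_biUnion.2 ⟨f t, Finset.mem_univ _, Finset.mem_product.2 ⟨?_, ?_⟩⟩
    · simpa using h0
    · simpa using h1
  · refine le_trans (le_of_eq ?_) hW
    unfold BucketingCode.work BucketingCode.prob₀ BucketingCode.prob₁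
    simp only [hsum]
    exact Equiv.sum_comp f.symm fun t => max (max (n₀ * ∑ x ∈ B₀ t, ∏ i, rowMarg P (x i))
      (n₁ * ∑ y ∈ B₁ t, ∏ i, colMarg P (y i))) ((n₀ * ∑ x ∈ B₀ t, ∏ i, rowMarg P (x i)) *
        (n₁ * ∑ y ∈ B₁ t, ∏ i, colMarg P (y i)))

/-- Concatenated codes have product buckets, so all probabilities multiply. The maximum defining the
work is submultiplicative, since each of its three terms is a product of the corresponding terms. -/
theorem AttainableOn.prod (hP : IsProbMatrix P) {κ κ' : Type} [Fintype κ] [Fintype κ']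
    {n₀ n₁ S W n₀' n₁' S' W' : ℝ} (h : AttainableOn P κ n₀ n₁ S W)
    (h' : AttainableOn P κ' n₀' n₁' S' W') (hn₀ : 0 ≤ n₀) (hn₁ : 0 ≤ n₁) (hn₀' : 0 ≤ n₀')
    (hn₁' : 0 ≤ n₁') (hS'0 : 0 ≤ S') :
    AttainableOn P (κ ⊕ κ') (n₀ * n₀') (n₁ * n₁') (S * S') (W * W') := by
  classical
  obtain ⟨τ, _, B₀, B₁, U, hU, hS, hW⟩ := h
  obtain ⟨τ', _, B₀', B₁', U', hU', hS', hW'⟩ := h'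
  let E : ∀ α : Type, (κ → α) × (κ' → α) ≃ (κ ⊕ κ' → α) := fun α =>
    (Equiv.sumArrowEquivProdArrow κ κ' α).symm
  have hsum : ∀ {α : Type} (p : α → ℝ) (B : Finset (κ → α)) (B' : Finset (κ' → α)),
      ∑ x ∈ (B ×ˢ B').map (E α).toEmbedding, ∏ i, p (x i) =
        (∑ x ∈ B, ∏ i, p (x i)) * ∑ x ∈ B', ∏ i, p (x i) := by
    intro α p B B'
    rw [Finset.sum_map, Finset.sum_product, Finset.sum_mul_sum]
    refine Finset.sum_congr rfl fun x _ => Finset.sum_congr rfl fun y _ => ?_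
    rw [Fintype.prod_sum_type]
    rfl
  let F : ((κ → Fin b₀) × (κ → Fin b₁)) × ((κ' → Fin b₀) × (κ' → Fin b₁)) ≃
      (κ ⊕ κ' → Fin b₀) × (κ ⊕ κ' → Fin b₁) :=
    (Equiv.prodProdProdComm _ _ _ _).trans ((E (Fin b₀)).prodCongr (E (Fin b₁)))
  refine ⟨τ × τ', inferInstance, fun t => (B₀ t.1 ×ˢ B₀' t.2).map (E _).toEmbedding,
    fun t => (B₁ t.1 ×ˢ B₁' t.2).map (E _).toEmbedding, (U ×ˢ U').map F.toEmbedding, ?_, ?_, ?_⟩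
  · intro y hy
    obtain ⟨x, hx, rfl⟩ := Finset.mem_map.1 hy
    obtain ⟨hx0, hx1⟩ := Finset.mem_product.1 hx
    obtain ⟨t, h0, h1⟩ := hU _ hx0
    obtain ⟨t', h0', h1'⟩ := hU' _ hx1
    refine ⟨(t, t'), Finset.mem_map_of_mem (E _).toEmbedding
      (a := (x.1.1, x.2.1)) (Finset.mem_product.2 ⟨h0, h0'⟩),
      Finset.mem_map_of_mem (E _).toEmbedding
      (a := (x.1.2, x.2.2)) (Finset.mem_product.2 ⟨h1, h1'⟩)⟩
  · have e : ∑ x ∈ (U ×ˢ U').map F.toEmbedding, ∏ i, P (x.1 i) (x.2 i) =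
        (∑ x ∈ U, ∏ i, P (x.1 i) (x.2 i)) * ∑ x ∈ U', ∏ i, P (x.1 i) (x.2 i) := by
      rw [Finset.sum_map, Finset.sum_product, Finset.sum_mul_sum]
      refine Finset.sum_congr rfl fun x _ => Finset.sum_congr rfl fun y _ => ?_
      rw [Fintype.prod_sum_type]
      rfl
    rw [e]
    exact mul_le_mul hS hS' hS'0 (Finset.sum_nonneg fun _ _ =>
      Finset.prod_nonneg fun _ _ => hP.1 _ _)
  · simp only [hsum]
    have hr : ∀ {κ : Type} [Fintype κ] (B : Finset (κ → Fin b₀)),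
        0 ≤ ∑ x ∈ B, ∏ i, rowMarg P (x i) := fun B =>
      Finset.sum_nonneg fun _ _ => Finset.prod_nonneg fun _ _ => hP.row_nonneg _
    have hc : ∀ {κ : Type} [Fintype κ] (B : Finset (κ → Fin b₁)),
        0 ≤ ∑ x ∈ B, ∏ i, colMarg P (x i) := fun B =>
      Finset.sum_nonneg fun _ _ => Finset.prod_nonneg fun _ _ => hP.col_nonneg _
    have hmax : ∀ a b a' b' : ℝ, 0 ≤ a → 0 ≤ b → 0 ≤ a' → 0 ≤ b' →
        max (max (a * a') (b * b')) ((a * a') * (b * b')) ≤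
          max (max a b) (a * b) * max (max a' b') (a' * b') := by
      intro a b a' b' ha hb ha' hb'
      have h1 : a ≤ max (max a b) (a * b) := (le_max_left _ _).trans (le_max_left _ _)
      have h2 : b ≤ max (max a b) (a * b) := (le_max_right _ _).trans (le_max_left _ _)
      have h3 : a * b ≤ max (max a b) (a * b) := le_max_right _ _
      have h1' : a' ≤ max (max a' b') (a' * b') := (le_max_left _ _).trans (le_max_left _ _)
      have h2' : b' ≤ max (max a' b') (a' * b') := (le_max_right _ _).trans (le_max_left _ _)
      have h3' : a' * b' ≤ max (max a' b') (a' * b') := le_max_right _ _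
      refine max_le (max_le (mul_le_mul h1 h1' ha' (ha.trans h1))
        (mul_le_mul h2 h2' hb' (hb.trans h2))) ?_
      rw [mul_mul_mul_comm]
      exact mul_le_mul h3 h3' (mul_nonneg ha' hb') (ha.trans h1)
    refine le_trans ?_ (mul_le_mul hW hW' (Finset.sum_nonneg fun t _ => ?_) (le_trans
      (Finset.sum_nonneg fun t _ => ?_) hW))
    · rw [Finset.sum_mul_sum, Fintype.sum_prod_type]
      refine Finset.sum_le_sum fun t _ => Finset.sum_le_sum fun t' _ => ?_
      rw [mul_mul_mul_comm n₀, mul_mul_mul_comm n₁]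
      exact hmax _ _ _ _ (mul_nonneg hn₀ (hr _)) (mul_nonneg hn₁ (hc _))
        (mul_nonneg hn₀' (hr _)) (mul_nonneg hn₁' (hc _))
    · exact le_max_of_le_right (mul_nonneg (mul_nonneg hn₀' (hr _)) (mul_nonneg hn₁' (hc _)))
    · exact le_max_of_le_right (mul_nonneg (mul_nonneg hn₀ (hr _)) (mul_nonneg hn₁ (hc _)))

theorem Attainable.prod (hP : IsProbMatrix P) {d d' : ℕ} {n₀ n₁ S W n₀' n₁' S' W' : ℝ}
    (h : Attainable P d n₀ n₁ S W) (h' : Attainable P d' n₀' n₁' S' W') :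
    Attainable P (d + d') (n₀ * n₀') (n₁ * n₁') (S * S') (W * W') := by
  have := (h.on.prod hP h'.on h.1.le h.2.1.le h'.1.le h'.2.1.le h'.2.2.1).attainable hP
    (mul_pos h.1 h'.1) (mul_pos h.2.1 h'.2.1) (mul_nonneg h.2.2.1 h'.2.2.1)
  simpa using this

theorem Attainable.pow (hP : IsProbMatrix P) {d : ℕ} {n₀ n₁ S W : ℝ}
    (h : Attainable P d n₀ n₁ S W) (k : ℕ) :
    Attainable P ((k + 1) * d) (n₀ ^ (k + 1)) (n₁ ^ (k + 1)) (S ^ (k + 1)) (W ^ (k + 1)) := by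
  induction k with
  | zero => simpa using h
  | succ k ih =>
    have := ih.prod hP h
    simpa only [pow_succ _ (k + 1), Nat.succ_mul] using this

theorem Attainable.work_pos (hP : IsProbMatrix P) {d : ℕ} {n₀ n₁ S W : ℝ}
    (h : Attainable P d n₀ n₁ S W) (hS : 0 < S) : 0 < W := by
  obtain ⟨hn₀, hn₁, -, C, hCS, hCW⟩ := h
  obtain ⟨x, hx, hx0⟩ := Finset.exists_ne_zero_of_sum_ne_zero (hS.trans_le hCS).ne'
  obtain ⟨t, -, ht⟩ := Finset.mem_biUnion.1 hx
  obtain ⟨h0, -⟩ := Finset.mem_product.1 ht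
  have hnn : ∀ t, 0 ≤ n₀ * BucketingCode.prob₀ P (C.B₀ t) * (n₁ * BucketingCode.prob₁ P (C.B₁ t)) :=
    fun t => mul_nonneg (mul_nonneg hn₀.le (BucketingCode.prob₀_nonneg hP _))
      (mul_nonneg hn₁.le (BucketingCode.prob₁_nonneg hP _))
  have hp : 0 < BucketingCode.prob₀ P (C.B₀ t) := by
    refine Finset.sum_pos' (fun _ _ => Finset.prod_nonneg fun _ _ => hP.row_nonneg _)
      ⟨x.1, h0, Finset.prod_pos fun i _ => lt_of_le_of_ne (hP.row_nonneg _) fun h => ?_⟩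
    refine hx0 (Finset.prod_eq_zero (Finset.mem_univ i) ?_)
    exact (Finset.sum_eq_zero_iff_of_nonneg fun k _ => hP.1 (x.1 i) k).1 h.symm _
      (Finset.mem_univ _)
  refine lt_of_lt_of_le (lt_of_lt_of_le (mul_pos hn₀ hp) ?_) hCW
  refine le_trans ((le_max_left _ _).trans (le_max_left _ _))
    (Finset.single_le_sum (f := fun t => max (max (n₀ * BucketingCode.prob₀ P (C.B₀ t))
      (n₁ * BucketingCode.prob₁ P (C.B₁ t))) (n₀ * BucketingCode.prob₀ P (C.B₀ t) *
        (n₁ * BucketingCode.prob₁ P (C.B₁ t)))) (fun t _ => le_max_of_le_right (hnn t))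
      (Finset.mem_univ t))

end Attainability

/-! ### Convexity of the attainable set and absorption of the common core. -/

section LogAttainable

open Filter Topology

variable {b₀ b₁ : ℕ} {P : Matrix (Fin b₀) (Fin b₁) ℝ} {x y : ℝ × ℝ × ℝ × ℝ}

/-- The code is kept and the parameters are rescaled exponentially. The inequalities of the core say
that none of the three terms of the work grows faster than the allowed work, and that the demanded
success does not increase. -/
theorem logAttainable_add_core (hP : IsProbMatrix P) (hx : x ∈ logAttainable P)
    (hy : y ∈ commonCore) : x + y ∈ logAttainable P := by
  obtain ⟨d, n₀, n₁, S, W, hd, hS, h, rfl⟩ := hx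
  have hW := h.work_pos hP hS
  obtain ⟨hn₀, hn₁, -, C, hCS, hCW⟩ := h
  obtain ⟨a, b, s, w⟩ := y
  obtain ⟨h1, h2, h3, h4⟩ := mem_commonCore_iff.1 hy
  have hd' : (0 : ℝ) < d := Nat.cast_pos.2 hd
  refine ⟨d, n₀ * Real.exp (d * a), n₁ * Real.exp (d * b), S * Real.exp (-(d * s)),
    W * Real.exp (d * w), hd, by positivity, ⟨by positivity, by positivity, by positivity,
      C, ?_, ?_⟩, ?_⟩
  · refine le_trans (mul_le_of_le_one_right hS.le (Real.exp_le_one_iff.2 ?_)) hCS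
    exact neg_nonpos.2 (mul_nonneg hd'.le h1)
  · refine le_trans ?_ (mul_le_mul_of_nonneg_right hCW (Real.exp_pos _).le)
    rw [BucketingCode.work, BucketingCode.work, Finset.sum_mul]
    refine Finset.sum_le_sum fun t _ => ?_
    have hp := mul_nonneg hn₀.le (BucketingCode.prob₀_nonneg hP (C.B₀ t))
    have hq := mul_nonneg hn₁.le (BucketingCode.prob₁_nonneg hP (C.B₁ t))
    have e2 : Real.exp (d * a) ≤ Real.exp (d * w) :=
      Real.exp_le_exp.2 (mul_le_mul_of_nonneg_left h2 hd'.le)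
    have e3 : Real.exp (d * b) ≤ Real.exp (d * w) :=
      Real.exp_le_exp.2 (mul_le_mul_of_nonneg_left h3 hd'.le)
    have e4 : Real.exp (d * a) * Real.exp (d * b) ≤ Real.exp (d * w) := by
      rw [← Real.exp_add, ← mul_add]
      exact Real.exp_le_exp.2 (mul_le_mul_of_nonneg_left h4 hd'.le)
    rw [max_mul_of_nonneg _ _ (Real.exp_pos _).le, max_mul_of_nonneg _ _ (Real.exp_pos _).le]
    refine max_le_max (max_le_max ?_ ?_) ?_
    · rw [mul_right_comm]
      exact mul_le_mul_of_nonneg_left e2 hp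
    · rw [mul_right_comm]
      exact mul_le_mul_of_nonneg_left e3 hq
    · rw [mul_right_comm n₀, mul_right_comm n₁, mul_mul_mul_comm]
      exact mul_le_mul_of_nonneg_left e4 (mul_nonneg hp hq)
  · rw [Real.log_mul hn₀.ne' (Real.exp_pos _).ne', Real.log_mul hn₁.ne' (Real.exp_pos _).ne',
      Real.log_mul hS.ne' (Real.exp_pos _).ne', Real.log_mul hW.ne' (Real.exp_pos _).ne']
    simp only [Real.log_exp, Prod.smul_mk, smul_eq_mul, Prod.mk_add_mk, Prod.mk.injEq]
    refine ⟨?_, ?_, ?_, ?_⟩ <;> field_simp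
    ring

theorem logAttainable_rat_combo (hP : IsProbMatrix P) (hx : x ∈ logAttainable P)
    (hy : y ∈ logAttainable P) (k l : ℕ) :
    ((k + 1 : ℝ) / (k + 1 + (l + 1))) • x + ((l + 1 : ℝ) / (k + 1 + (l + 1))) • y ∈
      logAttainable P := by
  obtain ⟨d, n₀, n₁, S, W, hd, hS, h, rfl⟩ := hx
  obtain ⟨d', n₀', n₁', S', W', hd', hS', h', rfl⟩ := hy
  obtain ⟨e, rfl⟩ := Nat.exists_eq_succ_of_ne_zero hd.ne'
  obtain ⟨e', rfl⟩ := Nat.exists_eq_succ_of_ne_zero hd'.ne'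
  have hW := h.work_pos hP hS
  have hW' := h'.work_pos hP hS'
  have hn₀ := h.1
  have hn₁ := h.2.1
  have hn₀' := h'.1
  have hn₁' := h'.2.1
  -- Each code is also raised to the dimension of the other, so that the two factors have dimensions
  -- in the ratio k + 1 : l + 1.
  refine ⟨_, _, _, _, _, ?_, ?_, ((h.pow hP k).pow hP e').prod hP ((h'.pow hP l).pow hP e), ?_⟩
  · positivity
  · positivity
  · rw [Real.log_mul (by positivity) (by positivity), Real.log_mul (by positivity) (by positivity),
      Real.log_mul (by positivity) (by positivity), Real.log_mul (by positivity) (by positivity)]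
    simp only [Real.log_pow, Prod.smul_mk, smul_eq_mul, Prod.mk_add_mk, Prod.mk.injEq,
      Nat.succ_eq_add_one]
    push_cast
    refine ⟨?_, ?_, ?_, ?_⟩ <;> field_simp
    ring

theorem convex_closure_logAttainable (hP : IsProbMatrix P) :
    Convex ℝ (closure (logAttainable P)) := by
  intro x hx y hy a b ha hb hab
  have key : ∀ x ∈ logAttainable P, ∀ y ∈ logAttainable P,
      a • x + b • y ∈ closure (logAttainable P) := by
    intro x hx y hy
    -- The added one matches the positive number of copies in the rational combinations and
    -- disappears in the limit.
    have hlim : ∀ c : ℝ, 0 ≤ c →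
        Tendsto (fun n : ℕ => ((⌊c * n⌋₊ : ℝ) + 1) / n) atTop (𝓝 c) := by
      intro c hc
      have h1 := (tendsto_nat_floor_mul_div_atTop hc).comp (tendsto_natCast_atTop_atTop (R := ℝ))
      have h2 := h1.add tendsto_one_div_atTop_nhds_zero_nat
      rw [add_zero] at h2
      refine h2.congr fun n => ?_
      simp only [Function.comp_apply, add_div]
    have hsum := (hlim a ha).add (hlim b hb)
    rw [hab] at hsum
    have hA := (hlim a ha).div hsum one_ne_zero
    have hB := (hlim b hb).div hsum one_ne_zero
    rw [div_one] at hA hB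
    have h3 := (hA.smul_const x).add (hB.smul_const y)
    refine mem_closure_of_tendsto h3 ((eventually_gt_atTop 0).mono fun n hn => ?_)
    have hn' : (0 : ℝ) < n := Nat.cast_pos.2 hn
    have h4 := logAttainable_rat_combo hP hx hy ⌊a * n⌋₊ ⌊b * n⌋₊
    convert h4 using 2
    · congr 1
      simp only [Pi.div_apply]
      field_simp
    · congr 1
      simp only [Pi.div_apply]
      field_simp
  have := map_mem_closure₂ (f := fun x y : ℝ × ℝ × ℝ × ℝ => a • x + b • y)
    (u := closure (logAttainable P)) (by fun_prop) hx hy key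
  rwa [closure_closure] at this

theorem closure_logAttainable_add_core (hP : IsProbMatrix P) (hx : x ∈ closure (logAttainable P))
    (hy : y ∈ commonCore) : x + y ∈ closure (logAttainable P) :=
  map_mem_closure (f := fun x => x + y) (by fun_prop) hx
    fun _ hz => logAttainable_add_core hP hz hy

theorem smul_mem_closure_cone {c : ℝ} (hc : 0 ≤ c) (hx : x ∈ closure (logAttainable P)) :
    c • x ∈ closure (logAttainableCone P) :=
  map_mem_closure (f := fun x => c • x) (by fun_prop) hx fun z hz =>
    Set.mem_biUnion (Set.mem_Ici.2 hc) (Set.smul_mem_smul_set hz)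

theorem mem_logAttainableCone_iff :
    x ∈ logAttainableCone P ↔ ∃ c : ℝ, 0 ≤ c ∧ ∃ z ∈ logAttainable P, c • z = x := by
  simp only [logAttainableCone, rayCone, Set.mem_iUnion₂, Set.mem_smul_set, Set.mem_Ici,
    exists_prop]

theorem closure_cone_add_mem (hP : IsProbMatrix P) (hx : x ∈ closure (logAttainableCone P))
    (hy : y ∈ closure (logAttainableCone P)) : x + y ∈ closure (logAttainableCone P) := by
  have := map_mem_closure₂ (f := fun x y : ℝ × ℝ × ℝ × ℝ => x + y)
    (u := closure (logAttainableCone P)) (by fun_prop) hx hy fun x hx y hy => by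
      obtain ⟨a, ha, u, hu, rfl⟩ := mem_logAttainableCone_iff.1 hx
      obtain ⟨b, hb, v, hv, rfl⟩ := mem_logAttainableCone_iff.1 hy
      rcases (add_nonneg ha hb).eq_or_lt with h0 | h0
      · have ha0 : a = 0 := by linarith
        have hb0 : b = 0 := by linarith
        have := smul_mem_closure_cone le_rfl (subset_closure hu)
        simpa [ha0, hb0] using this
      · have h1 := convex_closure_logAttainable hP (subset_closure hu) (subset_closure hv)
          (div_nonneg ha h0.le) (div_nonneg hb h0.le) (by field_simp)
        have h2 := smul_mem_closure_cone h0.le h1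
        rwa [smul_add, smul_smul, smul_smul, mul_div_cancel₀ _ h0.ne',
          mul_div_cancel₀ _ h0.ne'] at h2
  rwa [closure_closure] at this

theorem closure_cone_smul_mem {c : ℝ} (hc : 0 ≤ c) (hx : x ∈ closure (logAttainableCone P)) :
    c • x ∈ closure (logAttainableCone P) :=
  map_mem_closure (f := fun x => c • x) (by fun_prop) hx fun z hz => by
    obtain ⟨a, ha, u, hu, rfl⟩ := mem_logAttainableCone_iff.1 hz
    exact mem_logAttainableCone_iff.2 ⟨c * a, mul_nonneg hc ha, u, hu, mul_smul _ _ _⟩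

/-- For a fixed attainable u, the point u + y/ε is attainable; scaling it by ε gives εu + y, which
tends to y. -/
theorem commonCore_subset_closure_cone (hP : IsProbMatrix P) (hne : (logAttainable P).Nonempty) :
    commonCore ⊆ closure (logAttainableCone P) := by
  intro y hy
  obtain ⟨u, hu⟩ := hne
  have hlim : Tendsto (fun ε : ℝ => ε • u + y) (𝓝[>] 0) (𝓝 y) := by
    have : Continuous fun ε : ℝ => ε • u + y := by fun_prop
    have := (this.tendsto 0).mono_left (nhdsWithin_le_nhds (s := Set.Ioi 0))
    simpa using this
  refine mem_closure_of_tendsto hlim (eventually_mem_nhdsWithin.mono fun ε hε => ?_)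
  have hε' : (0 : ℝ) < ε := hε
  refine mem_logAttainableCone_iff.2 ⟨ε, hε'.le, u + ε⁻¹ • y, logAttainable_add_core hP hu
    (convCone_smul_mem (inv_pos.2 hε').le hy), ?_⟩
  rw [smul_add, smul_inv_smul₀ hε'.ne']

end LogAttainable

/-! ### Counting words of a given type. -/

section TypeClasses

variable {κ : Type} [Fintype κ] [DecidableEq κ]
  {γ δ : Type} [DecidableEq γ] [DecidableEq δ]

/-- The type class of a word: all its rearrangements. -/
def typeClass (g : κ → γ) : Finset (κ → γ) := Finset.univ.image fun σ : Equiv.Perm κ => g ∘ σ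

theorem mem_typeClass {g g' : κ → γ} : g' ∈ typeClass g ↔ ∃ σ : Equiv.Perm κ, g ∘ σ = g' := by
  simp [typeClass]

theorem self_mem_typeClass (g : κ → γ) : g ∈ typeClass g := mem_typeClass.2 ⟨1, rfl⟩

theorem card_typeClass_pos (g : κ → γ) : 0 < (typeClass g).card :=
  Finset.card_pos.2 ⟨g, self_mem_typeClass g⟩

/-- Orbit-stabilizer count: every fibre of σ ↦ g ∘ σ is a translate of the stabilizer, whose order
is the product of factorials. -/
theorem card_typeClass_mul [Fintype γ] (g : κ → γ) :
    (typeClass g).card * ∏ c, (Fintype.card {i // g i = c}).factorial =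
      (Fintype.card κ).factorial := by
  rw [← DomMulAct.stabilizer_card, ← Fintype.card_perm, ← Finset.card_univ (α := Equiv.Perm κ),
    Finset.card_eq_sum_card_image fun σ : Equiv.Perm κ => g ∘ σ]
  refine (Finset.sum_const_nat fun g' hg' => ?_).symm
  obtain ⟨τ, rfl⟩ := mem_typeClass.1 hg'
  rw [Fintype.card_subtype]
  refine Finset.card_bij' (fun σ _ => σ * τ⁻¹) (fun σ _ => σ * τ) ?_ ?_ (by simp) (by simp)
  · intro σ hσ
    have h := (Finset.mem_filter.1 hσ).2
    refine Finset.mem_filter.2 ⟨Finset.mem_univ _, funext fun i => ?_⟩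
    simpa using congrFun h (τ⁻¹ i)
  · intro σ hσ
    have h := (Finset.mem_filter.1 hσ).2
    refine Finset.mem_filter.2 ⟨Finset.mem_univ _, funext fun i => ?_⟩
    exact congrFun h (τ i)

/-- The words that form, together with `g'`, a rearrangement of the pair of `g` and `h`. -/
def typeFiber [Fintype δ] (g : κ → γ) (h : κ → δ) (g' : κ → γ) : Finset (κ → δ) :=
  Finset.univ.filter fun h' => (fun i => (g' i, h' i)) ∈ typeClass fun i => (g i, h i)

theorem mem_typeFiber [Fintype δ] {g : κ → γ} {h : κ → δ} {g' : κ → γ} {h' : κ → δ} :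
    h' ∈ typeFiber g h g' ↔ ∃ σ : Equiv.Perm κ, g ∘ σ = g' ∧ h ∘ σ = h' := by
  simp only [typeFiber, Finset.mem_filter, Finset.mem_univ, true_and, mem_typeClass, funext_iff,
    Function.comp_apply, Prod.mk.injEq, forall_and]

/-- Permuting coordinates shows that all rearrangements of `g` have equally many completions; the
joint type class is the disjoint union of these fibres. -/
theorem card_typeFiber_mul [Fintype δ] (g : κ → γ) (h : κ → δ) {g' : κ → γ} (hg' : g' ∈ typeClass g) :
    (typeFiber g h g').card * (typeClass g).card = (typeClass fun i => (g i, h i)).card := by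
  have hconst : ∀ g'' ∈ typeClass g, (typeFiber g h g'').card = (typeFiber g h g).card := by
    intro g'' hg''
    obtain ⟨τ, rfl⟩ := mem_typeClass.1 hg''
    refine Finset.card_bij' (fun y _ => y ∘ τ.symm) (fun y _ => y ∘ τ) ?_ ?_ ?_ ?_
    · intro y hy
      obtain ⟨σ, h1, rfl⟩ := mem_typeFiber.1 hy
      refine mem_typeFiber.2 ⟨τ.symm.trans σ, funext fun i => ?_, rfl⟩
      simpa using congrFun h1 (τ.symm i)
    · intro y hy
      obtain ⟨σ, h1, rfl⟩ := mem_typeFiber.1 hy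
      exact mem_typeFiber.2 ⟨τ.trans σ, funext fun i => congrFun h1 (τ i), rfl⟩
    · intro y _
      funext i
      simp
    · intro y _
      funext i
      simp
  have hmaps : Set.MapsTo (fun z : κ → γ × δ => fun i => (z i).1) (typeClass fun i => (g i, h i))
      (typeClass g) := by
    intro z hz
    obtain ⟨σ, rfl⟩ := mem_typeClass.1 hz
    exact mem_typeClass.2 ⟨σ, rfl⟩
  rw [Finset.card_eq_sum_card_fiberwise hmaps, hconst g' hg', mul_comm]
  refine (Finset.sum_const_nat fun g'' hg'' => ?_).symm
  rw [← hconst g'' hg'']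
  refine Finset.card_bij' (fun z _ => fun i => (z i).2) (fun y _ => fun i => (g'' i, y i)) ?_ ?_ ?_ ?_
  · intro z hz
    obtain ⟨h1, rfl⟩ := Finset.mem_filter.1 hz
    exact Finset.mem_filter.2 ⟨Finset.mem_univ _, h1⟩
  · intro y hy
    exact Finset.mem_filter.2 ⟨(Finset.mem_filter.1 hy).2, rfl⟩
  · intro z hz
    obtain ⟨h1, rfl⟩ := Finset.mem_filter.1 hz
    rfl
  · intro y _
    rfl

end TypeClasses

/-! ### Greedy covering. -/

section Covering

/-- Greedy covering: if every point of `U` is covered by at least `q |A|` elements of `A`, then `T`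
elements of `A` can be chosen so that at most `(1 - q) ^ T |U|` points stay uncovered. -/
theorem exists_greedy_cover {α β : Type} [DecidableEq β] (A : Finset α)
    (hA : A.Nonempty) (r : α → β → Prop) [∀ a b, Decidable (r a b)] {q : ℝ} (hq : q ≤ 1) (T : ℕ) :
    ∀ U : Finset β, (∀ u ∈ U, q * A.card ≤ (A.filter fun a => r a u).card) →
      ∃ a : Fin T → α, (∀ t, a t ∈ A) ∧
        ((U.filter fun u => ∀ t, ¬ r (a t) u).card : ℝ) ≤ (1 - q) ^ T * U.card := by
  induction T with
  | zero =>
    intro U _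
    exact ⟨Fin.elim0, fun t => t.elim0, by simp⟩
  | succ T ih =>
    intro U hU
    -- Double counting of incidences: on average an element of `A` covers a fraction `q` of the
    -- points.
    obtain ⟨a₀, ha₀, hcov⟩ : ∃ a ∈ A, q * U.card ≤ ((U.filter fun u => r a u).card : ℝ) := by
      refine Finset.exists_le_of_sum_le hA ?_
      have hsw : ∑ a ∈ A, ((U.filter fun u => r a u).card : ℝ) =
          ∑ u ∈ U, ((A.filter fun a => r a u).card : ℝ) := by
        exact_mod_cast Finset.sum_card_bipartiteAbove_eq_sum_card_bipartiteBelow r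
      rw [hsw]
      refine le_trans (le_of_eq ?_) (Finset.sum_le_sum hU)
      rw [Finset.sum_const, Finset.sum_const, nsmul_eq_mul, nsmul_eq_mul]
      ring
    obtain ⟨a, ha, h⟩ := ih (U.filter fun u => ¬ r a₀ u)
      fun u hu => hU u (Finset.mem_filter.1 hu).1
    refine ⟨Fin.cons a₀ a, Fin.cases ha₀ ha, ?_⟩
    have e : (U.filter fun u => ∀ t, ¬ r ((Fin.cons a₀ a : Fin (T + 1) → α) t) u) =
        (U.filter fun u => ¬ r a₀ u).filter fun u => ∀ t, ¬ r (a t) u := by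
      rw [Finset.filter_filter]
      refine Finset.filter_congr fun u _ => ?_
      simp [Fin.forall_fin_succ]
    rw [e]
    refine h.trans ?_
    rw [pow_succ, mul_assoc]
    refine mul_le_mul_of_nonneg_left ?_ (pow_nonneg (by linarith) T)
    have := Finset.card_filter_add_card_filter_not (s := U) fun u => r a₀ u
    have h2 : ((U.filter fun u => r a₀ u).card : ℝ) + (U.filter fun u => ¬ r a₀ u).card = U.card := by
      exact_mod_cast this
    linarith

end Covering

/-! ### Codes built from type classes. -/

section TypeCodes

variable {b₀ b₁ : ℕ} {P : Matrix (Fin b₀) (Fin b₁) ℝ}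

theorem prod_comp_of_mem_typeClass {κ : Type} [Fintype κ] [DecidableEq κ] {γ : Type}
    [DecidableEq γ] (p : γ → ℝ) {g g' : κ → γ} (h : g' ∈ typeClass g) :
    ∏ i, p (g' i) = ∏ i, p (g i) := by
  obtain ⟨σ, rfl⟩ := mem_typeClass.1 h
  exact Equiv.prod_comp σ fun i => p (g i)

theorem sum_typeFiber {κ : Type} [Fintype κ] [DecidableEq κ] {γ δ : Type}
    [DecidableEq γ] [Fintype δ] [DecidableEq δ] (p : δ → ℝ) (g : κ → γ) (h : κ → δ) {g' : κ → γ}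
    (hg' : g' ∈ typeClass g) :
    ∑ y ∈ typeFiber g h g', ∏ i, p (y i) =
      (typeClass fun i => (g i, h i)).card / (typeClass g).card * ∏ i, p (h i) := by
  have h1 : ∀ y ∈ typeFiber g h g', ∏ i, p (y i) = ∏ i, p (h i) := by
    intro y hy
    obtain ⟨σ, -, h2⟩ := mem_typeFiber.1 hy
    exact prod_comp_of_mem_typeClass p (mem_typeClass.2 ⟨σ, h2⟩)
  have h0 : ((typeClass g).card : ℝ) ≠ 0 := Nat.cast_ne_zero.2 (card_typeClass_pos g).ne'
  rw [Finset.sum_congr rfl h1, Finset.sum_const, nsmul_eq_mul, ← card_typeFiber_mul g h hg']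
  push_cast
  field_simp

/-- A label word `a` defines the bucket pair of all words in prescribed joint type with `a`; a pair
`u` is caught as soon as `a` is compatible with it. A greedy selection of labels catches at least
half of the type class of `x`. The set sizes are the inverse bucket probabilities, so each bucket
pair costs exactly one and the work is the number of buckets. -/
theorem attainableOn_typeCode {κ L : Type} [Fintype κ] [DecidableEq κ] [Fintype L] [DecidableEq L]
    (l : κ → L) (x : κ → Fin b₀ × Fin b₁)
    (hrow : ∀ i, 0 < rowMarg P (x i).1) (hcol : ∀ i, 0 < colMarg P (x i).2)
    (hP0 : 0 ≤ ∏ i, P (x i).1 (x i).2) :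
    AttainableOn P κ
      ((typeClass fun i => (l i, (x i).1)).card / (typeClass l).card *
        ∏ i, rowMarg P (x i).1)⁻¹
      ((typeClass fun i => (l i, (x i).2)).card / (typeClass l).card *
        ∏ i, colMarg P (x i).2)⁻¹
      ((typeClass x).card * (∏ i, P (x i).1 (x i).2) / 2)
      (2 * ((typeClass x).card * (typeClass l).card / (typeClass fun i => (x i, l i)).card)) := by
  classical
  have hX : (0 : ℝ) < (typeClass x).card := Nat.cast_pos.2 (card_typeClass_pos x)
  have hL : (0 : ℝ) < (typeClass l).card := Nat.cast_pos.2 (card_typeClass_pos l)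
  have hXL : (0 : ℝ) < (typeClass fun i => (x i, l i)).card := Nat.cast_pos.2 (card_typeClass_pos _)
  set A := typeClass l
  set U := typeClass x
  have hfib : ∀ u ∈ U, (A.filter fun a => a ∈ typeFiber x l u) = typeFiber x l u := by
    intro u _
    refine Finset.ext fun a => ⟨fun h => (Finset.mem_filter.1 h).2, fun h =>
      Finset.mem_filter.2 ⟨?_, h⟩⟩
    obtain ⟨σ, -, h2⟩ := mem_typeFiber.1 h
    exact mem_typeClass.2 ⟨σ, h2⟩
  -- The fraction of label words compatible with a given pair, the same for every pair in the class.
  set q : ℝ := (typeClass fun i => (x i, l i)).card / (U.card * A.card) with hq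
  have hq0 : 0 < q := by positivity
  have hcard : ∀ u ∈ U, q * A.card = (A.filter fun a => a ∈ typeFiber x l u).card := by
    intro u hu
    rw [hfib u hu, hq, ← card_typeFiber_mul x l hu]
    push_cast
    field_simp
    rfl
  have hq1 : q ≤ 1 := by
    have h1 := hcard x (self_mem_typeClass x)
    have h2 : ((A.filter fun a => a ∈ typeFiber x l x).card : ℝ) ≤ A.card := by
      exact_mod_cast Finset.card_filter_le _ _
    rw [← h1] at h2
    exact le_of_mul_le_mul_right (by linarith) hL
  obtain ⟨T, hT⟩ : ∃ T, T = ⌈q⁻¹⌉₊ := ⟨_, rfl⟩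
  obtain ⟨a, haA, hunc⟩ := exists_greedy_cover A ⟨l, self_mem_typeClass l⟩
    (fun a u => a ∈ typeFiber x l u) hq1 T U fun u hu => (hcard u hu).le
  have hTq : 1 ≤ q * T := by
    have := Nat.le_ceil q⁻¹
    rw [← hT] at this
    have := mul_le_mul_of_nonneg_left this hq0.le
    rwa [mul_inv_cancel₀ hq0.ne'] at this
  have hTle : (T : ℝ) ≤ 2 * q⁻¹ := by
    have h1 := Nat.ceil_lt_add_one (inv_pos.2 hq0).le
    rw [← hT] at h1
    have h2 : 1 ≤ q⁻¹ := (one_le_inv₀ hq0).2 hq1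
    linarith
  -- Since qT ≥ 1, the uncovered fraction is at most exp(-1), hence at most one half.
  have hhalf : (1 - q) ^ T ≤ 1 / 2 := by
    have h1 : 1 - q ≤ Real.exp (-q) := by
      have := Real.add_one_le_exp (-q)
      linarith
    have h2 := pow_le_pow_left₀ (by linarith) h1 T
    rw [← Real.exp_nat_mul] at h2
    have h3 : Real.exp (T * -q) ≤ Real.exp (-1) := Real.exp_le_exp.2 (by linarith)
    have h4 : Real.exp (-1) ≤ 1 / 2 := by
      rw [Real.exp_neg, ← one_div]
      exact one_div_le_one_div_of_le two_pos (by linarith [Real.add_one_le_exp 1])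
    linarith
  set V := U.filter fun u => ∃ t, a t ∈ typeFiber x l u with hV
  have hVcard : (U.card : ℝ) / 2 ≤ V.card := by
    have h1 := Finset.card_filter_add_card_filter_not (s := U)
      fun u => ∃ t, a t ∈ typeFiber x l u
    have h2 : (V.card : ℝ) + (U.filter fun u => ¬ ∃ t, a t ∈ typeFiber x l u).card = U.card := by
      exact_mod_cast h1
    simp only [not_exists] at h2
    have h3 := mul_le_mul_of_nonneg_right hhalf hX.le
    linarith
  refine ⟨Fin T, inferInstance, fun t => typeFiber l (fun i => (x i).1) (a t),
    fun t => typeFiber l (fun i => (x i).2) (a t),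
    V.map (Equiv.arrowProdEquivProdArrow κ (fun _ => Fin b₀) fun _ => Fin b₁).toEmbedding,
    ?_, ?_, ?_⟩
  · intro y hy
    obtain ⟨u, hu, rfl⟩ := Finset.mem_map.1 hy
    obtain ⟨-, t, ht⟩ := Finset.mem_filter.1 hu
    obtain ⟨σ, h1, h2⟩ := mem_typeFiber.1 ht
    refine ⟨t, mem_typeFiber.2 ⟨σ, h2, ?_⟩, mem_typeFiber.2 ⟨σ, h2, ?_⟩⟩ <;>
      (subst h1; rfl)
  · rw [Finset.sum_map]
    have h1 : ∀ u ∈ V, ∏ i, P (u i).1 (u i).2 = ∏ i, P (x i).1 (x i).2 := fun u hu =>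
      prod_comp_of_mem_typeClass (fun jk : Fin b₀ × Fin b₁ => P jk.1 jk.2)
        (Finset.mem_filter.1 hu).1
    refine le_trans ?_ (Finset.sum_congr rfl h1).ge
    rw [Finset.sum_const, nsmul_eq_mul, mul_div_right_comm]
    exact mul_le_mul_of_nonneg_right hVcard hP0
  · have hp0 : (0 : ℝ) < (typeClass fun i => (l i, (x i).1)).card / A.card *
        ∏ i, rowMarg P (x i).1 :=
      mul_pos (div_pos (Nat.cast_pos.2 (card_typeClass_pos _)) hL)
        (Finset.prod_pos fun i _ => hrow i)
    have hp1 : (0 : ℝ) < (typeClass fun i => (l i, (x i).2)).card / A.card *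
        ∏ i, colMarg P (x i).2 :=
      mul_pos (div_pos (Nat.cast_pos.2 (card_typeClass_pos _)) hL)
        (Finset.prod_pos fun i _ => hcol i)
    have h0 : ∀ t, ∑ y ∈ typeFiber l (fun i => (x i).1) (a t), ∏ i, rowMarg P (y i) = _ := fun t =>
      sum_typeFiber (rowMarg P) l (fun i => (x i).1) (haA t)
    have h1 : ∀ t, ∑ y ∈ typeFiber l (fun i => (x i).2) (a t), ∏ i, colMarg P (y i) = _ := fun t =>
      sum_typeFiber (colMarg P) l (fun i => (x i).2) (haA t)
    simp only [h0, h1]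
    rw [inv_mul_cancel₀ hp0.ne', inv_mul_cancel₀ hp1.ne']
    simp only [max_self, mul_one, Finset.sum_const, Finset.card_univ, Fintype.card_fin,
      nsmul_eq_mul]
    rwa [hq, inv_div] at hTle

end TypeCodes

/-! ### Stirling's formula and entropies of type classes. -/

section Asymptotics

open Filter Topology

/-- The error is stated in terms of `m` so that it is uniform over all n ≤ m, including n = 0, and
negligible after division by `m`. -/
theorem abs_log_factorial_sub_le {n m : ℕ} (hnm : n ≤ m) (hm : m ≠ 0) :
    |Real.log n.factorial - (n * Real.log n - n)| ≤ 1 + Real.log m := by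
  have hm1 : (1 : ℝ) ≤ m := by exact_mod_cast Nat.one_le_iff_ne_zero.2 hm
  have hlm : 0 ≤ Real.log m := Real.log_nonneg hm1
  rcases Nat.eq_zero_or_pos n with rfl | hn
  · simp only [Nat.factorial_zero, Nat.cast_one, Real.log_one, Nat.cast_zero, zero_mul, sub_self,
      abs_zero]
    linarith
  have hn1 : (1 : ℝ) ≤ n := by exact_mod_cast hn
  have hln : 0 ≤ Real.log n := Real.log_nonneg hn1
  have hle : Real.log n ≤ Real.log m := Real.log_le_log (by linarith) (by exact_mod_cast hnm)
  rw [abs_le]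
  constructor
  · have h1 := Stirling.le_log_factorial_stirling hn.ne'
    have h2 : 0 ≤ Real.log (2 * Real.pi) := Real.log_nonneg (by linarith [Real.pi_gt_three])
    linarith
  · have h1 := Stirling.log_stirlingSeq_formula n
    have h2 := Stirling.log_stirlingSeq_formula 1
    obtain ⟨k, rfl⟩ := Nat.exists_eq_succ_of_ne_zero hn.ne'
    -- The Stirling sequence decreases, so its first term bounds all others from above.
    have h3 := Stirling.log_stirlingSeq'_antitone (Nat.zero_le k)
    simp only [Function.comp_apply] at h3
    rw [Real.log_mul two_ne_zero (by positivity), Real.log_div (by positivity)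
      (Real.exp_pos 1).ne', Real.log_exp] at h1
    simp only [Nat.factorial_one, Nat.cast_one, Real.log_one, mul_one, one_mul, one_div,
      Real.log_inv, Real.log_exp] at h2
    have h4 : Real.log (Stirling.stirlingSeq (Nat.succ 0)) =
      0 - 2⁻¹ * Real.log 2 - -1 := h2
    have h5 : 0 ≤ Real.log 2 := Real.log_nonneg (by norm_num)
    linarith

/-- The subtracted term uses log m instead of log k, so these terms cancel between numerator and
denominator of a multinomial coefficient. -/
theorem tendsto_log_factorial {k : ℕ → ℕ} {r : ℝ} (hk : ∀ m, k m ≤ m)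
    (h : Tendsto (fun m => (k m : ℝ) / m) atTop (𝓝 r)) :
    Tendsto (fun m => (Real.log (k m).factorial - k m * Real.log m) / m) atTop
      (𝓝 (-Real.negMulLog r - r)) := by
  have h1 : Tendsto (fun m : ℕ => (1 + Real.log m) / m) atTop (𝓝 0) := by
    have h2 := (Real.isLittleO_log_id_atTop.tendsto_div_nhds_zero.comp
      (tendsto_natCast_atTop_atTop (R := ℝ))).const_add 0
    have h3 := tendsto_one_div_atTop_nhds_zero_nat.add h2
    simp only [add_zero] at h3
    refine h3.congr fun m => ?_
    simp [add_div]
  have h2 : Tendsto (fun m => (Real.log (k m).factorial - (k m * Real.log (k m) - k m)) / m) atTop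
      (𝓝 0) := by
    refine squeeze_zero_norm' ((eventually_ne_atTop 0).mono fun m hm => ?_) h1
    rw [norm_div, Real.norm_eq_abs, Real.norm_natCast]
    exact div_le_div_of_nonneg_right (abs_log_factorial_sub_le (hk m) hm) (Nat.cast_nonneg m)
  have h3 := (((Real.continuous_negMulLog.tendsto r).comp h).neg.sub h).add h2
  rw [add_zero] at h3
  refine h3.congr' ((eventually_ne_atTop 0).mono fun m hm => ?_)
  have hm' : (m : ℝ) ≠ 0 := Nat.cast_ne_zero.2 hm
  simp only [Function.comp_apply, Real.negMulLog]
  rcases Nat.eq_zero_or_pos (k m) with h0 | h0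
  · simp [h0]
  rw [Real.log_div (Nat.cast_ne_zero.2 h0.ne') hm']
  field_simp
  ring

theorem tendsto_floor_mul_div {c : ℝ} (hc : 0 ≤ c) :
    Tendsto (fun m : ℕ => (⌊c * m⌋₊ : ℝ) / m) atTop (𝓝 c) :=
  (tendsto_nat_floor_mul_div_atTop hc).comp tendsto_natCast_atTop_atTop

theorem tendsto_sum_floor {Γ : Type*} {r : Γ → ℝ} (hr : ∀ a, 0 ≤ r a) (s : Finset Γ) :
    Tendsto (fun m : ℕ => ((∑ a ∈ s, ⌊r a * m⌋₊ : ℕ) : ℝ) / m) atTop (𝓝 (∑ a ∈ s, r a)) := by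
  refine (tendsto_finsetSum s fun a _ => tendsto_floor_mul_div (hr a)).congr fun m => ?_
  rw [Nat.cast_sum, Finset.sum_div]

theorem sum_floor_le {Γ : Type*} [Fintype Γ] {r : Γ → ℝ} (hr : ∀ a, 0 ≤ r a) (hr1 : ∑ a, r a = 1) (s : Finset Γ) (m : ℕ) :
    ∑ a ∈ s, ⌊r a * m⌋₊ ≤ m := by
  have h1 : ((∑ a ∈ s, ⌊r a * m⌋₊ : ℕ) : ℝ) ≤ m := by
    rw [Nat.cast_sum]
    calc ∑ a ∈ s, (⌊r a * m⌋₊ : ℝ) ≤ ∑ a ∈ s, r a * m :=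
          Finset.sum_le_sum fun a _ => Nat.floor_le (mul_nonneg (hr a) (Nat.cast_nonneg m))
      _ ≤ ∑ a, r a * m := Finset.sum_le_sum_of_subset_of_nonneg (Finset.subset_univ s)
          fun a _ _ => mul_nonneg (hr a) (Nat.cast_nonneg m)
      _ = m := by rw [← Finset.sum_mul, hr1, one_mul]
  exact_mod_cast h1

variable {Γ C : Type} [Fintype Γ] [DecidableEq Γ] [Fintype C] [DecidableEq C]

/-- The logarithm of the size of the type class of words in which `φ` takes the value `c`
as often as the letter counts `n` prescribe. -/
noncomputable def logTypeSize (n : Γ → ℕ) (φ : Γ → C) : ℝ :=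
  Real.log (typeClass fun i : (Σ a, Fin (n a)) => φ i.1).card

theorem logTypeSize_eq (n : Γ → ℕ) (φ : Γ → C) :
    logTypeSize n φ = Real.log (∑ a, n a).factorial -
      ∑ c, Real.log (∑ a with φ a = c, n a).factorial := by
  have h := card_typeClass_mul fun i : (Σ a, Fin (n a)) => φ i.1
  have hc : ∀ c, Fintype.card {i : (Σ a, Fin (n a)) // φ i.1 = c} = ∑ a with φ a = c, n a := by
    intro c
    rw [Fintype.card_congr (Equiv.subtypeSigmaEquiv (fun a => Fin (n a)) fun a => φ a = c),
      Fintype.card_sigma]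
    simp only [Fintype.card_fin]
    exact (Finset.sum_subtype _ (by simp) n).symm
  simp only [hc, Fintype.card_sigma, Fintype.card_fin] at h
  have h2 := congrArg (fun k : ℕ => Real.log k) h
  simp only [Nat.cast_mul, Nat.cast_prod] at h2
  rw [Real.log_mul (Nat.cast_ne_zero.2 (card_typeClass_pos _).ne')
    (Finset.prod_ne_zero_iff.2 fun c _ => Nat.cast_ne_zero.2 (Nat.factorial_ne_zero _)),
    Real.log_prod fun c _ => Nat.cast_ne_zero.2 (Nat.factorial_ne_zero _)] at h2
  rw [logTypeSize]
  linarith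

/-- The entropy of the image of `r` under `φ`. -/
noncomputable def mapEntropy (r : Γ → ℝ) (φ : Γ → C) : ℝ :=
  ∑ c, Real.negMulLog (∑ a with φ a = c, r a)

theorem tendsto_logTypeSize {r : Γ → ℝ} (hr : ∀ a, 0 ≤ r a) (hr1 : ∑ a, r a = 1) (φ : Γ → C) :
    Tendsto (fun m : ℕ => logTypeSize (fun a => ⌊r a * m⌋₊) φ / m) atTop (𝓝 (mapEntropy r φ)) := by
  have h1 := tendsto_log_factorial (sum_floor_le hr hr1 Finset.univ)
    (tendsto_sum_floor hr Finset.univ)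
  have h2 := tendsto_finsetSum Finset.univ fun (c : C) _ =>
    tendsto_log_factorial (sum_floor_le hr hr1 (Finset.univ.filter fun a => φ a = c))
      (tendsto_sum_floor hr _)
  have h3 := h1.sub h2
  have hfib : ∀ {M : Type} [AddCommMonoid M] (f : Γ → M), ∑ c, ∑ a with φ a = c, f a = ∑ a, f a :=
    fun f => Finset.sum_fiberwise Finset.univ φ f
  have e : -Real.negMulLog (∑ a, r a) - ∑ a, r a -
      ∑ c, (-Real.negMulLog (∑ a with φ a = c, r a) - ∑ a with φ a = c, r a) = mapEntropy r φ := by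
    rw [Finset.sum_sub_distrib, hfib, hr1, Finset.sum_neg_distrib, Real.negMulLog_one, mapEntropy]
    ring
  rw [e] at h3
  refine h3.congr fun m => ?_
  rw [logTypeSize_eq, ← Finset.sum_div, ← sub_div, Finset.sum_sub_distrib, ← Finset.sum_mul,
    ← Nat.cast_sum, hfib]
  congr 1
  ring

end Asymptotics

/-! ### Divergence vectors are limits of attainable points. -/

section DivergenceVectorsAttainable

open Filter Topology

variable {b₀ b₁ N : ℕ} {P : Matrix (Fin b₀) (Fin b₁) ℝ}

theorem log_prod_sigma {Γ : Type} [Fintype Γ] (n : Γ → ℕ) (p : Γ → ℝ) (hp : ∀ a, n a ≠ 0 → p a ≠ 0) :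
    Real.log (∏ i : (Σ a, Fin (n a)), p i.1) = ∑ a, n a * Real.log (p a) := by
  have h0 : ∀ i ∈ (Finset.univ : Finset (Σ a, Fin (n a))), p i.1 ≠ 0 := fun i _ =>
    hp i.1 fun h => by
      have := i.2.2
      omega
  rw [Real.log_prod h0, Fintype.sum_sigma]
  simp

theorem logAttainable_of_counts (hP : IsProbMatrix P) (n : Fin N × Fin b₀ × Fin b₁ → ℕ)
    (hn : ∀ a, n a ≠ 0 → P a.2.1 a.2.2 ≠ 0) (hpos : 0 < ∑ a, n a) :
    ((∑ a, n a : ℕ) : ℝ)⁻¹ •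
      (-(logTypeSize n (fun a => (a.1, a.2.1)) - logTypeSize n (fun a => a.1)
          + ∑ a, n a * Real.log (rowMarg P a.2.1)),
        -(logTypeSize n (fun a => (a.1, a.2.2)) - logTypeSize n (fun a => a.1)
          + ∑ a, n a * Real.log (colMarg P a.2.2)),
        -(logTypeSize n (fun a => a.2) + ∑ a, n a * Real.log (P a.2.1 a.2.2) - Real.log 2),
        Real.log 2 + (logTypeSize n (fun a => a.2) + logTypeSize n (fun a => a.1)
          - logTypeSize n (fun a => (a.2, a.1)))) ∈ logAttainable P := by
  have hPpos : ∀ a, n a ≠ 0 → 0 < P a.2.1 a.2.2 := fun a ha =>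
    lt_of_le_of_ne (hP.1 _ _) (hn a ha).symm
  have hrow : ∀ a, n a ≠ 0 → 0 < rowMarg P a.2.1 := fun a ha =>
    Finset.sum_pos' (fun k _ => hP.1 _ k) ⟨a.2.2, Finset.mem_univ _, hPpos a ha⟩
  have hcol : ∀ a, n a ≠ 0 → 0 < colMarg P a.2.2 := fun a ha =>
    Finset.sum_pos' (fun j _ => hP.1 j _) ⟨a.2.1, Finset.mem_univ _, hPpos a ha⟩
  have hne : ∀ i : (Σ a, Fin (n a)), n i.1 ≠ 0 := fun i h => by
    have := i.2.2
    omega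
  have hprod : 0 < ∏ i : (Σ a, Fin (n a)), P i.1.2.1 i.1.2.2 :=
    Finset.prod_pos fun i _ => hPpos _ (hne i)
  have hprow : 0 < ∏ i : (Σ a, Fin (n a)), rowMarg P i.1.2.1 :=
    Finset.prod_pos fun i _ => hrow _ (hne i)
  have hpcol : 0 < ∏ i : (Σ a, Fin (n a)), colMarg P i.1.2.2 :=
    Finset.prod_pos fun i _ => hcol _ (hne i)
  have hcls : ∀ {C : Type} [DecidableEq C] (φ : Fin N × Fin b₀ × Fin b₁ → C),
      (0 : ℝ) < (typeClass fun i : (Σ a, Fin (n a)) => φ i.1).card := fun φ =>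
    Nat.cast_pos.2 (card_typeClass_pos _)
  have hL := hcls fun a => a.1
  have hX := hcls fun a => a.2
  have hL0 := hcls fun a => (a.1, a.2.1)
  have hL1 := hcls fun a => (a.1, a.2.2)
  have hXL := hcls fun a => (a.2, a.1)
  have hatt := (attainableOn_typeCode (P := P) (fun i : (Σ a, Fin (n a)) => i.1.1)
    (fun i => i.1.2) (fun i => hrow _ (hne i)) (fun i => hcol _ (hne i)) hprod.le).attainable hP
    (by positivity) (by positivity) (by positivity)
  refine ⟨_, _, _, _, _, ?_, ?_, hatt, ?_⟩
  · simpa using hpos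
  · positivity
  · simp only [Fintype.card_sigma, Fintype.card_fin]
    congr 1
    simp only [Prod.mk.injEq]
    rw [Real.log_inv, Real.log_inv, Real.log_mul (by positivity) hprow.ne',
      Real.log_mul (by positivity) hpcol.ne', Real.log_div hL0.ne' hL.ne',
      Real.log_div hL1.ne' hL.ne', Real.log_div (by positivity) two_ne_zero,
      Real.log_mul hX.ne' hprod.ne', Real.log_mul two_ne_zero (by positivity),
      Real.log_div (by positivity) hXL.ne', Real.log_mul hX.ne' hL.ne',
      log_prod_sigma n (fun a => rowMarg P a.2.1) fun a ha => (hrow a ha).ne',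
      log_prod_sigma n (fun a => colMarg P a.2.2) fun a ha => (hcol a ha).ne',
      log_prod_sigma n (fun a => P a.2.1 a.2.2) hn]
    exact ⟨rfl, rfl, rfl, rfl⟩

/-- Type codes with letter counts ⌊r m⌋. In the limit the bucket probabilities give conditional
entropies given the label plus log-probabilities, which are minus the marginal divergences. The work
exponent is the mutual information H(X) + H(L) - H(X, L) of letter pair and label, which equals the
last coordinate; the factor 2 of the code vanishes. -/
theorem divergenceVectors_subset_closure (hP : IsProbMatrix P) (N : ℕ) :
    divergenceVectors P N ⊆ closure (logAttainable P) := by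
  rintro _ ⟨R, hR, rfl⟩
  have hdiv := fun i => finiteFamilies.finiteDiv hR i
  set r : Fin N × Fin b₀ × Fin b₁ → ℝ := fun a => R a.1 a.2.1 a.2.2 with hrdef
  have hr : ∀ a, 0 ≤ r a := fun a => hR.1 _ _ _
  have hr1 : ∑ a, r a = 1 := by
    rw [Fintype.sum_prod_type]
    simp only [Fintype.sum_prod_type]
    exact hR.2.1
  set n : ℕ → Fin N × Fin b₀ × Fin b₁ → ℕ := fun m a => ⌊r a * m⌋₊ with hn
  have hlin : ∀ p : Fin N × Fin b₀ × Fin b₁ → ℝ,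
      Tendsto (fun m : ℕ => (∑ a, (n m a : ℝ) * p a) / m) atTop (𝓝 (∑ a, r a * p a)) := by
    intro p
    refine (tendsto_finsetSum Finset.univ fun a _ =>
      (tendsto_floor_mul_div (hr a)).mul_const (p a)).congr fun m => ?_
    rw [Finset.sum_div]
    exact Finset.sum_congr rfl fun a _ => by ring
  have hconst : Tendsto (fun m : ℕ => Real.log 2 / m) atTop (𝓝 0) :=
    tendsto_const_div_atTop_nhds_zero_nat _
  have hd := tendsto_sum_floor hr Finset.univ
  rw [hr1] at hd
  have hinv := hd.inv₀ one_ne_zero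
  rw [inv_one] at hinv
  have hE : ∀ {C : Type} [Fintype C] [DecidableEq C] (φ : Fin N × Fin b₀ × Fin b₁ → C),
      Tendsto (fun m : ℕ => logTypeSize (n m) φ / m) atTop (𝓝 (mapEntropy r φ)) :=
    fun φ => tendsto_logTypeSize hr hr1 φ
  have t0 := (((hE fun a => (a.1, a.2.1)).sub (hE fun a => a.1)).add
    (hlin fun a => Real.log (rowMarg P a.2.1))).neg
  have t1 := (((hE fun a => (a.1, a.2.2)).sub (hE fun a => a.1)).add
    (hlin fun a => Real.log (colMarg P a.2.2))).neg
  have t2 := (((hE fun a => a.2).add (hlin fun a => Real.log (P a.2.1 a.2.2))).sub hconst).neg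
  have t3 := hconst.add (((hE fun a => a.2).add (hE fun a => a.1)).sub (hE fun a => (a.2, a.1)))
  have hlim := hinv.smul (t0.prodMk_nhds (t1.prodMk_nhds (t2.prodMk_nhds t3)))
  rw [one_smul] at hlim
  -- marginals of the limiting distribution
  have m1 : ∀ i, ∑ a with a.1 = i, r a = ∑ j, ∑ k, R i j k := by
    intro i
    rw [Finset.sum_filter]
    simp only [Fintype.sum_prod_type]
    rw [Finset.sum_eq_single i (fun b _ hb => by simp [hb]) (by simp)]
    simp [hrdef]
  have m2 : ∀ jk : Fin b₀ × Fin b₁, ∑ a with a.2 = jk, r a = ∑ i, R i jk.1 jk.2 := by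
    intro jk
    rw [Finset.sum_filter]
    rw [Fintype.sum_prod_type]
    refine Finset.sum_congr rfl fun i _ => ?_
    rw [Finset.sum_eq_single jk (fun b _ hb => by simp [hb]) (by simp)]
    simp [hrdef]
  have m3 : ∀ ij : Fin N × Fin b₀, ∑ a with (a.1, a.2.1) = ij, r a = rowMarg (R ij.1) ij.2 := by
    rintro ⟨i, j⟩
    rw [Finset.sum_filter]
    simp only [Fintype.sum_prod_type, Prod.mk.injEq]
    rw [Finset.sum_eq_single i (fun b _ hb => by simp [hb]) (by simp),
      Finset.sum_eq_single j (fun b _ hb => by simp [hb]) (by simp)]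
    simp [hrdef, rowMarg]
  have m4 : ∀ ik : Fin N × Fin b₁, ∑ a with (a.1, a.2.2) = ik, r a = colMarg (R ik.1) ik.2 := by
    rintro ⟨i, k⟩
    rw [Finset.sum_filter]
    simp only [Fintype.sum_prod_type, Prod.mk.injEq]
    rw [Finset.sum_eq_single i (fun b _ hb => by simp [hb]) (by simp)]
    refine Finset.sum_congr rfl fun j _ => ?_
    rw [Finset.sum_eq_single k (fun b _ hb => by simp [hb]) (by simp)]
    simp [hrdef]
  have m5 : ∀ x : (Fin b₀ × Fin b₁) × Fin N, ∑ a with (a.2, a.1) = x, r a =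
      R x.2 x.1.1 x.1.2 := by
    rintro ⟨⟨j, k⟩, i⟩
    rw [Finset.sum_filter, Finset.sum_eq_single (i, j, k) (fun b _ hb => if_neg fun h => hb ?_)
      (by simp)]
    · simp [hrdef]
    · rw [Prod.mk.injEq] at h
      exact Prod.ext h.2 h.1
  -- the divergences in terms of entropies
  have k0 : ∀ i, klRow (R i) P = Real.negMulLog (∑ j, ∑ k, R i j k) -
      ∑ j, Real.negMulLog (rowMarg (R i) j) - ∑ j, rowMarg (R i) j * Real.log (rowMarg P j) :=
    fun i => kl_eq (hdiv i).row_nonneg ((hdiv i).row_eq_zero hP)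
  have k1 : ∀ i, klCol (R i) P = Real.negMulLog (∑ j, ∑ k, R i j k) -
      ∑ k, Real.negMulLog (colMarg (R i) k) - ∑ k, colMarg (R i) k * Real.log (colMarg P k) := by
    intro i
    rw [← sum_colMarg]
    exact kl_eq (hdiv i).col_nonneg ((hdiv i).col_eq_zero hP)
  have kJ : ∀ Q, FiniteDiv P Q → klJoint Q P = Real.negMulLog (∑ j, ∑ k, Q j k) -
      ∑ j, ∑ k, Real.negMulLog (Q j k) - ∑ j, ∑ k, Q j k * Real.log (P j k) := by
    intro Q hQ
    have := kl_eq (r := fun jk : Fin b₀ × Fin b₁ => Q jk.1 jk.2) (p := fun jk => P jk.1 jk.2)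
      (fun _ => hQ.nonneg _ _) (fun _ => hQ.eq_zero _ _)
    simp only [Fintype.sum_prod_type] at this
    exact this
  have k2 := kJ _ (FiniteDiv.sum fun i (_ : i ∈ Finset.univ) => hdiv i)
  have hmass : ∑ j, ∑ k, (∑ i, R i) j k = 1 := (mem_finiteFamilies_iff.1 hR).2
  rw [hmass, Real.negMulLog_one] at k2
  simp only [Matrix.sum_apply] at k2
  have hr' : ∀ i j k, r (i, j, k) = R i j k := fun _ _ _ => rfl
  have v0 : -(mapEntropy r (fun a => (a.1, a.2.1)) - mapEntropy r (fun a => a.1) +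
      ∑ a, r a * Real.log (rowMarg P a.2.1)) = ∑ i, klRow (R i) P := by
    simp only [mapEntropy, m1, m3]
    simp only [k0, Finset.sum_sub_distrib, Fintype.sum_prod_type, rowMarg,
      Finset.sum_mul, hr']
    ring
  have v1 : -(mapEntropy r (fun a => (a.1, a.2.2)) - mapEntropy r (fun a => a.1) +
      ∑ a, r a * Real.log (colMarg P a.2.2)) = ∑ i, klCol (R i) P := by
    have e : ∀ i, ∑ k, colMarg (R i) k * Real.log (colMarg P k) =
        ∑ j, ∑ k, R i j k * Real.log (colMarg P k) := by
      intro i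
      rw [Finset.sum_comm]
      exact Finset.sum_congr rfl fun k _ => by rw [colMarg, Finset.sum_mul]
    simp only [mapEntropy, m1, m4]
    simp only [k1, Finset.sum_sub_distrib, Fintype.sum_prod_type, e, hr']
    ring
  have hsw : ∑ i, ∑ j, ∑ k, R i j k * Real.log (P j k) =
      ∑ j, ∑ k, (∑ i, R i j k) * Real.log (P j k) := by
    rw [Finset.sum_comm]
    refine Finset.sum_congr rfl fun j _ => ?_
    rw [Finset.sum_comm]
    exact Finset.sum_congr rfl fun k _ => by rw [Finset.sum_mul]
  have v2 : -(mapEntropy r (fun a => a.2) + ∑ a, r a * Real.log (P a.2.1 a.2.2) - 0) =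
      klJoint (∑ i, R i) P := by
    rw [k2, ← hsw]
    simp only [mapEntropy, m2]
    simp only [Fintype.sum_prod_type, hr']
    ring
  have v3 : 0 + (mapEntropy r (fun a => a.2) + mapEntropy r (fun a => a.1) -
      mapEntropy r (fun a => (a.2, a.1))) =
      -klJoint (∑ i, R i) P + ∑ i, klJoint (R i) P := by
    have e : ∑ j, ∑ k, ∑ i, Real.negMulLog (R i j k) = ∑ i, ∑ j, ∑ k, Real.negMulLog (R i j k) := by
      symm
      rw [Finset.sum_comm]
      exact Finset.sum_congr rfl fun j _ => Finset.sum_comm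
    rw [k2, ← hsw]
    simp only [mapEntropy, m1, m2, m5]
    simp only [Fintype.sum_prod_type, kJ _ (hdiv _),
      Finset.sum_sub_distrib, e]
    ring
  rw [v0, v1, v2, v3] at hlim
  -- Rounding down may leave no letters for small `m`; eventually the word length is positive.
  have hdpos := hd.eventually (lt_mem_nhds one_pos)
  refine mem_closure_of_tendsto hlim ((hdpos.and (eventually_gt_atTop 0)).mono ?_)
  rintro m ⟨hm, hm0⟩
  have hm0' : (0 : ℝ) < m := Nat.cast_pos.2 hm0
  have hsum : 0 < ∑ a, n m a := by
    rcases Nat.eq_zero_or_pos (∑ a, n m a) with h0 | h0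
    · simp only [hn] at h0
      rw [h0] at hm
      simp at hm
    · exact h0
  have hmem := logAttainable_of_counts hP (n m) (fun a ha hPa => ha (by
    simp [hn, hrdef, (hdiv a.1).eq_zero _ _ hPa])) hsum
  have hd0 : ((∑ a, n m a : ℕ) : ℝ) ≠ 0 := Nat.cast_ne_zero.2 hsum.ne'
  convert hmem using 1
  simp only [Prod.smul_mk, smul_eq_mul, Prod.mk.injEq]
  change (((∑ a, n m a : ℕ) : ℝ) / m)⁻¹ * _ = _ ∧ (((∑ a, n m a : ℕ) : ℝ) / m)⁻¹ * _ = _ ∧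
    (((∑ a, n m a : ℕ) : ℝ) / m)⁻¹ * _ = _ ∧ (((∑ a, n m a : ℕ) : ℝ) / m)⁻¹ * _ = _
  refine ⟨?_, ?_, ?_, ?_⟩ <;> field_simp

end DivergenceVectorsAttainable

/-! ### Compactness of convex hulls in finite dimension. -/

section CompactHull

/-- By Carathéodory, the hull is the image of a compact set: the simplex on dimension plus one
vertices times a power of `s`. -/
theorem IsCompact.convexHull_of_finiteDimensional {E : Type*} [NormedAddCommGroup E]
    [NormedSpace ℝ E] [FiniteDimensional ℝ E] {s : Set E} (hs : IsCompact s) :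
    IsCompact (convexHull ℝ s) := by
  set n := Module.finrank ℝ E + 1
  have hK : IsCompact (stdSimplex ℝ (Fin n) ×ˢ Set.univ.pi fun _ : Fin n => s) :=
    (isCompact_stdSimplex ℝ (Fin n)).prod (isCompact_univ_pi fun _ => hs)
  have hc : Continuous fun p : (Fin n → ℝ) × (Fin n → E) => ∑ i, p.1 i • p.2 i := by fun_prop
  convert hK.image hc using 1
  ext x
  constructor
  · intro hx
    obtain ⟨ι, _, z, w, hz, hli, hw, hw1, rfl⟩ := eq_pos_convex_span_of_mem_convexHull hx
    have hcard : Fintype.card ι ≤ Fintype.card (Fin n) := by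
      rw [Fintype.card_fin]
      refine hli.card_le_finrank_succ.trans (Nat.succ_le_succ (Submodule.finrank_le _))
    obtain ⟨ψ⟩ := Function.Embedding.nonempty_of_card_le hcard
    have hne : Nonempty ι := by
      by_contra h
      rw [not_nonempty_iff] at h
      simp at hw1
    obtain ⟨i₀⟩ := hne
    -- Unused slots get weight zero, but their points must still lie in `s`, hence the filler `z
    -- i₀`.
    refine ⟨(Function.extend ψ w 0, Function.extend ψ z fun _ => z i₀), ⟨⟨fun a => ?_, ?_⟩,
      fun a _ => ?_⟩, ?_⟩
    · by_cases h : ∃ i, ψ i = a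
      · obtain ⟨i, rfl⟩ := h
        simpa only [ψ.injective.extend_apply] using (hw i).le
      · simp only [Function.extend_apply' _ _ _ h, Pi.zero_apply, le_refl]
    · rw [← hw1]
      exact sum_extend_zero ψ w (fun c => c) rfl
    · by_cases h : ∃ i, ψ i = a
      · obtain ⟨i, rfl⟩ := h
        simpa only [ψ.injective.extend_apply] using hz ⟨i, rfl⟩
      · simpa only [Function.extend_apply' _ _ _ h] using hz ⟨i₀, rfl⟩
    · refine (Fintype.sum_of_injective ψ ψ.injective _ _ (fun a ha => ?_) fun i => ?_).symm
      · simp only [Function.extend_apply' _ _ _ fun ⟨i, hi⟩ => ha ⟨i, hi⟩, Pi.zero_apply, zero_smul]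
      · simp only [ψ.injective.extend_apply]
  · rintro ⟨⟨w, z⟩, ⟨⟨hw, hw1⟩, hz⟩, rfl⟩
    exact (convex_convexHull ℝ s).sum_mem (fun i _ => hw i) hw1
      fun i _ => subset_convexHull ℝ s (hz i (Set.mem_univ i))

end CompactHull

/-! ### Separation, and the first two descriptions. -/

section Duality

variable {b₀ b₁ : ℕ} {P : Matrix (Fin b₀) (Fin b₁) ℝ}

theorem isCompact_divergenceVectors (hP : IsProbMatrix P) (N : ℕ) :
    IsCompact (divergenceVectors P N) := by
  refine (isCompact_finiteFamilies P N).image_of_continuousOn ?_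
  have hdiv : ∀ R ∈ finiteFamilies P N, ∀ i, FiniteDiv P (R i) := fun R hR i =>
    finiteFamilies.finiteDiv hR i
  have hJ : ∀ f : (Fin N → Matrix (Fin b₀) (Fin b₁) ℝ) → Matrix (Fin b₀) (Fin b₁) ℝ,
      Continuous f → (∀ R ∈ finiteFamilies P N, FiniteDiv P (f R)) →
      ContinuousOn (fun R => klJoint (f R) P) (finiteFamilies P N) := fun f hf h =>
    continuousOn_kl (continuous_pi fun jk => (continuous_apply_apply jk.1 jk.2).comp hf)
      (fun R hR jk => (h R hR).nonneg _ _) fun R hR jk => (h R hR).eq_zero _ _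
  have hrow : ∀ i, ContinuousOn (fun R : Fin N → Matrix (Fin b₀) (Fin b₁) ℝ => klRow (R i) P)
      (finiteFamilies P N) := by
    intro i
    refine continuousOn_kl (continuous_pi fun j => ?_) (fun R hR => (hdiv R hR i).row_nonneg)
      fun R hR => (hdiv R hR i).row_eq_zero hP
    exact continuous_finsetSum _ fun k _ => (continuous_apply_apply j k).comp (continuous_apply i)
  have hcol : ∀ i, ContinuousOn (fun R : Fin N → Matrix (Fin b₀) (Fin b₁) ℝ => klCol (R i) P)
      (finiteFamilies P N) := by
    intro i
    refine continuousOn_kl (continuous_pi fun k => ?_) (fun R hR => (hdiv R hR i).col_nonneg)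
      fun R hR => (hdiv R hR i).col_eq_zero hP
    exact continuous_finsetSum _ fun j _ => (continuous_apply_apply j k).comp (continuous_apply i)
  have hjoint := fun i => hJ (fun R => R i) (continuous_apply i) fun R hR => hdiv R hR i
  have htot := hJ (fun R => ∑ i, R i) (by fun_prop) fun R hR => FiniteDiv.sum fun i _ => hdiv R hR i
  fun_prop

theorem divergenceVectors_one {Q : Matrix (Fin b₀) (Fin b₁) ℝ} (hQ : IsProbMatrix Q)
    (h : ∀ j k, P j k = 0 → Q j k = 0) :
    (klRow Q P, klCol Q P, klJoint Q P, 0) ∈ divergenceVectors P 1 := by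
  refine ⟨fun _ => Q, mem_finiteFamilies_iff.2 ⟨fun _ => ⟨hQ.1, h⟩, ?_⟩, ?_⟩
  · simpa [totalMass_apply] using hQ.2
  · simp

theorem one_le_mul_of_isProbMatrix (hP : IsProbMatrix P) : 1 ≤ b₀ * b₁ := by
  obtain ⟨R, hR⟩ := finiteFamilies_nonempty hP
  rcases Nat.eq_zero_or_pos (b₀ * b₁) with h | h
  · have : IsEmpty (Fin (b₀ * b₁)) := by rw [h]; infer_instance
    have := hR.2.1
    simp at this
  · exact h

/-- A closed convex set that absorbs the common core and contains the divergence vectors contains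
all points satisfying the bucketing information bounds. -/
theorem infoPolar_subset (hP : IsProbMatrix P) {C : Set (ℝ × ℝ × ℝ × ℝ)} (hconv : Convex ℝ C)
    (hcl : IsClosed C) (hcore : ∀ z ∈ C, ∀ y ∈ commonCore, z + y ∈ C)
    (hdiv : divergenceVectors P (b₀ * b₁) ⊆ C) : infoPolar P ⊆ C := by
  rintro ⟨m₀, m₁, s, w⟩ ⟨hs, hx⟩
  by_contra hxC
  obtain ⟨f, u, hfx, hfC⟩ := geometric_hahn_banach_point_closed hconv hcl hxC
  set a := f (1, 0, 0, 0)
  set b := f (0, 1, 0, 0)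
  set c := f (0, 0, 1, 0)
  set e := f (0, 0, 0, 1)
  have hf : ∀ p q r t : ℝ, f (p, q, r, t) = p * a + q * b + r * c + t * e := by
    intro p q r t
    have : ((p, q, r, t) : ℝ × ℝ × ℝ × ℝ) = p • (1, 0, 0, 0) + q • (0, 1, 0, 0) +
        r • (0, 0, 1, 0) + t • (0, 0, 0, 1) := by simp
    rw [this, map_add, map_add, map_add, map_smul, map_smul, map_smul, map_smul]
    rfl
  have hz := hdiv (divergenceVectors_mono (one_le_mul_of_isProbMatrix hP)
    (divergenceVectors_one hP fun _ _ h => h))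
  -- Otherwise a large multiple of `y` added to a point of `C` would push `f` down to `u`.
  have hpos : ∀ y ∈ commonCore, 0 ≤ f y := by
    intro y hy
    by_contra hneg
    have hneg' : f y < 0 := not_le.1 hneg
    set z : ℝ × ℝ × ℝ × ℝ := (klRow P P, klCol P P, klJoint P P, 0)
    have hfz := hfC z hz
    set t := (f z - u) / -f y
    have ht : 0 ≤ t := div_nonneg (by linarith) (by linarith)
    have h1 := hfC _ (hcore z hz _ (convCone_smul_mem ht hy))
    rw [map_add, map_smul, smul_eq_mul] at h1
    have h2 : t * f y = -(f z - u) := by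
      simp only [t]
      rw [div_neg, neg_mul, div_mul_cancel₀ _ hneg'.ne]
    linarith
  have g1 := hpos (1, 0, 0, 1) (mem_commonCore_iff.2 (by norm_num))
  have g2 := hpos (0, 1, 0, 1) (mem_commonCore_iff.2 (by norm_num))
  have g3 := hpos (0, 0, 1, 0) (mem_commonCore_iff.2 (by norm_num))
  have g4 := hpos (0, 0, 0, 1) (mem_commonCore_iff.2 (by norm_num))
  have g5 := hpos (-1, -1, 0, -1) (mem_commonCore_iff.2 (by norm_num))
  rw [hf] at g1 g2 g3 g4 g5 hfx
  have he : 0 ≤ e := by linarith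
  rcases he.eq_or_lt with he | he
  -- A functional without `w` component can only see `s`; it is refuted by s ≥ 0 and by the vector
  -- of `P` itself, whose joint divergence is zero.
  · have ha : a = 0 := by linarith
    have hb : b = 0 := by linarith
    have h1 := hfC _ hz
    rw [hf, klJoint_self hP, ha, hb] at h1
    rw [ha, hb, ← he] at hfx
    have : 0 ≤ s * c := mul_nonneg hs (by linarith)
    linarith
  -- After division by `e`, positivity on the core generators becomes the constraints on λ₀, λ₁, μ,
  -- and a maximizing family gives the contradicting divergence vector.
  · obtain ⟨R, hR, hRI⟩ := (isGreatest_bucketingInfo hP (-a / e) (-b / e) (c / e)).1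
    have h1 := hfC _ (hdiv ⟨R, hR, rfl⟩)
    simp only [hf] at h1
    have h2 := hx (-a / e) (-b / e) (c / e) ((div_le_one he).2 (by linarith))
      ((div_le_one he).2 (by linarith)) (by rw [← add_div, one_le_div he]; linarith)
      (div_nonneg (by linarith) he.le)
    rw [← hRI, infoObjective] at h2
    have h3 := mul_le_mul_of_nonneg_left h2 he.le
    have e1 : e * (-a / e) = -a := by field_simp
    have e2 : e * (-b / e) = -b := by field_simp
    have e3 : e * (c / e) = c := by field_simp
    simp only [mul_sub, mul_add, ← mul_assoc, e1, e2, e3, sub_mul, mul_one] at h3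
    linarith

theorem closure_logAttainable_eq_infoPolar (hP : IsProbMatrix P) :
    closure (logAttainable P) = infoPolar P :=
  Set.Subset.antisymm
    (closure_minimal (logAttainable_subset_infoPolar hP) (isClosed_infoPolar P))
    (infoPolar_subset hP (convex_closure_logAttainable hP) isClosed_closure
      (fun _ hz _ hy => closure_logAttainable_add_core hP hz hy)
      (divergenceVectors_subset_closure hP _))

theorem convex_commonCore : Convex ℝ commonCore := fun _ hx _ hy _ _ ha hb _ =>
  convCone_add_mem (convCone_smul_mem ha hx) (convCone_smul_mem hb hy)

/-- Core plus hull is closed, as the sum of a closed and a compact set, so the separation result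
applies to it as well. -/
theorem closure_logAttainable_eq_core_add (hP : IsProbMatrix P) {N : ℕ} (hN : b₀ * b₁ ≤ N) :
    closure (logAttainable P) = commonCore + convexHull ℝ (divergenceVectors P N) := by
  refine Set.Subset.antisymm ?_ ?_
  · rw [closure_logAttainable_eq_infoPolar hP]
    refine infoPolar_subset hP (convex_commonCore.add (convex_convexHull ℝ _))
      (isClosed_commonCore.add_right_of_isCompact
        (isCompact_divergenceVectors hP N).convexHull_of_finiteDimensional) ?_ ?_
    · rintro _ ⟨y, hy, z, hz, rfl⟩ y' hy'
      exact ⟨y + y', convCone_add_mem hy hy', z, hz, add_right_comm y y' z⟩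
    · intro z hz
      exact ⟨0, convCone_zero_mem _, z,
        subset_convexHull ℝ _ (divergenceVectors_mono hN hz), zero_add z⟩
  · rintro _ ⟨y, hy, z, hz, rfl⟩
    have hz' : z ∈ closure (logAttainable P) :=
      convexHull_min (divergenceVectors_subset_closure hP N) (convex_closure_logAttainable hP) hz
    have := closure_logAttainable_add_core hP hz' hy
    rwa [add_comm] at this

end Duality

/-! ### Second-order cost of removing a small mass. -/

section Perturbation

open Filter Topology

/-- From log x ≤ x - 1 the divergence is at most a chi-square expression, in which the first-order
terms in ε cancel. -/
theorem kl_sub_le {ι : Type*} [Fintype ι] {p q : ι → ℝ} (hp : ∀ j, 0 ≤ p j) (hp1 : ∑ j, p j = 1)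
    (hq1 : ∑ j, q j = 1) (hpq : ∀ j, p j = 0 → q j = 0) {ε : ℝ} (hε2 : ε ≤ 1 / 2)
    (hle : ∀ j, ε * q j ≤ p j) :
    kl (fun j => p j - ε * q j) p ≤ 2 * ε ^ 2 * ∑ j, q j ^ 2 / p j := by
  have hsum : ∑ j, (p j - ε * q j) = 1 - ε := by
    rw [Finset.sum_sub_distrib, ← Finset.mul_sum, hp1, hq1, mul_one]
  have hX : 0 ≤ ∑ j, q j ^ 2 / p j :=
    Finset.sum_nonneg fun j _ => div_nonneg (sq_nonneg _) (hp j)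
  have hterm : ∀ j, (p j - ε * q j) * Real.log ((p j - ε * q j) / ((1 - ε) * p j)) ≤
      (p j - 2 * ε * q j + ε ^ 2 * (q j ^ 2 / p j)) / (1 - ε) - (p j - ε * q j) := by
    intro j
    have h1e : 0 < 1 - ε := by linarith
    rcases (hp j).eq_or_lt with h0 | h0
    · simp [← h0, hpq j h0.symm]
    have hr : 0 ≤ p j - ε * q j := sub_nonneg.2 (hle j)
    have h1 : (p j - ε * q j) * Real.log ((p j - ε * q j) / ((1 - ε) * p j)) ≤
        (p j - ε * q j) * ((p j - ε * q j) / ((1 - ε) * p j) - 1) := by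
      rcases hr.eq_or_lt with h2 | h2
      · simp [← h2]
      · exact mul_le_mul_of_nonneg_left
          (Real.log_le_sub_one_of_pos (div_pos h2 (mul_pos h1e h0))) hr
    refine h1.trans (le_of_eq ?_)
    field_simp
    ring
  have h2 := Finset.sum_le_sum fun j (_ : j ∈ Finset.univ) => hterm j
  rw [Finset.sum_sub_distrib, ← Finset.sum_div, Finset.sum_add_distrib, Finset.sum_sub_distrib,
    ← Finset.mul_sum, ← Finset.mul_sum, hp1, hq1, hsum] at h2
  rw [kl, hsum]
  refine h2.trans ?_
  rw [mul_one, sub_le_iff_le_add, div_le_iff₀ (by linarith)]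
  nlinarith [mul_nonneg (mul_nonneg (sq_nonneg ε) hX) (by linarith : (0 : ℝ) ≤ 1 - 2 * ε),
    sq_nonneg ε]

theorem tendsto_kl_sub_div {ι : Type*} [Fintype ι] {p q : ι → ℝ} (hp : ∀ j, 0 ≤ p j)
    (hp1 : ∑ j, p j = 1) (hq1 : ∑ j, q j = 1) (hpq : ∀ j, p j = 0 → q j = 0)
    (hle : ∀ᶠ ε : ℝ in 𝓝[>] 0, ∀ j, ε * q j ≤ p j) :
    Tendsto (fun ε : ℝ => ε⁻¹ * kl (fun j => p j - ε * q j) p) (𝓝[>] 0) (𝓝 0) := by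
  have hlim : Tendsto (fun ε : ℝ => 2 * ε * ∑ j, q j ^ 2 / p j) (𝓝[>] 0) (𝓝 0) := by
    have : Continuous fun ε : ℝ => 2 * ε * ∑ j, q j ^ 2 / p j := by fun_prop
    have := (this.tendsto 0).mono_left (nhdsWithin_le_nhds (s := Set.Ioi 0))
    simpa using this
  have hsmall : ∀ᶠ ε : ℝ in 𝓝[>] 0, ε ≤ 1 / 2 :=
    nhdsWithin_le_nhds (Iic_mem_nhds (by norm_num))
  refine tendsto_of_tendsto_of_tendsto_of_le_of_le' tendsto_const_nhds hlim ?_ ?_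
  · filter_upwards [hle, eventually_mem_nhdsWithin] with ε h1 h2
    refine mul_nonneg (inv_nonneg.2 (le_of_lt h2)) (kl_nonneg (fun j => sub_nonneg.2 (h1 j)) hp hp1
      fun j h => by rw [h, hpq j h, mul_zero, sub_zero])
  · filter_upwards [hle, hsmall, eventually_mem_nhdsWithin] with ε h1 h2 h3
    have h3' : (0 : ℝ) < ε := h3
    refine (mul_le_mul_of_nonneg_left (kl_sub_le hp hp1 hq1 hpq h2 h1)
      (inv_nonneg.2 h3'.le)).trans (le_of_eq ?_)
    field_simp

end Perturbation

/-! ### The cone for unlimited data. -/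

section UnlimitedData

open Filter Topology

variable {b₀ b₁ : ℕ} {P : Matrix (Fin b₀) (Fin b₁) ℝ} {x y : ℝ × ℝ × ℝ × ℝ}

theorem extendedCore_add_mem (hx : x ∈ extendedCore) (hy : y ∈ extendedCore) :
    x + y ∈ extendedCore := by
  obtain ⟨a, b, c, e⟩ := x
  obtain ⟨a', b', c', e'⟩ := y
  rw [mem_extendedCore_iff] at hx hy
  obtain ⟨⟨h1, h2, h3⟩, h4, h5, h6⟩ := hx
  obtain ⟨⟨k1, k2, k3⟩, k4, k5, k6⟩ := hy
  rw [Prod.mk_add_mk, Prod.mk_add_mk, Prod.mk_add_mk, mem_extendedCore_iff]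
  refine ⟨⟨?_, ?_, ?_⟩, ?_, ?_, ?_⟩ <;> linarith

theorem extendedCore_smul_mem {t : ℝ} (ht : 0 ≤ t) (hx : x ∈ extendedCore) :
    t • x ∈ extendedCore := by
  obtain ⟨a, b, c, e⟩ := x
  rw [mem_extendedCore_iff] at hx
  obtain ⟨⟨h1, h2, h3⟩, h4, h5, h6⟩ := hx
  rw [Prod.smul_mk, Prod.smul_mk, Prod.smul_mk, mem_extendedCore_iff]
  simp only [smul_eq_mul, ← mul_add]
  exact ⟨⟨mul_le_mul_of_nonneg_left h1 ht, mul_le_mul_of_nonneg_left h2 ht,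
    mul_le_mul_of_nonneg_left h3 ht⟩, mul_le_mul_of_nonneg_left h4 ht,
    mul_le_mul_of_nonneg_left h5 ht, mul_le_mul_of_nonneg_left h6 ht⟩

theorem isClosed_extendedCore : IsClosed extendedCore := by
  have e : extendedCore = ({x | x.1 ≤ x.2.2.2} ∩ ({x | x.2.1 ≤ x.2.2.2} ∩
      {x | x.1 + x.2.1 ≤ x.2.2.2})) ∩ ({x | x.1 ≤ x.2.2.2 + x.2.2.1} ∩
      ({x | x.2.1 ≤ x.2.2.2 + x.2.2.1} ∩ {x | x.1 + x.2.1 ≤ x.2.2.2 + x.2.2.1})) := by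
    ext ⟨m₀, m₁, s, w⟩
    rw [mem_extendedCore_iff]
    rfl
  rw [e]
  refine ((isClosed_le ?_ ?_).inter ((isClosed_le ?_ ?_).inter (isClosed_le ?_ ?_))).inter
    ((isClosed_le ?_ ?_).inter ((isClosed_le ?_ ?_).inter (isClosed_le ?_ ?_))) <;> fun_prop

theorem commonCore_subset_extendedCore : commonCore ⊆ extendedCore := by
  rintro ⟨a, b, c, e⟩ h
  obtain ⟨h1, h2, h3, h4⟩ := mem_commonCore_iff.1 h
  rw [mem_extendedCore_iff]
  refine ⟨⟨?_, ?_, ?_⟩, ?_, ?_, ?_⟩ <;> linarith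

theorem closure_convCone_add_mem {A : Set (ℝ × ℝ × ℝ × ℝ)} (hx : x ∈ closure (convCone A))
    (hy : y ∈ closure (convCone A)) : x + y ∈ closure (convCone A) :=
  map_mem_closure₂ (f := fun x y : ℝ × ℝ × ℝ × ℝ => x + y) (by fun_prop) hx hy
    fun _ hx _ hy => convCone_add_mem hx hy

theorem closure_convCone_smul_mem {A : Set (ℝ × ℝ × ℝ × ℝ)} {c : ℝ} (hc : 0 ≤ c)
    (hx : x ∈ closure (convCone A)) : c • x ∈ closure (convCone A) :=
  map_mem_closure (f := fun x : ℝ × ℝ × ℝ × ℝ => c • x) (by fun_prop) hx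
    fun _ hx => convCone_smul_mem hc hx

theorem closure_singleDivergence_bounds (hP : IsProbMatrix P)
    (hx : x ∈ closure (convCone (singleDivergenceVectors P))) :
    0 ≤ x.1 ∧ x.1 ≤ x.2.2.1 ∧ 0 ≤ x.2.1 ∧ x.2.1 ≤ x.2.2.1 ∧ x.2.2.2 = 0 := by
  have hcl : IsClosed {x : ℝ × ℝ × ℝ × ℝ |
      0 ≤ x.1 ∧ x.1 ≤ x.2.2.1 ∧ 0 ≤ x.2.1 ∧ x.2.1 ≤ x.2.2.1 ∧ x.2.2.2 = 0} := by
    change IsClosed ({x : ℝ × ℝ × ℝ × ℝ | 0 ≤ x.1} ∩ ({x | x.1 ≤ x.2.2.1} ∩ ({x | 0 ≤ x.2.1} ∩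
      ({x | x.2.1 ≤ x.2.2.1} ∩ {x | x.2.2.2 = 0}))))
    refine (isClosed_le ?_ ?_).inter ((isClosed_le ?_ ?_).inter ((isClosed_le ?_ ?_).inter
      ((isClosed_le ?_ ?_).inter (isClosed_eq ?_ ?_)))) <;> fun_prop
  refine closure_minimal (convCone_subset ?_ (by simp) ?_ ?_) hcl hx
  · rintro _ ⟨Q, ⟨hQ, h⟩, rfl⟩
    have hd : FiniteDiv P Q := ⟨hQ.1, h⟩
    exact ⟨klRow_nonneg hP hd, klRow_le_klJoint hP hd, klCol_nonneg hP hd, klCol_le_klJoint hP hd,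
      rfl⟩
  · rintro x ⟨h1, h2, h3, h4, h5⟩ y ⟨k1, k2, k3, k4, k5⟩
    simp only [Set.mem_ofPred_eq, Prod.fst_add, Prod.snd_add]
    refine ⟨?_, ?_, ?_, ?_, ?_⟩ <;> linarith
  · rintro c hc x ⟨h1, h2, h3, h4, h5⟩
    simp only [Set.mem_ofPred_eq, Prod.smul_fst, Prod.smul_snd, smul_eq_mul]
    exact ⟨mul_nonneg hc h1, mul_le_mul_of_nonneg_left h2 hc, mul_nonneg hc h3,
      mul_le_mul_of_nonneg_left h4 hc, by rw [h5, mul_zero]⟩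

/-- A sum of closed cones can fail to be closed when large parts cancel. Here the only dangerous
direction of the divergence cone is (1, 1, 1, 0). If it is present, the sum is an intersection of
two half-spaces; if not, near a given point only a bounded part of that cone contributes, and closed
plus compact is closed. -/
theorem isClosed_extendedCore_add (hP : IsProbMatrix P) :
    IsClosed (extendedCore + closure (convCone (singleDivergenceVectors P))) := by
  set L := closure (convCone (singleDivergenceVectors P)) with hL
  have hLcl : IsClosed L := isClosed_closure
  by_cases hv : ((1, 1, 1, 0) : ℝ × ℝ × ℝ × ℝ) ∈ L
  · have e : extendedCore + L = {x | x.1 ≤ x.2.2.2 + x.2.2.1} ∩ {x | x.2.1 ≤ x.2.2.2 + x.2.2.1} := by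
      ext ⟨m₀, m₁, s, w⟩
      constructor
      · rintro ⟨⟨p, q, r, t⟩, hy, ⟨a, b, c, z⟩, hl, hxy⟩
        obtain ⟨h1, h2, h3, h4, h5⟩ := closure_singleDivergence_bounds hP hl
        obtain ⟨-, k1, k2, -⟩ := mem_extendedCore_iff.1 hy
        simp only [Prod.mk_add_mk, Prod.mk.injEq] at hxy
        obtain ⟨rfl, rfl, rfl, rfl⟩ := hxy
        dsimp only at h1 h2 h3 h4 h5
        exact ⟨show p + a ≤ t + z + (r + c) by linarith, show q + b ≤ t + z + (r + c) by linarith⟩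
      · rintro ⟨h1, h2⟩
        dsimp only [Set.mem_ofPred_eq] at h1 h2
        set τ := |s| + |m₀| + |m₁| + |w| with hτ
        have a1 := le_abs_self s
        have a2 := le_abs_self m₀
        have a3 := le_abs_self m₁
        have a4 := neg_abs_le w
        have a5 := abs_nonneg s
        have a6 := abs_nonneg m₀
        have a7 := abs_nonneg m₁
        have a8 := abs_nonneg w
        have a9 := neg_abs_le s
        refine ⟨(m₀ - τ, m₁ - τ, s - τ, w), mem_extendedCore_iff.2 ⟨⟨?_, ?_, ?_⟩, ?_, ?_, ?_⟩,
          τ • (1, 1, 1, 0), closure_convCone_smul_mem (by linarith) hv, ?_⟩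
        any_goals linarith
        simp
    rw [e]
    refine (isClosed_le ?_ ?_).inter (isClosed_le ?_ ?_) <;> fun_prop
  · have hcomp : ∀ B : ℝ, IsCompact (L ∩ {x | x.2.2.1 ≤ B}) := by
      intro B
      have hbox : IsCompact (Set.Icc (0 : ℝ) B ×ˢ Set.Icc (0 : ℝ) B ×ˢ Set.Icc (0 : ℝ) B ×ˢ
          ({0} : Set ℝ)) :=
        isCompact_Icc.prod (isCompact_Icc.prod (isCompact_Icc.prod isCompact_singleton))
      refine hbox.of_isClosed_subset (hLcl.inter (isClosed_le (by fun_prop) (by fun_prop))) ?_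
      rintro x ⟨hx, hxB⟩
      obtain ⟨h1, h2, h3, h4, h5⟩ := closure_singleDivergence_bounds hP hx
      have hxB' : x.2.2.1 ≤ B := hxB
      exact ⟨⟨h1, h2.trans hxB'⟩, ⟨h3, h4.trans hxB'⟩, ⟨h1.trans h2, hxB'⟩, h5⟩
    -- On the compact slice where the third coordinate is 1, its excess over the smaller of the
    -- first two is positive, hence bounded below; homogeneity extends this to `L`.
    obtain ⟨δ, hδ, hδL⟩ : ∃ δ : ℝ, 0 < δ ∧ ∀ x ∈ L, δ * x.2.2.1 ≤ x.2.2.1 - min x.1 x.2.1 := by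
      have hS : IsCompact ((L ∩ {x | x.2.2.1 ≤ 1}) ∩ {x | x.2.2.1 = 1}) :=
        (hcomp 1).inter_right (isClosed_eq (by fun_prop) (by fun_prop))
      obtain ⟨δ, hδ, h⟩ := hS.exists_forall_le' (f := fun x => x.2.2.1 - min x.1 x.2.1) (a := 0)
        (Continuous.continuousOn (by fun_prop)) (by
          rintro ⟨a, b, c, z⟩ ⟨⟨hx, -⟩, hc⟩
          obtain ⟨h1, h2, h3, h4, h5⟩ := closure_singleDivergence_bounds hP hx
          dsimp only [Set.mem_ofPred_eq] at h1 h2 h3 h4 h5 hc ⊢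
          by_contra hneg
          have hmin : c ≤ min a b := by linarith
          have ha : a = 1 := by linarith [hmin.trans (min_le_left a b)]
          have hb : b = 1 := by linarith [hmin.trans (min_le_right a b)]
          rw [ha, hb, hc, h5] at hx
          exact hv hx)
      refine ⟨δ, hδ, fun x hx => ?_⟩
      obtain ⟨h1, h2, h3, h4, h5⟩ := closure_singleDivergence_bounds hP hx
      rcases (h1.trans h2).eq_or_lt with h0 | h0
      · rw [← h0, mul_zero, zero_sub]
        exact neg_nonneg.2 ((min_le_left _ _).trans (h2.trans h0.ge))
      · have h6 := h (x.2.2.1⁻¹ • x) ⟨⟨closure_convCone_smul_mem (inv_pos.2 h0).le hx,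
          le_of_eq (inv_mul_cancel₀ h0.ne')⟩, inv_mul_cancel₀ h0.ne'⟩
        simp only [Prod.smul_fst, Prod.smul_snd, smul_eq_mul] at h6
        rw [← mul_min_of_nonneg _ _ (inv_pos.2 h0).le, ← mul_sub] at h6
        have h7 := mul_le_mul_of_nonneg_right h6 h0.le
        rwa [mul_right_comm, inv_mul_cancel₀ h0.ne', one_mul] at h7
    refine isClosed_of_closure_subset fun x hx => ?_
    -- The core contributes nonnegatively to this excess, so on the neighbourhood `U` it bounds the
    -- summand from `L`.
    set B := x.2.2.2 + x.2.2.1 - min x.1 x.2.1 + 1 with hB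
    set U : Set (ℝ × ℝ × ℝ × ℝ) := {z | z.2.2.2 + z.2.2.1 - min z.1 z.2.1 < B}
    have hU : IsOpen U := isOpen_lt (by fun_prop) (by fun_prop)
    have hxU : x ∈ U := show x.2.2.2 + x.2.2.1 - min x.1 x.2.1 < B from lt_add_one _
    have hx2 := hU.inter_closure ⟨hxU, hx⟩
    have hsub : U ∩ (extendedCore + L) ⊆ extendedCore + (L ∩ {x | x.2.2.1 ≤ B / δ}) := by
      rintro _ ⟨hzU, ⟨p, q, r, t⟩, hy, ⟨a, b, c, z⟩, hl, rfl⟩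
      refine ⟨_, hy, _, ⟨hl, ?_⟩, rfl⟩
      obtain ⟨h1, h2, h3, h4, h5⟩ := closure_singleDivergence_bounds hP hl
      obtain ⟨-, k1, k2, -⟩ := mem_extendedCore_iff.1 hy
      have h6 := hδL _ hl
      have h7 : t + z + (r + c) - min (p + a) (q + b) < B := hzU
      dsimp only [Set.mem_ofPred_eq] at h1 h2 h3 h4 h5 h6 ⊢
      rw [le_div_iff₀ hδ]
      have h8 := min_le_left (p + a) (q + b)
      have h9 := min_le_right (p + a) (q + b)
      rcases min_choice a b with h | h <;> rw [h] at h6 <;> linarith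
    have hx3 := (isClosed_extendedCore.add_right_of_isCompact (hcomp (B / δ))).closure_subset_iff.2
      hsub hx2
    exact Set.add_subset_add_left Set.inter_subset_left hx3

theorem divergenceVectors_subset_extendedCore_add (hP : IsProbMatrix P) (N : ℕ) :
    divergenceVectors P N ⊆ extendedCore + closure (convCone (singleDivergenceVectors P)) := by
  rintro _ ⟨R, hR, rfl⟩
  have hdiv := fun i => finiteFamilies.finiteDiv hR i
  have hle := klJoint_sum_le Finset.univ hP fun i (_ : i ∈ Finset.univ) => hdiv i
  have hone : ∀ i, (klRow (R i) P, klCol (R i) P, klJoint (R i) P, (0 : ℝ)) ∈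
      convCone (singleDivergenceVectors P) := by
    intro i
    rcases (hdiv i).totalMass_nonneg.eq_or_lt with h0 | h0
    · rw [(hdiv i).eq_zero_of_totalMass h0.symm, klRow_zero, klCol_zero, klJoint_zero]
      exact convCone_zero_mem _
    · set c := totalMass b₀ b₁ (R i)
      have hQ : IsProbMatrix (c⁻¹ • R i) := by
        refine ⟨((hdiv i).smul (inv_pos.2 h0).le).nonneg, ?_⟩
        rw [← totalMass_apply, map_smul, smul_eq_mul]
        exact inv_mul_cancel₀ h0.ne'
      have hQmem : (klRow (c⁻¹ • R i) P, klCol (c⁻¹ • R i) P, klJoint (c⁻¹ • R i) P, (0 : ℝ)) ∈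
          singleDivergenceVectors P :=
        ⟨c⁻¹ • R i, ⟨hQ, ((hdiv i).smul (inv_pos.2 h0).le).eq_zero⟩, rfl⟩
      have hm := convCone_smul_mem h0.le (subset_convCone _ hQmem)
      simpa only [klRow_smul, klCol_smul, klJoint_smul, Prod.smul_mk, smul_eq_mul, mul_zero,
        mul_inv_cancel_left₀ h0.ne'] using hm
  have hsum : ∑ i, (klRow (R i) P, klCol (R i) P, klJoint (R i) P, (0 : ℝ)) ∈
      convCone (singleDivergenceVectors P) :=
    Submodule.sum_mem (PointedCone.hull ℝ (singleDivergenceVectors P)) fun i _ => hone i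
  -- By subadditivity the defect is a nonnegative multiple of (0, 0, -1, 1); the rest is a sum of
  -- single divergence vectors.
  refine ⟨(0, 0, klJoint (∑ i, R i) P - ∑ i, klJoint (R i) P,
    -klJoint (∑ i, R i) P + ∑ i, klJoint (R i) P), mem_extendedCore_iff.2 ?_, _,
    subset_closure hsum, ?_⟩
  · refine ⟨⟨?_, ?_, ?_⟩, ?_, ?_, ?_⟩ <;> linarith
  · simp [Prod.ext_iff, Prod.fst_sum, Prod.snd_sum]

theorem logAttainableCone_subset (hP : IsProbMatrix P) :
    logAttainableCone P ⊆ {x : ℝ × ℝ × ℝ × ℝ | 0 ≤ x.2.2.1} ∩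
      (extendedCore + closure (convCone (singleDivergenceVectors P))) := by
  intro x hx
  obtain ⟨c, hc, z, hz, rfl⟩ := mem_logAttainableCone_iff.1 hx
  refine ⟨mul_nonneg hc (logAttainable_subset_infoPolar hP hz).1, ?_⟩
  have hconv : Convex ℝ (extendedCore + closure (convCone (singleDivergenceVectors P))) :=
    Convex.add (fun _ hx _ hy _ _ ha hb _ =>
      extendedCore_add_mem (extendedCore_smul_mem ha hx) (extendedCore_smul_mem hb hy))
      fun _ hx _ hy _ _ ha hb _ =>
        closure_convCone_add_mem (closure_convCone_smul_mem ha hx) (closure_convCone_smul_mem hb hy)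
  have hz' := subset_closure hz
  rw [closure_logAttainable_eq_core_add hP le_rfl] at hz'
  obtain ⟨y, hy, v, hv, rfl⟩ := hz'
  obtain ⟨y', hy', l, hl, rfl⟩ :=
    convexHull_min (divergenceVectors_subset_extendedCore_add hP _) hconv hv
  refine ⟨c • (y + y'), extendedCore_smul_mem hc
    (extendedCore_add_mem (commonCore_subset_extendedCore hy) hy'), c • l,
    closure_convCone_smul_mem hc hl, ?_⟩
  simp only [smul_add, add_assoc]

/-- The family {εQ, P - εQ} has total `P`, so its success exponent is zero. Scaled by 1/ε, the first
member contributes the divergences of `Q`, with the joint one counted as work, and the second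
contributes O(ε). -/
theorem single_split_mem_closure_cone (hP : IsProbMatrix P) {Q : Matrix (Fin b₀) (Fin b₁) ℝ}
    (hQ : IsProbMatrix Q) (h : ∀ j k, P j k = 0 → Q j k = 0) :
    (klRow Q P, klCol Q P, 0, klJoint Q P) ∈ closure (logAttainableCone P) := by
  have hd : FiniteDiv P Q := ⟨hQ.1, h⟩
  have hsmall : ∀ᶠ ε : ℝ in 𝓝[>] 0, ∀ j k, ε * Q j k ≤ P j k := by
    refine eventually_all.2 fun j => eventually_all.2 fun k => ?_
    rcases (hP.1 j k).eq_or_lt with h0 | h0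
    · exact Eventually.of_forall fun ε => by rw [h j k h0.symm, mul_zero, ← h0]
    · have hc : Tendsto (fun ε : ℝ => ε * Q j k) (𝓝[>] 0) (𝓝 0) := by
        have : Continuous fun ε : ℝ => ε * Q j k := by fun_prop
        have := (this.tendsto 0).mono_left (nhdsWithin_le_nhds (s := Set.Ioi 0))
        simpa using this
      exact (hc.eventually (gt_mem_nhds h0)).mono fun _ h => h.le
  have erow : ∀ ε : ℝ, klRow (P - ε • Q) P =
      kl (fun j => rowMarg P j - ε * rowMarg Q j) (rowMarg P) := by
    intro ε
    rw [klRow]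
    congr 1
    ext j
    simp [rowMarg, Finset.mul_sum]
  have ecol : ∀ ε : ℝ, klCol (P - ε • Q) P =
      kl (fun k => colMarg P k - ε * colMarg Q k) (colMarg P) := by
    intro ε
    rw [klCol]
    congr 1
    ext k
    simp [colMarg, Finset.mul_sum]
  have trow := tendsto_kl_sub_div hP.row_nonneg hP.row_sum hQ.row_sum (hd.row_eq_zero hP)
    (hsmall.mono fun ε h j => by
      rw [rowMarg, Finset.mul_sum]
      exact Finset.sum_le_sum fun k _ => h j k)
  have tcol := tendsto_kl_sub_div hP.col_nonneg hP.col_sum hQ.col_sum (hd.col_eq_zero hP)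
    (hsmall.mono fun ε h k => by
      rw [colMarg, Finset.mul_sum]
      exact Finset.sum_le_sum fun j _ => h j k)
  have tjoint := tendsto_kl_sub_div (p := fun jk : Fin b₀ × Fin b₁ => P jk.1 jk.2)
    (q := fun jk => Q jk.1 jk.2) (fun _ => hP.1 _ _)
    (by rw [Fintype.sum_prod_type]; exact hP.2) (by rw [Fintype.sum_prod_type]; exact hQ.2)
    (fun _ => h _ _) (hsmall.mono fun ε h jk => h _ _)
  have hlim := (trow.const_add (klRow Q P)).prodMk_nhds ((tcol.const_add (klCol Q P)).prodMk_nhds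
    ((tendsto_const_nhds (x := (0 : ℝ)) (f := 𝓝[>] (0 : ℝ))).prodMk_nhds
      (tjoint.const_add (klJoint Q P))))
  simp only [add_zero] at hlim
  rw [← closure_closure]
  refine mem_closure_of_tendsto hlim ?_
  filter_upwards [hsmall, eventually_mem_nhdsWithin] with ε hε hε0
  have hε0' : (0 : ℝ) < ε := hε0
  have hmem : (![ε • Q, P - ε • Q] : Fin 2 → Matrix (Fin b₀) (Fin b₁) ℝ) ∈ finiteFamilies P 2 := by
    refine mem_finiteFamilies_iff.2 ⟨fun i => ?_, ?_⟩
    · fin_cases i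
      · exact hd.smul hε0'.le
      · exact ⟨fun j k => sub_nonneg.2 (hε j k), fun j k h0 => by simp [h0, h j k h0]⟩
    · simp only [Fin.sum_univ_two, Matrix.cons_val_zero, Matrix.cons_val_one]
      rw [add_sub_cancel]
      exact hP.2
  have hv := smul_mem_closure_cone (inv_pos.2 hε0').le
    (divergenceVectors_subset_closure hP 2 ⟨_, hmem, rfl⟩)
  simp only [Fin.sum_univ_two, Matrix.cons_val_zero, Matrix.cons_val_one, add_sub_cancel,
    klJoint_self hP, neg_zero, zero_add, klRow_smul, klCol_smul, klJoint_smul, Prod.smul_mk,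
    smul_eq_mul, mul_add, mul_zero, inv_mul_cancel_left₀ hε0'.ne', erow, ecol] at hv
  exact hv

/-- Both extremes are kept, all of the joint divergence as success exponent or all of it as work, so
that they can later be mixed. -/
theorem closure_single_subset (hP : IsProbMatrix P)
    (hx : x ∈ closure (convCone (singleDivergenceVectors P))) :
    x ∈ closure (logAttainableCone P) ∧
      (x.1, x.2.1, 0, x.2.2.1) ∈ closure (logAttainableCone P) := by
  have hne : (logAttainable P).Nonempty := closure_nonempty_iff.1
    ⟨_, divergenceVectors_subset_closure hP 1 (divergenceVectors_one hP fun _ _ h => h)⟩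
  have hcl : IsClosed {x : ℝ × ℝ × ℝ × ℝ | x ∈ closure (logAttainableCone P) ∧
      (x.1, x.2.1, (0 : ℝ), x.2.2.1) ∈ closure (logAttainableCone P)} :=
    isClosed_closure.inter (isClosed_closure.preimage (by fun_prop))
  refine closure_minimal (convCone_subset ?_ ?_ ?_ ?_) hcl hx
  · rintro _ ⟨Q, ⟨hQ, h⟩, rfl⟩
    refine ⟨?_, single_split_mem_closure_cone hP hQ h⟩
    have := smul_mem_closure_cone zero_le_one
      (divergenceVectors_subset_closure hP 1 (divergenceVectors_one hQ h))
    rwa [one_smul] at this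
  · have h0 := commonCore_subset_closure_cone hP hne (convCone_zero_mem _)
    exact ⟨h0, h0⟩
  · rintro x ⟨h1, h2⟩ y ⟨h3, h4⟩
    refine ⟨closure_cone_add_mem hP h1 h3, ?_⟩
    simpa using closure_cone_add_mem hP h2 h4
  · rintro c hc x ⟨h1, h2⟩
    refine ⟨closure_cone_smul_mem hc h1, ?_⟩
    simpa using closure_cone_smul_mem hc h2

theorem closure_logAttainableCone_eq (hP : IsProbMatrix P) :
    closure (logAttainableCone P) = {x : ℝ × ℝ × ℝ × ℝ | 0 ≤ x.2.2.1} ∩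
      (extendedCore + closure (convCone (singleDivergenceVectors P))) := by
  have hne : (logAttainable P).Nonempty := closure_nonempty_iff.1
    ⟨_, divergenceVectors_subset_closure hP 1 (divergenceVectors_one hP fun _ _ h => h)⟩
  refine Set.Subset.antisymm (closure_minimal (logAttainableCone_subset hP)
    ((isClosed_le (by fun_prop) (by fun_prop)).inter (isClosed_extendedCore_add hP))) ?_
  rintro _ ⟨hs, ⟨p, q, r, t⟩, hy, ⟨a, b, c, z⟩, hl, rfl⟩
  obtain ⟨h1, h2⟩ := closure_single_subset hP hl
  obtain ⟨⟨k1, k2, k3⟩, k4, k5, k6⟩ := mem_extendedCore_iff.1 hy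
  obtain ⟨-, -, -, -, hz⟩ := closure_singleDivergence_bounds hP hl
  have hs' : 0 ≤ r + c := hs
  dsimp only at h1 h2 hz
  rcases le_or_gt 0 r with hr | hr
  · exact closure_cone_add_mem hP (commonCore_subset_closure_cone hP hne
      (mem_commonCore_iff.2 ⟨hr, k1, k2, k3⟩)) h1
  -- A deficit r < 0 is met by converting the fraction -r/c of the success exponent into work; s ≥ 0
  -- says that this fraction is at most one.
  · have hc : 0 < c := by linarith
    have hθ : 0 ≤ -r / c := div_nonneg (by linarith) hc.le
    have hθ' : 0 ≤ 1 - -r / c := sub_nonneg.2 ((div_le_one hc).2 (by linarith))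
    have hy' : (p, q, (0 : ℝ), t + r) ∈ commonCore :=
      mem_commonCore_iff.2 ⟨le_rfl, k4, k5, k6⟩
    have := closure_cone_add_mem hP (commonCore_subset_closure_cone hP hne hy')
      (closure_cone_add_mem hP (closure_cone_smul_mem hθ' h1) (closure_cone_smul_mem hθ h2))
    convert this using 1
    simp only [Prod.smul_mk, smul_eq_mul, Prod.mk_add_mk, Prod.mk.injEq, hz]
    refine ⟨?_, ?_, ?_, ?_⟩ <;> field_simp <;> ring

end UnlimitedData

theorem mainTheorem2 {b₀ b₁ : ℕ} (P : Matrix (Fin b₀) (Fin b₁) ℝ) (hP : IsProbMatrix P) :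
    closure (logAttainable P) =
      {(m₀, m₁, s, w) : ℝ × ℝ × ℝ × ℝ | 0 ≤ s ∧
        ∀ l₀ l₁ μ : ℝ, l₀ ≤ 1 → l₁ ≤ 1 → 1 ≤ l₀ + l₁ → 0 ≤ μ →
          w ≥ l₀ * m₀ + l₁ * m₁ - μ * s - bucketingInfo P l₀ l₁ μ} ∧
    (∀ N : ℕ, b₀ * b₁ ≤ N →
      closure (logAttainable P) = commonCore + convexHull ℝ (divergenceVectors P N)) ∧
    closure (logAttainableCone P) =
      {(_m₀, _m₁, s, _w) : ℝ × ℝ × ℝ × ℝ | 0 ≤ s} ∩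
        (extendedCore + closure (convCone (singleDivergenceVectors P))) :=
  ⟨closure_logAttainable_eq_infoPolar hP, fun _ hN => closure_logAttainable_eq_core_add hP hN,
    closure_logAttainableCone_eq hP⟩
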